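/- Let $\mathbb K=\mathbb R$ or $\mathbb K=\mathbb C$, and let $S^1=\mathbb R/\mathbb Z$ with coordinate $x$. For $\lambda\in\mathbb K$ let $\mathcal F_\lambda(S^1)$ be the space of $\lambda$-densities $\phi(x)(dx)^\lambda$ with $\phi\in C^\infty(S^1,\mathbb K)$. Let $\mathrm{Diff}(S^1)$ be the group of orientation-preserving diffeomorphisms of $S^1$, acting on $\mathcal F_\lambda(S^1)$ by $$\rho^\lambda_{f^{-1}}:\ \phi(x)(dx)^\lambda\mapsto (f'(x))^\lambda\,\phi(f(x))\,(dx)^\lambda .$$ For $\lambda,\mu\in\mathbb K$ and $k\ge 0$ let $\mathcal D^k_{\lambda,\mu}(S^1)$ be the space of linear differential operators $$A=\sum_{i=0}^k a_i(x)\frac{d^i}{dx^i}:\ \mathcal F_\lambda(S^1)\to\mathcal F_\mu(S^1),\qquad a_i\in C^\infty(S^1,\mathbb K),$$ of order at most $k$, with the action $A\mapsto\rho^\mu_f\circ A\circ\rho^\lambda_{f^{-1}}$ of $f\in\mathrm{Diff}(S^1)$. Let $\mathcal I^k_{\lambda,\mu}(S^1)$ be the associative $\mathbb K$-algebra (under composition)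 of all $\mathbb K$-linear maps $T:\mathcal D^k_{\lambda,\mu}(S^1)\to\mathcal D^k_{\lambda,\mu}(S^1)$, not necessarily local or continuous, that commute with the action of $\mathrm{Diff}(S^1)$; call it trivial if it consists of the scalar multiples of $\mathrm{Id}$. Let $\mathbb K^n$ be the algebra $\mathbb K\oplus\cdots\oplus\mathbb K$ ($n$ summands), and let $\mathfrak b$ be the algebra of all $4\times4$ matrices of the form $$\begin{pmatrix} a&0&0&d\\ 0&a&0&0\\ 0&c&b&0\\ 0&0&0&b\end{pmatrix},\qquad a,b,c,d\in\mathbb K .$$ **Theorem.** Let $k\ge5$. The algebra $\mathcal I^k_{\lambda,\mu}(S^1)$ is trivial for all $(\lambda,\mu)\in\mathbb K^2$ except in the following cases, where the isomorphisms are isomorphisms of $\mathbb K$-algebras: 1. $\mathcal I^k_{\lambda,\mu}(S^1)\cong\mathbb K^2$ if $\lambda+\mu=1$ and $\lambda\ne0$; or $\lambda=0$ and $\mu\ne 0,1$; or $\mu=1$ and $\lambda\neq 0,1$; 2. $\mathcal I^k_{0,0}(S^1)\cong\mathcal I^k_{1,1}(S^1)\cong\mathbb K^3$; 3. $\mathcal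 I^k_{0,1}(S^1)\cong\mathfrak b\oplus\mathbb K^2$. In particular, for all $k,l\ge5$ and all $(\lambda,\mu)$, the algebras $\mathcal I^k_{\lambda,\mu}(S^1)$ and $\mathcal I^l_{\lambda,\mu}(S^1)$ are isomorphic. -/

import Mathlib

open scoped ContDiff

noncomputable section

/-- The circle is `S¹ = ℝ/ℤ` with its global affine coordinate `x`; `CircleFun 𝕜` is the
algebra `C^∞(S¹, 𝕜)`, realised as the algebra of smooth `1`-periodic functions `ℝ → 𝕜`. -/
def CircleFun (𝕜 : Type*) [RCLike 𝕜] : Subalgebra 𝕜 (ℝ → 𝕜) where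
  carrier := {φ | ContDiff ℝ ∞ φ ∧ Function.Periodic φ 1}
  mul_mem' := fun ha hb => ⟨ha.1.mul hb.1, ha.2.mul hb.2⟩
  add_mem' := fun ha hb => ⟨ha.1.add hb.1, ha.2.add hb.2⟩
  algebraMap_mem' := fun _ => ⟨contDiff_const, fun _ => rfl⟩

/-- The space `F_lam(S¹)` of densities `φ(x)(dx)^lam`, a density being given by its
coefficient `φ` in the coordinate `x`. As a vector space it does not depend on `lam`;
the weight enters through the action of diffeomorphisms. -/
abbrev Density (𝕜 : Type*) [RCLike 𝕜] (_lam : 𝕜) : Type _ := CircleFun 𝕜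

/-- An orientation preserving diffeomorphism of `S¹ = ℝ/ℤ`, given by a lift to `ℝ`:
a smooth bijection `f` of `ℝ` with smooth inverse, `f' > 0` and `f (x + 1) = f x + 1`.
(Two lifts of the same diffeomorphism differ by an integer translation, which acts trivially
on periodic functions.) -/
structure CircleDiffeo where
  toEquiv : ℝ ≃ ℝ
  contDiff_toFun : ContDiff ℝ ∞ toEquiv
  contDiff_invFun : ContDiff ℝ ∞ toEquiv.symm
  deriv_pos : ∀ x, 0 < deriv toEquiv x
  map_add_one : ∀ x, toEquiv (x + 1) = toEquiv x + 1

namespace CircleDiffeo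

/-- The inverse diffeomorphism. -/
def symm (f : CircleDiffeo) : CircleDiffeo where
  toEquiv := f.toEquiv.symm
  contDiff_toFun := f.contDiff_invFun
  contDiff_invFun := f.contDiff_toFun
  deriv_pos := by
    intro x
    have hd : (∞ : WithTop ℕ∞) ≠ 0 := by simp
    have h1 : HasDerivAt f.toEquiv (deriv f.toEquiv (f.toEquiv.symm x)) (f.toEquiv.symm x) :=
      (f.contDiff_toFun.differentiable hd _).hasDerivAt
    have h2 : HasDerivAt f.toEquiv.symm (deriv f.toEquiv.symm x) x :=
      (f.contDiff_invFun.differentiable hd _).hasDerivAt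
    have h3 := h1.comp x h2
    have h4 : (f.toEquiv ∘ f.toEquiv.symm) = id := by ext y; simp
    rw [h4] at h3
    have h5 := h3.unique (hasDerivAt_id x)
    have h6 := f.deriv_pos (f.toEquiv.symm x)
    by_contra h
    nlinarith [not_lt.mp h]
  map_add_one := by
    intro x
    rw [Equiv.symm_apply_eq, f.map_add_one, Equiv.apply_symm_apply]

theorem deriv_periodic (f : CircleDiffeo) : Function.Periodic (deriv f.toEquiv) 1 := by
  intro x
  have h : (fun y => f.toEquiv (y + 1)) = fun y => f.toEquiv y + 1 := funext f.map_add_one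
  have h2 := congrArg (fun g => deriv g x) h
  simpa [deriv_comp_add_const] using h2

theorem contDiff_deriv (f : CircleDiffeo) : ContDiff ℝ ∞ (deriv f.toEquiv) :=
  (contDiff_infty_iff_deriv.mp f.contDiff_toFun).2

variable {𝕜 : Type*} [RCLike 𝕜]

/-- The function `(f')^lam = exp (lam * log f')` on `S¹`. -/
def derivPow (f : CircleDiffeo) (lam : 𝕜) : CircleFun 𝕜 :=
  ⟨fun x => NormedSpace.exp (lam * ((Real.log (deriv f.toEquiv x) : ℝ) : 𝕜)), by
    refine ⟨?_, fun x => by simp only [f.deriv_periodic x]⟩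
    have he : ContDiff ℝ ∞ (NormedSpace.exp : 𝕜 → 𝕜) := by
      have h : ContDiff 𝕜 ∞ (NormedSpace.exp : 𝕜 → 𝕜) :=
        contDiff_iff_contDiffAt.mpr fun x =>
          (NormedSpace.exp_analytic (𝕂 := 𝕜) x).contDiffAt
      exact h.restrict_scalars ℝ
    refine he.comp (contDiff_const.mul ?_)
    exact (RCLike.ofRealCLM (K := 𝕜)).contDiff.comp
      (f.contDiff_deriv.log fun x => (f.deriv_pos x).ne')⟩

/-- The composition `φ ∘ f`. -/
def pullback (f : CircleDiffeo) : CircleFun 𝕜 →ₐ[𝕜] CircleFun 𝕜 where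
  toFun φ := ⟨fun x => (φ : ℝ → 𝕜) (f.toEquiv x), φ.2.1.comp f.contDiff_toFun, fun x => by
    simp only [f.map_add_one]; exact φ.2.2 _⟩
  map_one' := rfl
  map_mul' _ _ := rfl
  map_zero' := rfl
  map_add' _ _ := rfl
  commutes' _ := rfl

/-- The operator `φ (dx)^lam ↦ (f')^lam (φ ∘ f) (dx)^lam`, that is, `ρ^lam_{f⁻¹}`. -/
def densityPullback (f : CircleDiffeo) (lam : 𝕜) : Density 𝕜 lam →ₗ[𝕜] Density 𝕜 lam :=
  LinearMap.mulLeft 𝕜 (f.derivPow lam) ∘ₗ f.pullback.toLinearMap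

/-- The action `ρ^lam_f` of a diffeomorphism on densities of weight `lam`. -/
def densityAct (f : CircleDiffeo) (lam : 𝕜) : Density 𝕜 lam →ₗ[𝕜] Density 𝕜 lam :=
  f.symm.densityPullback lam

/-- The action `A ↦ ρ^mu_f ∘ A ∘ ρ^lam_{f⁻¹}` on linear maps from densities of weight `lam` to
densities of weight `mu`. -/
def opAct (f : CircleDiffeo) (lam mu : 𝕜) :
    (Density 𝕜 lam →ₗ[𝕜] Density 𝕜 mu) →ₗ[𝕜] (Density 𝕜 lam →ₗ[𝕜] Density 𝕜 mu) where
  toFun A := f.densityAct mu ∘ₗ A ∘ₗ f.symm.densityAct lam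
  map_add' A B := by rw [LinearMap.add_comp, LinearMap.comp_add]
  map_smul' c A := by rw [LinearMap.smul_comp, LinearMap.comp_smul, RingHom.id_apply]

end CircleDiffeo

variable {𝕜 : Type*} [RCLike 𝕜]

/-- The derivative `d/dx` on `C^∞(S¹)`. -/
def ddx (𝕜 : Type*) [RCLike 𝕜] : CircleFun 𝕜 →ₗ[𝕜] CircleFun 𝕜 where
  toFun φ := ⟨deriv (φ : ℝ → 𝕜), (contDiff_infty_iff_deriv.mp φ.2.1).2, fun x => by
    have h : (fun y => (φ : ℝ → 𝕜) (y + 1)) = φ := funext φ.2.2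
    have h2 := congrArg (fun g => deriv g x) h
    simpa [deriv_comp_add_const] using h2⟩
  map_add' φ ψ := by
    ext x
    have hd : (∞ : WithTop ℕ∞) ≠ 0 := by simp
    exact deriv_add (φ.2.1.differentiable hd x) (ψ.2.1.differentiable hd x)
  map_smul' c φ := by
    ext x
    have hd : (∞ : WithTop ℕ∞) ≠ 0 := by simp
    exact deriv_const_smul c (φ.2.1.differentiable hd x)

/-- The space `D^k_{lam,mu}(S¹)` of differential operators of order at most `k` from densities
of weight `lam` to densities of weight `mu`: the linear maps `A` of the form
`A φ = ∑_{i ≤ k} a_i φ^{(i)}` with smooth coefficients `a_i`. -/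
def DiffOp (k : ℕ) (lam mu : 𝕜) : Submodule 𝕜 (Density 𝕜 lam →ₗ[𝕜] Density 𝕜 mu) where
  carrier := {A | ∃ a : ℕ → CircleFun 𝕜, ∀ φ : CircleFun 𝕜,
    A φ = ∑ i ∈ Finset.range (k + 1), a i * (ddx 𝕜)^[i] φ}
  add_mem' := by
    rintro A B ⟨a, ha⟩ ⟨b, hb⟩
    refine ⟨a + b, fun φ => ?_⟩
    rw [LinearMap.add_apply, ha, hb, ← Finset.sum_add_distrib]
    simp only [Pi.add_apply, add_mul]
  zero_mem' := ⟨0, fun φ => by simp⟩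
  smul_mem' := by
    rintro c A ⟨a, ha⟩
    refine ⟨c • a, fun φ => ?_⟩
    rw [LinearMap.smul_apply, ha, Finset.smul_sum]
    simp only [Pi.smul_apply, smul_mul_assoc]

/-- Leibniz rule. -/
theorem ddx_mul (φ ψ : CircleFun 𝕜) : ddx 𝕜 (φ * ψ) = ddx 𝕜 φ * ψ + φ * ddx 𝕜 ψ := by
  ext x
  have hd : (∞ : WithTop ℕ∞) ≠ 0 := by simp
  exact deriv_mul (φ.2.1.differentiable hd x) (ψ.2.1.differentiable hd x)

/-- Chain rule. -/
theorem ddx_pullback (f : CircleDiffeo) :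
    ∃ w : CircleFun 𝕜, ∀ φ : CircleFun 𝕜,
      ddx 𝕜 (f.pullback φ) = w * f.pullback (ddx 𝕜 φ) := by
  refine ⟨⟨fun x => ((deriv f.toEquiv x : ℝ) : 𝕜),
    (RCLike.ofRealCLM (K := 𝕜)).contDiff.comp f.contDiff_deriv,
    fun x => by simp only [f.deriv_periodic x]⟩, fun φ => ?_⟩
  ext x
  have hd : (∞ : WithTop ℕ∞) ≠ 0 := by simp
  have h1 := (φ.2.1.differentiable hd (f.toEquiv x)).hasDerivAt
  have h2 := (f.contDiff_toFun.differentiable hd x).hasDerivAt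
  have h3 := (h1.scomp x h2).deriv
  refine h3.trans ?_
  rw [RCLike.real_smul_eq_coe_mul]
  rfl

/-- The iterated derivatives of `w * (φ ∘ f)` in terms of those of `φ`. -/
theorem ddx_iterate_pullback (f : CircleDiffeo) (w : CircleFun 𝕜) (i : ℕ) :
    ∃ c : ℕ → CircleFun 𝕜, (∀ j, i < j → c j = 0) ∧ ∀ φ : CircleFun 𝕜,
      (ddx 𝕜)^[i] (w * f.pullback φ)
        = ∑ j ∈ Finset.range (i + 1), c j * f.pullback ((ddx 𝕜)^[j] φ) := by
  obtain ⟨v, hv⟩ := ddx_pullback (𝕜 := 𝕜) f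
  induction i with
  | zero =>
    refine ⟨fun j => if j = 0 then w else 0, fun j hj => if_neg hj.ne', fun φ => by simp⟩
  | succ i ih =>
    obtain ⟨c, hc0, hc⟩ := ih
    refine ⟨fun j => ddx 𝕜 (c j) + (if j = 0 then 0 else c (j - 1) * v), ?_, fun φ => ?_⟩
    · intro j hj
      have h1 : c j = 0 := hc0 j (by omega)
      have h2 : c (j - 1) = 0 := hc0 (j - 1) (by omega)
      simp [h1, h2]
    · rw [Function.iterate_succ_apply', hc, map_sum]
      simp only [ddx_mul, hv, add_mul, Finset.sum_add_distrib]
      congr 1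
      · rw [Finset.sum_range_succ _ (i + 1), hc0 (i + 1) (Nat.lt_succ_self i)]
        simp
      · rw [Finset.sum_range_succ' _ (i + 1)]
        simp [Function.iterate_succ_apply', mul_assoc]

/-- The action of diffeomorphisms preserves the order of differential operators. -/
theorem opAct_mem_DiffOp (f : CircleDiffeo) (k : ℕ) (lam mu : 𝕜)
    (A : Density 𝕜 lam →ₗ[𝕜] Density 𝕜 mu) (hA : A ∈ DiffOp k lam mu) :
    f.opAct lam mu A ∈ DiffOp k lam mu := by
  obtain ⟨a, ha⟩ := hA
  choose c hc0 hc using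
    fun i => ddx_iterate_pullback (𝕜 := 𝕜) f (f.derivPow lam) i
  refine ⟨fun j => ∑ i ∈ Finset.range (k + 1),
    f.symm.derivPow mu * f.symm.pullback (a i * c i j), fun φ => ?_⟩
  have hinv : ∀ ψ : CircleFun 𝕜, f.symm.pullback (f.pullback ψ) = ψ := by
    intro ψ
    ext x
    exact congrArg (ψ : ℝ → 𝕜) (f.toEquiv.apply_symm_apply x)
  have h1 : f.opAct lam mu A φ
      = f.symm.derivPow mu * f.symm.pullback (A (f.derivPow lam * f.pullback φ)) := rfl
  rw [h1, ha, map_sum, Finset.mul_sum]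
  simp only [Finset.sum_mul]
  rw [Finset.sum_comm]
  refine Finset.sum_congr rfl fun i hi => ?_
  rw [hc i φ]
  have hsub : Finset.range (i + 1) ⊆ Finset.range (k + 1) := by
    intro j hj
    simp only [Finset.mem_range] at hi hj ⊢
    omega
  rw [Finset.sum_subset hsub (fun j _ hj => by
    rw [hc0 i j (by simpa using hj), zero_mul])]
  rw [Finset.mul_sum, map_sum, Finset.mul_sum]
  refine Finset.sum_congr rfl fun j _ => ?_
  rw [← mul_assoc, map_mul, hinv, mul_assoc]

/-- The action of a diffeomorphism on the module `D^k_{lam,mu}(S¹)`. -/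
def diffOpAct (k : ℕ) (lam mu : 𝕜) (f : CircleDiffeo) : Module.End 𝕜 (DiffOp k lam mu) :=
  (f.opAct lam mu).restrict (opAct_mem_DiffOp f k lam mu)

/-- The algebra of symmetries `I^k_{lam,mu}(S¹)`: all linear maps (local or not, no continuity
being required) on `D^k_{lam,mu}(S¹)` that commute with the action of `Diff(S¹)`. -/
def SymmAlg (k : ℕ) (lam mu : 𝕜) : Subalgebra 𝕜 (Module.End 𝕜 (DiffOp k lam mu)) :=
  Subalgebra.centralizer 𝕜 (Set.range (diffOpAct k lam mu))

/-- The algebra `𝔟` of `4 × 4` matrices of the form below. -/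
def AlgB (𝕜 : Type*) [RCLike 𝕜] : Subalgebra 𝕜 (Matrix (Fin 4) (Fin 4) 𝕜) where
  carrier := {M | ∃ a b c d : 𝕜, M = !![a, 0, 0, d; 0, a, 0, 0; 0, c, b, 0; 0, 0, 0, b]}
  mul_mem' := by
    rintro _ _ ⟨a, b, c, d, rfl⟩ ⟨a', b', c', d', rfl⟩
    refine ⟨a * a', b * b', c * a' + b * c', a * d' + d * b', ?_⟩
    ext i j
    fin_cases i <;> fin_cases j <;> simp [Matrix.mul_apply, Fin.sum_univ_four]
  add_mem' := by
    rintro _ _ ⟨a, b, c, d, rfl⟩ ⟨a', b', c', d', rfl⟩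
    refine ⟨a + a', b + b', c + c', d + d', ?_⟩
    ext i j
    fin_cases i <;> fin_cases j <;> simp
  algebraMap_mem' := by
    intro r
    refine ⟨r, r, 0, 0, ?_⟩
    ext i j
    fin_cases i <;> fin_cases j <;> simp [Matrix.algebraMap_matrix_apply]

end

/-! Although no continuity is assumed, a symmetry T is almost local. If A vanishes near 0, it is
fixed by diffeomorphisms supported near 0, hence so is T A. Taking these to be dilations and maps x
↦ x + τ x^(M+2) near 0 kills every coefficient of T A at 0, except possibly the one of order l = mu
- lam, and that one only if l = 0, or l = 1 and lam = 0 (`coefAt_symm_eq_zero`). In the exceptional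
cases the coefficient is still locally constant, so its derivative is local.

A functional that is local at 0 and homogeneous under dilations sees only finitely many derivatives
of a coefficient. Indeed a coefficient that is flat enough at 0 is, near 0, the transform of some β
under a dilation minus a multiple of β, the multiple being the factor by which the functional scales
(`functional_mon_eq_zero_of_mem_jet`). Rotations carry this to all points. Hence T sends a d^i to
the sum of t i j a^(j) d^(i-j), plus, in the exceptional cases, a linear functional c times an
invariant operator, which is the identity if mu = lam and d/dx if (lam, mu) = (0, 1).

The functional c is invariant (`functional_invariant`). Filtered by order, it induces invariant
functionals on densities of weight mu - lam - i. There are none in weights 0, -1, -2, ..., and only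
multiples of the integral in weight 1. So c vanishes for mu = lam, and for (0, 1) it is a multiple
of A ↦ ∫ A(1).

For the local part, equivariance under x + τ x² and x + τ x³ gives linear relations between the t i
j (`locRel_of_mem`). From level i = 4 on, a level vanishes as soon as the lower ones do, so the
levels up to 3 decide. There, elimination leaves only t 0 0 free unless one of lam, mu - 1, lam + mu
- 1 is zero; in the special cases further entries stay free.

Conversely, all the freedom is realised. If lam + mu = 1 the formal adjoint is a symmetry. If lam =
0, so is A ↦ A(1), and A = A(1) + B ∘ d/dx with B of weights (1, mu), so that symmetries for (1, mu)
lift. In general the adjoint identifies the case (lam, mu) with (1 - mu, 1 - lam). For (0, 1) two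
nilpotent symmetries are added, A ↦ (∫ A(1)) d/dx and one with a d/dx ↦ a'; they produce the algebra
`AlgB`. -/

noncomputable section

open Filter Topology

variable {𝕜 : Type*} [RCLike 𝕜]

/-! ### Periodic functions, cut-offs and a periodic local coordinate -/

namespace CircleFun

theorem hasDerivAt (φ : CircleFun 𝕜) (x : ℝ) : HasDerivAt φ.1 ((ddx 𝕜 φ).1 x) x :=
  (φ.2.1.differentiable (by simp) x).hasDerivAt

theorem ddx_apply (φ : CircleFun 𝕜) (x : ℝ) : (ddx 𝕜 φ).1 x = deriv φ.1 x := rfl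

theorem ddx_iterate_apply (n : ℕ) (φ : CircleFun 𝕜) :
    ((ddx 𝕜)^[n] φ).1 = deriv^[n] φ.1 := by
  induction n with
  | zero => rfl
  | succ n ih =>
    rw [Function.iterate_succ_apply', Function.iterate_succ_apply', ← ih]
    rfl

theorem ddx_iterate_congr {φ ψ : CircleFun 𝕜} {x : ℝ} (h : φ.1 =ᶠ[𝓝 x] ψ.1) (n : ℕ) :
    ((ddx 𝕜)^[n] φ).1 =ᶠ[𝓝 x] ((ddx 𝕜)^[n] ψ).1 := by
  induction n with
  | zero => exact h
  | succ n ih =>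
    rw [Function.iterate_succ_apply', Function.iterate_succ_apply']
    exact ih.deriv

theorem exists_bound (φ : CircleFun 𝕜) : ∃ C, 0 < C ∧ ∀ x, ‖φ.1 x‖ ≤ C := by
  obtain ⟨C, hC⟩ := (isCompact_Icc (a := (0 : ℝ)) (b := 1)).exists_bound_of_continuousOn
    φ.2.1.continuous.continuousOn
  refine ⟨max C 1, by positivity, fun x => ?_⟩
  obtain ⟨y, hy, hxy⟩ := φ.2.2.exists_mem_Ico₀ one_pos x
  rw [hxy]
  exact (hC y ⟨hy.1, hy.2.le⟩).trans (le_max_left _ _)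

/-- Composition of a real periodic function with a smooth function of a real variable. -/
def comp (g : ℝ → 𝕜) (hg : ContDiff ℝ ∞ g) (η : CircleFun ℝ) : CircleFun 𝕜 :=
  ⟨fun x => g (η.1 x), hg.comp η.2.1, fun x => by simp only [η.2.2 x]⟩

/-- A real periodic function, seen as a `𝕜`-valued one. -/
def ofReal (η : CircleFun ℝ) : CircleFun 𝕜 :=
  comp (fun x => (x : 𝕜)) (RCLike.ofRealCLM (K := 𝕜)).contDiff η

@[simp] theorem ofReal_apply (η : CircleFun ℝ) (x : ℝ) :
    (ofReal (𝕜 := 𝕜) η).1 x = (η.1 x : 𝕜) := rfl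

theorem ddx_ofReal (η : CircleFun ℝ) : ddx 𝕜 (ofReal η) = ofReal (ddx ℝ η) := by
  ext x
  exact ((RCLike.ofRealCLM (K := 𝕜)).hasFDerivAt.comp_hasDerivAt x (hasDerivAt η x)).deriv

@[simp] theorem mul_val (φ ψ : CircleFun 𝕜) (x : ℝ) : (φ * ψ).1 x = φ.1 x * ψ.1 x := rfl
@[simp] theorem add_val (φ ψ : CircleFun 𝕜) (x : ℝ) : (φ + ψ).1 x = φ.1 x + ψ.1 x := rfl
@[simp] theorem sub_val (φ ψ : CircleFun 𝕜) (x : ℝ) : (φ - ψ).1 x = φ.1 x - ψ.1 x := rfl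
@[simp] theorem smul_val (c : 𝕜) (φ : CircleFun 𝕜) (x : ℝ) : (c • φ).1 x = c * φ.1 x := rfl
@[simp] theorem pow_val (φ : CircleFun 𝕜) (n : ℕ) (x : ℝ) : (φ ^ n).1 x = φ.1 x ^ n := rfl
@[simp] theorem one_val (x : ℝ) : (1 : CircleFun 𝕜).1 x = 1 := rfl
@[simp] theorem zero_val (x : ℝ) : (0 : CircleFun 𝕜).1 x = 0 := rfl
@[simp] theorem sum_val {ι : Type*} (s : Finset ι) (φ : ι → CircleFun 𝕜) (x : ℝ) :
    (∑ i ∈ s, φ i).1 x = ∑ i ∈ s, (φ i).1 x := by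
  classical
  induction s using Finset.induction_on with
  | empty => simp
  | insert i s hi ih => rw [Finset.sum_insert hi, Finset.sum_insert hi, add_val, ih]

theorem ddx_one : ddx 𝕜 (1 : CircleFun 𝕜) = 0 := by
  ext x
  exact deriv_const x (1 : 𝕜)

theorem ddx_iterate_one {n : ℕ} (hn : n ≠ 0) : (ddx 𝕜)^[n] (1 : CircleFun 𝕜) = 0 := by
  obtain ⟨m, rfl⟩ := Nat.exists_eq_succ_of_ne_zero hn
  rw [Function.iterate_succ_apply, ddx_one, iterate_map_zero]

theorem cos_periodic : Function.Periodic (fun x : ℝ => Real.cos (2 * Real.pi * x)) 1 := by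
  intro x
  simp only [mul_add, mul_one, Real.cos_add_two_pi]

/-- The function that vanishes where `cos 2πx ≤ a` and equals `1` where `b ≤ cos 2πx`. -/
def cut (a b : ℝ) : CircleFun ℝ :=
  ⟨fun x => Real.smoothTransition ((Real.cos (2 * Real.pi * x) - a) / (b - a)), by
    refine ⟨Real.smoothTransition.contDiff.comp ?_, fun x => by
      have := cos_periodic x
      simp only at this
      simp only [this]⟩
    exact (((Real.contDiff_cos.comp (contDiff_const.mul contDiff_id)).sub
      contDiff_const).div_const _)⟩

theorem cut_eq_zero {a b x : ℝ} (hab : a < b) (h : Real.cos (2 * Real.pi * x) ≤ a) :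
    (cut a b).1 x = 0 :=
  Real.smoothTransition.zero_of_nonpos (div_nonpos_of_nonpos_of_nonneg (by linarith) (by linarith))

theorem cut_eq_one {a b x : ℝ} (hab : a < b) (h : b ≤ Real.cos (2 * Real.pi * x)) :
    (cut a b).1 x = 1 :=
  Real.smoothTransition.one_of_one_le ((one_le_div (by linarith)).2 (by linarith))

theorem exists_bump (ε : ℝ) (hε : 0 < ε) : ∃ χ : CircleFun ℝ, (∀ᶠ x in 𝓝 0, χ.1 x = 1) ∧
    ∀ x, |x| ≤ 3 / 4 → ε ≤ |x| → χ.1 x = 0 := by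
  -- For ε ≤ 1/4 a point with |x| ≤ 3/4 is at distance at least ε from ±1 too, so cos 2πx ≤ cos 2πε
  -- also holds for 1/2 ≤ |x| ≤ 3/4.
  wlog h : ε ≤ 1 / 4 generalizing ε
  · obtain ⟨χ, h1, h2⟩ := this (1 / 4) (by norm_num) (by norm_num)
    exact ⟨χ, h1, fun x hx hx' => h2 x hx (by linarith)⟩
  have hc : Real.cos (2 * Real.pi * ε) < 1 := by
    have := Real.cos_lt_cos_of_nonneg_of_le_pi (x := 0) (y := 2 * Real.pi * ε) le_rfl
      (by nlinarith [Real.pi_pos]) (by positivity)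
    simpa using this
  set a := Real.cos (2 * Real.pi * ε)
  refine ⟨cut a ((a + 1) / 2), ?_, fun x hx hx' => cut_eq_zero (by linarith) ?_⟩
  · have hcont : ContinuousAt (fun x : ℝ => Real.cos (2 * Real.pi * x)) 0 := by fun_prop
    have : ∀ᶠ x in 𝓝 (0 : ℝ), (a + 1) / 2 < Real.cos (2 * Real.pi * x) :=
      hcont.eventually (lt_mem_nhds (by simp; linarith))
    filter_upwards [this] with x hx using cut_eq_one (by linarith) hx.le
  · rw [← Real.cos_abs (2 * Real.pi * x), abs_mul, abs_of_pos Real.two_pi_pos]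
    rcases le_total |x| (1 / 2) with h1 | h1
    · exact Real.cos_le_cos_of_nonneg_of_le_pi (by positivity) (by nlinarith [Real.pi_pos])
        (by nlinarith [Real.pi_pos])
    · rw [show 2 * Real.pi * |x| = 2 * Real.pi - 2 * Real.pi * (1 - |x|) by ring,
        Real.cos_two_pi_sub]
      exact Real.cos_le_cos_of_nonneg_of_le_pi (by positivity) (by nlinarith [Real.pi_pos])
        (by nlinarith [Real.pi_pos])

theorem eq_zero_of_forall_abs_le {φ : CircleFun 𝕜} (h : ∀ x, |x| ≤ 1 / 2 → φ.1 x = 0) :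
    φ = 0 := by
  ext x
  obtain ⟨y, hy, hxy⟩ := φ.2.2.exists_mem_Ico one_pos x (-(1 / 2))
  rw [hxy]
  exact h y (abs_le.2 ⟨hy.1, by linarith [hy.2]⟩)

theorem cos_pi_mul_ne_zero {x : ℝ} (h : -1 < Real.cos (2 * Real.pi * x)) :
    Real.cos (Real.pi * x) ≠ 0 := by
  intro h0
  have := Real.cos_two_mul (Real.pi * x)
  rw [h0, ← mul_assoc] at this
  norm_num at this
  linarith

/-- A periodic function with `coord x = x` for `|x| ≤ 3/8`. -/
def coord : CircleFun ℝ :=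
  -- The second factor is the sawtooth that equals x for |x| < 1/2. Its jumps, at the half-integers,
  -- lie where the cut-off vanishes, and -√2/2 = cos (2π · 3/8) is the value from which the cut-off
  -- is 1.
  ⟨fun x => (cut (-9 / 10) (-(√2 / 2))).1 x * (Real.arctan (Real.tan (Real.pi * x)) / Real.pi), by
    have hs : (-9 / 10 : ℝ) < -(√2 / 2) := by
      have : √2 < 9 / 5 := (Real.sqrt_lt' (by norm_num)).2 (by norm_num)
      linarith
    constructor
    · refine contDiff_iff_contDiffAt.2 fun x => ?_
      by_cases hx : -1 < Real.cos (2 * Real.pi * x)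
      · refine (cut _ _).2.1.contDiffAt.mul (ContDiffAt.div_const ?_ _)
        refine Real.contDiff_arctan.contDiffAt.comp x ?_
        exact (Real.contDiffAt_tan.2 (cos_pi_mul_ne_zero hx)).comp x
          (contDiff_const.mul contDiff_id).contDiffAt
      · have hcont : ContinuousAt (fun x : ℝ => Real.cos (2 * Real.pi * x)) x := by fun_prop
        have : ∀ᶠ y in 𝓝 x, Real.cos (2 * Real.pi * y) < -9 / 10 :=
          hcont.eventually (gt_mem_nhds (by linarith))
        refine (contDiffAt_const (c := (0 : ℝ))).congr_of_eventuallyEq ?_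
        filter_upwards [this] with y hy
        rw [cut_eq_zero hs hy.le, zero_mul]
    · intro x
      have h1 := (cut (-9 / 10) (-(√2 / 2))).2.2 x
      have h2 : Real.tan (Real.pi * (x + 1)) = Real.tan (Real.pi * x) := by
        rw [mul_add, mul_one, Real.tan_periodic]
      simp only [h1, h2]⟩

theorem coord_eq {x : ℝ} (hx : |x| ≤ 3 / 8) : coord.1 x = x := by
  have hs : (-9 / 10 : ℝ) < -(√2 / 2) := by
    have : √2 < 9 / 5 := (Real.sqrt_lt' (by norm_num)).2 (by norm_num)
    linarith
  have hc : -(√2 / 2) ≤ Real.cos (2 * Real.pi * x) := by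
    have h1 : Real.cos (3 * Real.pi / 4) = -(√2 / 2) := by
      rw [show 3 * Real.pi / 4 = Real.pi - Real.pi / 4 by ring, Real.cos_pi_sub,
        Real.cos_pi_div_four]
    rw [← h1, ← Real.cos_abs (2 * Real.pi * x), abs_mul, abs_of_pos Real.two_pi_pos]
    exact Real.cos_le_cos_of_nonneg_of_le_pi (by positivity) (by nlinarith [Real.pi_pos])
      (by nlinarith [Real.pi_pos])
  have h := abs_le.1 hx
  have h3 : Real.arctan (Real.tan (Real.pi * x)) = Real.pi * x :=
    Real.arctan_tan (by nlinarith [Real.pi_pos]) (by nlinarith [Real.pi_pos])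
  change (cut (-9 / 10) (-(√2 / 2))).1 x * (Real.arctan (Real.tan (Real.pi * x)) / Real.pi) = x
  rw [cut_eq_one hs hc, h3]
  field_simp

theorem coord_eventuallyEq : coord.1 =ᶠ[𝓝 0] fun x => x := by
  have : ∀ᶠ x in 𝓝 (0 : ℝ), |x| < 3 / 8 := by
    have hc : ContinuousAt (fun x : ℝ => |x|) 0 := by fun_prop
    exact hc.eventually (gt_mem_nhds (by simp))
  filter_upwards [this] with x hx using coord_eq hx.le

theorem exists_eventuallyEq (g : ℝ → 𝕜) (hg : ContDiff ℝ ∞ g) :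
    ∃ φ : CircleFun 𝕜, φ.1 =ᶠ[𝓝 0] g := by
  refine ⟨comp g hg coord, ?_⟩
  filter_upwards [coord_eventuallyEq] with x hx
  change g (coord.1 x) = g x
  rw [hx]

end CircleFun

/-! ### Construction of diffeomorphisms of the circle -/

namespace CircleDiffeo

/-- The diffeomorphism with lift `f`. -/
def ofLift (f : ℝ → ℝ) (hf : ContDiff ℝ ∞ f) (hpos : ∀ x, 0 < deriv f x)
    (hper : ∀ x, f (x + 1) = f x + 1) : CircleDiffeo :=
  have hmono : StrictMono f := strictMono_of_deriv_pos hpos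
  have hint : ∀ (n : ℕ) x, f (x + n) = f x + n := by
    intro n
    induction n with
    | zero => simp
    | succ n ih =>
      intro x
      push_cast
      rw [← add_assoc, hper, ih, add_assoc]
  have hint' : ∀ (n : ℕ) x, f (x - n) = f x - n := by
    intro n x
    have := hint n (x - n)
    rw [sub_add_cancel] at this
    linarith
  have hsurj : Function.Surjective f := by
    refine hf.continuous.surjective ?_ ?_
    · refine tendsto_atTop_atTop.2 fun b => ?_
      obtain ⟨n, hn⟩ := exists_nat_gt (b - f 0)
      refine ⟨n, fun a ha => ?_⟩
      have h1 := hmono.monotone ha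
      have h2 := hint n 0
      rw [zero_add] at h2
      linarith
    · refine tendsto_atBot_atBot.2 fun b => ?_
      obtain ⟨n, hn⟩ := exists_nat_gt (f 0 - b)
      refine ⟨-n, fun a ha => ?_⟩
      have h1 := hmono.monotone ha
      have h2 := hint' n 0
      rw [zero_sub] at h2
      linarith
  { toEquiv := (StrictMono.orderIsoOfSurjective f hmono hsurj).toEquiv
    contDiff_toFun := hf
    contDiff_invFun := by
      have := Homeomorph.contDiff_symm_deriv (n := ∞)
        (StrictMono.orderIsoOfSurjective f hmono hsurj).toHomeomorph
        (f' := deriv f) (fun x => (hpos x).ne')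
        (fun x => (hf.differentiable (by simp) x).hasDerivAt) hf
      exact this
    deriv_pos := hpos
    map_add_one := hper }

/-- Rotation of the circle. -/
def rot (s : ℝ) : CircleDiffeo :=
  ofLift (fun x => x + s) (contDiff_id.add contDiff_const) (fun x => by simp) (fun x => by ring)

@[simp] theorem rot_apply (s x : ℝ) : (rot s).toEquiv x = x + s := rfl

/-- The derivative 1 + s η' stays positive as long as |s| sup |η'| < 1. Suitable η give the germs at
0 used throughout: translations, dilations and x + τ x^(M+2). -/
theorem exists_perturb (η : CircleFun ℝ) : ∃ ε > 0, ∀ s : ℝ, |s| < ε →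
    ∃ f : CircleDiffeo, ∀ x, f.toEquiv x = x + s * η.1 x := by
  obtain ⟨C, hC, h⟩ := CircleFun.exists_bound (ddx ℝ η)
  refine ⟨1 / C, by positivity, fun s hs => ?_⟩
  have hd : ∀ x, HasDerivAt (fun x => x + s * η.1 x) (1 + s * (ddx ℝ η).1 x) x := fun x =>
    (hasDerivAt_id x).add ((CircleFun.hasDerivAt η x).const_mul s)
  refine ⟨ofLift (fun x => x + s * η.1 x) (contDiff_id.add (contDiff_const.mul η.2.1))
    (fun x => ?_) (fun x => ?_), fun x => rfl⟩
  · rw [(hd x).deriv]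
    have h1 : |s * (ddx ℝ η).1 x| < 1 := by
      rw [abs_mul]
      have := h x
      rw [Real.norm_eq_abs] at this
      rw [lt_div_iff₀ hC] at hs
      nlinarith [abs_nonneg s]
    linarith [(abs_lt.1 h1).1]
  · rw [η.2.2 x]
    ring

end CircleDiffeo

end

/-! ### Powers of the local coordinate and the action on densities -/

noncomputable section

open Filter Topology

variable {𝕜 : Type*} [RCLike 𝕜]

namespace CircleFun

/-- The `𝕜`-valued function that equals `x` near `0`. -/
def zc (𝕜 : Type*) [RCLike 𝕜] : CircleFun 𝕜 := ofReal coord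

theorem zc_eventuallyEq : (zc 𝕜).1 =ᶠ[𝓝 0] fun x => (x : 𝕜) := by
  filter_upwards [coord_eventuallyEq] with x hx
  simp [zc, hx]

@[simp] theorem zc_zero : (zc 𝕜).1 0 = 0 := by
  simpa using (zc_eventuallyEq (𝕜 := 𝕜)).eq_of_nhds

theorem ddx_zc_eventuallyEq : (ddx 𝕜 (zc 𝕜)).1 =ᶠ[𝓝 0] fun _ => 1 := by
  have h := coord_eventuallyEq.deriv
  filter_upwards [h] with x hx
  rw [zc, ddx_ofReal, ofReal_apply, ddx_apply, hx]
  simp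

theorem ddx_pow (φ : CircleFun 𝕜) (n : ℕ) :
    ddx 𝕜 (φ ^ n) = (n : 𝕜) • (φ ^ (n - 1) * ddx 𝕜 φ) := by
  induction n with
  | zero => simp [ddx_one]
  | succ n ih =>
    rw [pow_succ, ddx_mul, ih]
    rcases n with _ | n
    · simp
    · ext x
      simp
      ring

theorem ddx_iterate_zc_pow (r j : ℕ) :
    ((ddx 𝕜)^[j] (zc 𝕜 ^ r)).1 =ᶠ[𝓝 0] fun x => (r.descFactorial j : 𝕜) * (x : 𝕜) ^ (r - j) := by
  have key : ((ddx 𝕜)^[j] (zc 𝕜 ^ r)).1 =ᶠ[𝓝 0]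
      ((r.descFactorial j : 𝕜) • zc 𝕜 ^ (r - j)).1 := by
    induction j with
    | zero => simp
    | succ j ih =>
      rw [Function.iterate_succ_apply']
      refine EventuallyEq.trans (ddx_iterate_congr ih 1) ?_
      simp only [Function.iterate_one]
      filter_upwards [ddx_zc_eventuallyEq (𝕜 := 𝕜)] with x hx
      rw [map_smul, ddx_pow]
      simp only [smul_val, mul_val, hx, mul_one, pow_val, ← mul_assoc]
      rw [Nat.descFactorial_succ, Nat.sub_sub, Nat.cast_mul, mul_comm ((r.descFactorial j : 𝕜))]
  filter_upwards [key, zc_eventuallyEq (𝕜 := 𝕜)] with x hx hz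
  rw [hx]
  simp [hz]

theorem ddx_iterate_zc_pow_zero (r j : ℕ) :
    ((ddx 𝕜)^[j] (zc 𝕜 ^ r)).1 0 = if j = r then (r.factorial : 𝕜) else 0 := by
  rw [(ddx_iterate_zc_pow r j).eq_of_nhds]
  split_ifs with h
  · subst h
    simp [Nat.descFactorial_self]
  · rcases lt_or_gt_of_ne h with h | h
    · simp [Nat.sub_ne_zero_of_lt h]
    · simp [Nat.descFactorial_eq_zero_iff_lt.2 h]

end CircleFun

open CircleFun

namespace CircleDiffeo

variable (f : CircleDiffeo)

@[simp] theorem pullback_apply (φ : CircleFun 𝕜) (x : ℝ) :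
    (f.pullback φ).1 x = φ.1 (f.toEquiv x) := rfl

@[simp] theorem symm_toEquiv_apply (x : ℝ) : f.symm.toEquiv (f.toEquiv x) = x :=
  f.toEquiv.symm_apply_apply x

@[simp] theorem toEquiv_symm_apply (x : ℝ) : f.toEquiv (f.symm.toEquiv x) = x :=
  f.toEquiv.apply_symm_apply x

theorem differentiable : Differentiable ℝ f.toEquiv := f.contDiff_toFun.differentiable (by simp)

theorem continuous : Continuous f.toEquiv := f.contDiff_toFun.continuous

theorem derivPow_apply (lam : 𝕜) (x : ℝ) :
    (f.derivPow lam).1 x = NormedSpace.exp (lam * ((Real.log (deriv f.toEquiv x) : ℝ) : 𝕜)) := rfl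

theorem derivPow_add (lam mu : 𝕜) : f.derivPow (lam + mu) = f.derivPow lam * f.derivPow mu := by
  ext x
  change (f.derivPow (lam + mu)).1 x = (f.derivPow lam).1 x * (f.derivPow mu).1 x
  simp only [derivPow_apply]
  let _ : NormedAlgebra ℚ 𝕜 := NormedAlgebra.restrictScalars ℚ ℝ 𝕜
  rw [add_mul, NormedSpace.exp_add]

theorem derivPow_zero : f.derivPow (0 : 𝕜) = 1 := by
  ext x
  change (f.derivPow (0 : 𝕜)).1 x = 1
  rw [derivPow_apply, zero_mul, NormedSpace.exp_zero]

theorem derivPow_ne_zero (lam : 𝕜) (x : ℝ) : (f.derivPow lam).1 x ≠ 0 := by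
  have h := congrArg (fun g => g.1 x) (f.derivPow_add lam (-lam))
  rw [add_neg_cancel, derivPow_zero] at h
  intro h0
  simp [h0] at h

theorem derivPow_one (x : ℝ) : (f.derivPow (1 : 𝕜)).1 x = ((deriv f.toEquiv x : ℝ) : 𝕜) := by
  rw [derivPow_apply, one_mul]
  have h := congrArg (algebraMap ℝ 𝕜) (Real.exp_log (f.deriv_pos x))
  rw [Real.exp_eq_exp_ℝ, NormedSpace.algebraMap_exp_comm] at h
  exact h

theorem derivPow_nat (n : ℕ) (x : ℝ) :
    (f.derivPow (n : 𝕜)).1 x = ((deriv f.toEquiv x : ℝ) : 𝕜) ^ n := by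
  induction n with
  | zero => simp [derivPow_zero]
  | succ n ih => rw [Nat.cast_succ, derivPow_add, mul_val, ih, derivPow_one, pow_succ]

theorem deriv_symm (x : ℝ) :
    deriv f.symm.toEquiv (f.toEquiv x) = (deriv f.toEquiv x)⁻¹ := by
  have h2 : HasDerivAt f.symm.toEquiv (deriv f.symm.toEquiv (f.toEquiv x)) (f.toEquiv x) :=
    (f.symm.differentiable _).hasDerivAt
  have h3 := h2.comp x (f.differentiable x).hasDerivAt
  have h4 : f.symm.toEquiv ∘ f.toEquiv = id := by
    ext y
    simp
  rw [h4] at h3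
  exact eq_inv_of_mul_eq_one_left (h3.unique (hasDerivAt_id x))

theorem derivPow_symm (lam : 𝕜) (x : ℝ) :
    (f.derivPow lam).1 x * (f.symm.derivPow lam).1 (f.toEquiv x) = 1 := by
  have h : (f.symm.derivPow lam).1 (f.toEquiv x) = (f.derivPow (-lam)).1 x := by
    simp only [derivPow_apply, deriv_symm, Real.log_inv]
    push_cast
    rw [mul_neg, neg_mul]
  rw [h, ← mul_val, ← derivPow_add, add_neg_cancel, derivPow_zero, one_val]

theorem densityPullback_apply (lam : 𝕜) (φ : CircleFun 𝕜) (x : ℝ) :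
    (f.densityPullback lam φ).1 x = (f.derivPow lam).1 x * φ.1 (f.toEquiv x) := rfl

theorem densityPullback_eq (lam : 𝕜) (φ : CircleFun 𝕜) :
    f.densityPullback lam φ = f.derivPow lam * f.pullback φ := rfl

theorem densityPullback_symm (lam : 𝕜) (φ : CircleFun 𝕜) :
    f.densityPullback lam (f.symm.densityPullback lam φ) = φ := by
  ext x
  rw [densityPullback_apply, densityPullback_apply, ← mul_assoc, derivPow_symm, one_mul,
    symm_toEquiv_apply]

theorem densityPullback_injective (lam : 𝕜) : Function.Injective (f.densityPullback lam) := by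
  refine Function.LeftInverse.injective (g := f.symm.densityPullback lam) fun φ => ?_
  exact f.symm.densityPullback_symm lam φ

theorem densityPullback_opAct (lam mu : 𝕜) (A : CircleFun 𝕜 →ₗ[𝕜] CircleFun 𝕜)
    (φ : CircleFun 𝕜) :
    f.densityPullback mu (f.opAct lam mu A φ) = A (f.densityPullback lam φ) :=
  f.densityPullback_symm mu _

theorem opAct_apply_map (lam mu : 𝕜) (A : CircleFun 𝕜 →ₗ[𝕜] CircleFun 𝕜)
    (φ : CircleFun 𝕜) (x : ℝ) :
    (f.derivPow mu).1 x * (f.opAct lam mu A φ).1 (f.toEquiv x)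
      = (A (f.densityPullback lam φ)).1 x := by
  rw [← densityPullback_opAct f lam mu]
  rfl

/-- A linear map is determined by its intertwining relation with the pullbacks. -/
theorem opAct_eq_of_intertwine {lam mu : 𝕜} {A B : CircleFun 𝕜 →ₗ[𝕜] CircleFun 𝕜}
    (h : ∀ φ, f.densityPullback mu (B φ) = A (f.densityPullback lam φ)) :
    f.opAct lam mu A = B :=
  LinearMap.ext fun φ => f.densityPullback_injective mu <| by rw [densityPullback_opAct, h]

theorem deriv_rot (s x : ℝ) : deriv (rot s).toEquiv x = 1 := by
  have : ((rot s).toEquiv : ℝ → ℝ) = fun x => x + s := rfl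
  rw [this]
  simp

theorem derivPow_rot (s : ℝ) (lam : 𝕜) : (rot s).derivPow lam = 1 := by
  ext x
  change ((rot s).derivPow lam).1 x = 1
  rw [derivPow_apply, deriv_rot]
  simp

theorem ddx_iterate_rot (s : ℝ) (n : ℕ) (φ : CircleFun 𝕜) :
    (ddx 𝕜)^[n] ((rot s).pullback φ) = (rot s).pullback ((ddx 𝕜)^[n] φ) := by
  induction n with
  | zero => rfl
  | succ n ih =>
    rw [Function.iterate_succ_apply', ih, Function.iterate_succ_apply']
    ext x
    exact deriv_comp_add_const _ _ _

theorem densityPullback_rot (s : ℝ) (lam : 𝕜) (φ : CircleFun 𝕜) :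
    (rot s).densityPullback lam φ = (rot s).pullback φ := by
  rw [densityPullback_eq, derivPow_rot, one_mul]

end CircleDiffeo

/-! ### Differential operators and their coefficients -/

open CircleDiffeo

/-- The differential operator `∑ i ≤ k, a i * d^i/dx^i`. -/
def op (k : ℕ) (lam mu : 𝕜) : (ℕ → CircleFun 𝕜) →ₗ[𝕜] DiffOp k lam mu where
  toFun a := ⟨∑ i ∈ Finset.range (k + 1), LinearMap.mulLeft 𝕜 (a i) ∘ₗ (ddx 𝕜) ^ i,
    a, fun φ => by simp [Module.End.pow_apply]⟩
  map_add' a b := by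
    ext1
    refine LinearMap.ext fun φ => ?_
    simp [Finset.sum_add_distrib, add_mul]
  map_smul' c a := by
    ext1
    refine LinearMap.ext fun φ => ?_
    simp [Finset.smul_sum]

instance (k : ℕ) (lam mu : 𝕜) : AddCommGroup (DiffOp k lam mu) :=
  Module.addCommMonoidToAddCommGroup 𝕜

section Op

variable {k : ℕ} {lam mu : 𝕜}

theorem DiffOp.sub_apply (A B : DiffOp k lam mu) (φ : CircleFun 𝕜) :
    (A - B).1 φ = A.1 φ - B.1 φ := by
  -- The subtraction is the one deduced from the module structure, so its values are found by
  -- cancellation.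
  have h : ((A - B) + B).1 φ = A.1 φ := by rw [sub_add_cancel]
  exact eq_sub_of_add_eq h

theorem op_apply (a : ℕ → CircleFun 𝕜) (φ : CircleFun 𝕜) :
    (op k lam mu a).1 φ = ∑ i ∈ Finset.range (k + 1), a i * (ddx 𝕜)^[i] φ := by
  simp [op, Module.End.pow_apply]

theorem op_surjective : Function.Surjective (op k lam mu) := by
  rintro ⟨A, a, ha⟩
  exact ⟨a, Subtype.ext (LinearMap.ext fun φ => by rw [op_apply, ha])⟩

theorem op_apply_pt (a : ℕ → CircleFun 𝕜) (φ : CircleFun 𝕜) (x : ℝ) :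
    ((op k lam mu a).1 φ).1 x
      = ∑ i ∈ Finset.range (k + 1), (a i).1 x * ((ddx 𝕜)^[i] φ).1 x := by
  rw [op_apply, sum_val]
  rfl

theorem DiffOp.congr (A : DiffOp k lam mu) {φ ψ : CircleFun 𝕜} {x : ℝ}
    (h : φ.1 =ᶠ[𝓝 x] ψ.1) : (A.1 φ).1 =ᶠ[𝓝 x] (A.1 ψ).1 := by
  obtain ⟨a, rfl⟩ := op_surjective A
  have h' : ∀ i, ∀ᶠ y in 𝓝 x, ((ddx 𝕜)^[i] φ).1 y = ((ddx 𝕜)^[i] ψ).1 y := fun i =>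
    ddx_iterate_congr h i
  have := (Finset.eventually_all (Finset.range (k + 1))).2 fun i _ => h' i
  filter_upwards [this] with y hy
  rw [op_apply_pt, op_apply_pt]
  exact Finset.sum_congr rfl fun i hi => by rw [hy i hi]

/-- The test function `(y - x)^i / i!` near `x`. -/
def testFun (𝕜 : Type*) [RCLike 𝕜] (i : ℕ) (x : ℝ) : CircleFun 𝕜 :=
  ((i.factorial : 𝕜)⁻¹) • (rot (-x)).pullback (zc 𝕜 ^ i)

theorem ddx_iterate_testFun (i j : ℕ) (x : ℝ) :
    ((ddx 𝕜)^[j] (testFun 𝕜 i x)).1 x = if j = i then 1 else 0 := by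
  have hl : (ddx 𝕜)^[j] (testFun 𝕜 i x)
      = ((i.factorial : 𝕜)⁻¹) • (ddx 𝕜)^[j] ((rot (-x)).pullback (zc 𝕜 ^ i)) := by
    rw [testFun, ← Module.End.pow_apply, map_smul, Module.End.pow_apply]
  rw [hl, ddx_iterate_rot, smul_val, pullback_apply, rot_apply, add_neg_cancel,
    ddx_iterate_zc_pow_zero]
  split_ifs
  · exact inv_mul_cancel₀ (Nat.cast_ne_zero.2 (Nat.factorial_ne_zero i))
  · simp

/-- The coefficient of `d^i/dx^i` at the point `x`. -/
def coefAt (k : ℕ) (lam mu : 𝕜) (i : ℕ) (x : ℝ) : DiffOp k lam mu →ₗ[𝕜] 𝕜 where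
  toFun A := (A.1 (testFun 𝕜 i x)).1 x
  map_add' _ _ := rfl
  map_smul' _ _ := rfl

theorem coefAt_apply (i : ℕ) (x : ℝ) (A : DiffOp k lam mu) :
    coefAt k lam mu i x A = (A.1 (testFun 𝕜 i x)).1 x := rfl

theorem coefAt_op (a : ℕ → CircleFun 𝕜) {i : ℕ} (hi : i ≤ k) (x : ℝ) :
    coefAt k lam mu i x (op k lam mu a) = (a i).1 x := by
  rw [coefAt_apply, op_apply_pt]
  simp only [ddx_iterate_testFun]
  simp
  omega

theorem coefAt_op_of_lt (a : ℕ → CircleFun 𝕜) {i : ℕ} (hi : k < i) (x : ℝ) :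
    coefAt k lam mu i x (op k lam mu a) = 0 := by
  rw [coefAt_apply, op_apply_pt]
  simp only [ddx_iterate_testFun]
  simp
  omega

theorem apply_eq_sum_coefAt (A : DiffOp k lam mu) (φ : CircleFun 𝕜) (x : ℝ) :
    (A.1 φ).1 x = ∑ i ∈ Finset.range (k + 1), coefAt k lam mu i x A * ((ddx 𝕜)^[i] φ).1 x := by
  obtain ⟨a, rfl⟩ := op_surjective A
  rw [op_apply_pt]
  refine Finset.sum_congr rfl fun i hi => ?_
  rw [coefAt_op a (by simpa [Nat.lt_succ_iff] using hi)]

theorem DiffOp.ext_coefAt {A B : DiffOp k lam mu}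
    (h : ∀ i ≤ k, ∀ x, coefAt k lam mu i x A = coefAt k lam mu i x B) : A = B := by
  ext1
  refine LinearMap.ext fun φ => Subtype.ext (funext fun x => ?_)
  rw [apply_eq_sum_coefAt, apply_eq_sum_coefAt]
  exact Finset.sum_congr rfl fun i hi => by rw [h i (by simpa [Nat.lt_succ_iff] using hi)]

variable (k lam mu) in
/-- The operator `a * d^i/dx^i` (zero if `k < i`). -/
def mon (i : ℕ) : CircleFun 𝕜 →ₗ[𝕜] DiffOp k lam mu :=
  op k lam mu ∘ₗ LinearMap.single 𝕜 (fun _ => CircleFun 𝕜) i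

theorem mon_def (i : ℕ) (a : CircleFun 𝕜) : mon k lam mu i a = op k lam mu (Pi.single i a) := rfl

theorem mon_apply {i : ℕ} (hi : i ≤ k) (a φ : CircleFun 𝕜) :
    (mon k lam mu i a).1 φ = a * (ddx 𝕜)^[i] φ := by
  rw [mon_def, op_apply, Finset.sum_eq_single i]
  · rw [Pi.single_eq_same]
  · intro j _ hj
    rw [Pi.single_eq_of_ne hj, zero_mul]
  · intro h
    exact absurd (Finset.mem_range.2 (by omega)) h

theorem op_eq_sum_mon (a : ℕ → CircleFun 𝕜) :
    op k lam mu a = ∑ i ∈ Finset.range (k + 1), mon k lam mu i (a i) := by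
  ext1
  refine LinearMap.ext fun φ => ?_
  rw [op_apply, AddSubmonoidClass.coe_finsetSum, LinearMap.sum_apply]
  refine Finset.sum_congr rfl fun i hi => ?_
  rw [mon_apply (by simpa [Nat.lt_succ_iff] using hi)]

theorem coefAt_mon {i j : ℕ} (hj : j ≤ k) (a : CircleFun 𝕜) (x : ℝ) :
    coefAt k lam mu j x (mon k lam mu i a) = if j = i then a.1 x else 0 := by
  rw [mon_def, coefAt_op _ hj]
  split_ifs with h
  · subst h
    rw [Pi.single_eq_same]
  · rw [Pi.single_eq_of_ne h, zero_val]

theorem ext_mon {V : Type*} [AddCommMonoid V] [Module 𝕜 V] {S T : DiffOp k lam mu →ₗ[𝕜] V}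
    (h : ∀ i ≤ k, ∀ a, S (mon k lam mu i a) = T (mon k lam mu i a)) : S = T := by
  refine LinearMap.ext fun A => ?_
  obtain ⟨a, rfl⟩ := op_surjective A
  rw [op_eq_sum_mon, map_sum, map_sum]
  exact Finset.sum_congr rfl fun i hi => h i (by simpa [Nat.lt_succ_iff] using hi) _

theorem diffOpAct_coe (f : CircleDiffeo) (A : DiffOp k lam mu) :
    (diffOpAct k lam mu f A).1 = f.opAct lam mu A.1 := rfl

theorem diffOpAct_eq_of_intertwine (f : CircleDiffeo) {A B : DiffOp k lam mu}
    (h : ∀ φ, f.densityPullback mu (B.1 φ) = A.1 (f.densityPullback lam φ)) :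
    diffOpAct k lam mu f A = B :=
  Subtype.ext (f.opAct_eq_of_intertwine h)

theorem mem_symmAlg_iff {T : Module.End 𝕜 (DiffOp k lam mu)} :
    T ∈ SymmAlg k lam mu ↔
      ∀ f A, T (diffOpAct k lam mu f A) = diffOpAct k lam mu f (T A) := by
  rw [SymmAlg, Subalgebra.mem_centralizer_iff]
  constructor
  · intro h f A
    exact (LinearMap.congr_fun (h _ ⟨f, rfl⟩) A).symm
  · rintro h _ ⟨f, rfl⟩
    exact LinearMap.ext fun A => (h f A).symm

theorem diffOpAct_rot_op (s : ℝ) (a : ℕ → CircleFun 𝕜) :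
    diffOpAct k lam mu (rot s) (op k lam mu fun i => (rot s).pullback (a i))
      = op k lam mu a := by
  refine diffOpAct_eq_of_intertwine _ fun φ => ?_
  rw [densityPullback_rot, densityPullback_rot, op_apply, op_apply, map_sum]
  refine Finset.sum_congr rfl fun i _ => ?_
  rw [map_mul, ddx_iterate_rot]

theorem diffOpAct_rot_mon (s : ℝ) (i : ℕ) (a : CircleFun 𝕜) :
    diffOpAct k lam mu (rot s) (mon k lam mu i ((rot s).pullback a)) = mon k lam mu i a := by
  rw [mon_def, mon_def, ← diffOpAct_rot_op s (Pi.single i a)]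
  congr 2
  funext j
  rcases eq_or_ne j i with rfl | h
  · simp
  · simp [h]

theorem pullback_rot_testFun (i : ℕ) (s x : ℝ) :
    (rot s).pullback (testFun 𝕜 i (x + s)) = testFun 𝕜 i x := by
  ext y
  change (testFun 𝕜 i (x + s)).1 (y + s) = (testFun 𝕜 i x).1 y
  simp only [testFun, smul_val, pullback_apply, rot_apply]
  rw [show y + s + -(x + s) = y + -x by ring]

/-- Rotations act on operators by translating the coefficients; this reduces the study of a symmetry
to the single point 0. -/
theorem coefAt_diffOpAct_rot (i : ℕ) (s x : ℝ) (A : DiffOp k lam mu) :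
    coefAt k lam mu i (x + s) (diffOpAct k lam mu (rot s) A) = coefAt k lam mu i x A := by
  have h := (rot s).opAct_apply_map lam mu A.1 (testFun 𝕜 i (x + s)) x
  rw [derivPow_rot, one_val, one_mul, densityPullback_rot, pullback_rot_testFun] at h
  exact h

end Op

end

noncomputable section

open Filter Topology CircleFun CircleDiffeo

variable {𝕜 : Type*} [RCLike 𝕜]

/-! ### Jets at the point 0 -/

section Jet

theorem ddx_iterate_add (n : ℕ) (φ ψ : CircleFun 𝕜) :
    (ddx 𝕜)^[n] (φ + ψ) = (ddx 𝕜)^[n] φ + (ddx 𝕜)^[n] ψ := by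
  simp only [← Module.End.pow_apply, map_add]

theorem ddx_iterate_smul (n : ℕ) (c : 𝕜) (φ : CircleFun 𝕜) :
    (ddx 𝕜)^[n] (c • φ) = c • (ddx 𝕜)^[n] φ := by
  simp only [← Module.End.pow_apply, map_smul]

theorem ddx_iterate_sub (n : ℕ) (φ ψ : CircleFun 𝕜) :
    (ddx 𝕜)^[n] (φ - ψ) = (ddx 𝕜)^[n] φ - (ddx 𝕜)^[n] ψ := by
  simp only [← Module.End.pow_apply, map_sub]

variable (𝕜) in
/-- The functions whose derivatives of order less than `n` vanish at `0`. -/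
def jetSet (n : ℕ) : Set (CircleFun 𝕜) := {φ | ∀ j < n, ((ddx 𝕜)^[j] φ).1 0 = 0}

theorem mem_jetSet_succ {n : ℕ} {φ : CircleFun 𝕜} :
    φ ∈ jetSet 𝕜 (n + 1) ↔ φ.1 0 = 0 ∧ ddx 𝕜 φ ∈ jetSet 𝕜 n := by
  constructor
  · exact fun h => ⟨h 0 n.succ_pos, fun j hj => h (j + 1) (by omega)⟩
  · rintro ⟨h0, h⟩ j hj
    rcases j with _ | j
    · exact h0
    · exact h j (by omega)

theorem jetSet_anti {m n : ℕ} (h : m ≤ n) {φ : CircleFun 𝕜} (hφ : φ ∈ jetSet 𝕜 n) :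
    φ ∈ jetSet 𝕜 m := fun j hj => hφ j (by omega)

theorem jetSet_add {n : ℕ} {φ ψ : CircleFun 𝕜} (hφ : φ ∈ jetSet 𝕜 n) (hψ : ψ ∈ jetSet 𝕜 n) :
    φ + ψ ∈ jetSet 𝕜 n := fun j hj => by
  rw [ddx_iterate_add, add_val, hφ j hj, hψ j hj, add_zero]

theorem jetSet_smul_mem {n : ℕ} (ψ : CircleFun 𝕜) {φ : CircleFun 𝕜} (hφ : φ ∈ jetSet 𝕜 n) :
    ψ * φ ∈ jetSet 𝕜 n := by
  induction n generalizing φ ψ with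
  | zero => exact fun j hj => absurd hj (by omega)
  | succ n ih =>
    refine mem_jetSet_succ.2 ⟨?_, ?_⟩
    · rw [mul_val, (mem_jetSet_succ.1 hφ).1, mul_zero]
    · rw [ddx_mul]
      exact jetSet_add (ih _ (jetSet_anti n.le_succ hφ)) (ih _ (mem_jetSet_succ.1 hφ).2)

variable (𝕜) in
/-- The ideal of functions whose derivatives of order less than `n` vanish at `0`. -/
def jet (n : ℕ) : Ideal (CircleFun 𝕜) where
  carrier := jetSet 𝕜 n
  add_mem' := jetSet_add
  zero_mem' := fun j _ => by rw [iterate_map_zero]; rfl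
  smul_mem' := fun ψ _ h => jetSet_smul_mem ψ h

theorem mem_jet {n : ℕ} {φ : CircleFun 𝕜} :
    φ ∈ jet 𝕜 n ↔ ∀ j < n, ((ddx 𝕜)^[j] φ).1 0 = 0 := Iff.rfl

theorem mem_jet_succ {n : ℕ} {φ : CircleFun 𝕜} :
    φ ∈ jet 𝕜 (n + 1) ↔ φ.1 0 = 0 ∧ ddx 𝕜 φ ∈ jet 𝕜 n := mem_jetSet_succ

theorem mem_jet_zero (φ : CircleFun 𝕜) : φ ∈ jet 𝕜 0 := fun j hj => absurd hj (by omega)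

theorem mem_jet_one {φ : CircleFun 𝕜} : φ ∈ jet 𝕜 1 ↔ φ.1 0 = 0 := by
  rw [mem_jet_succ]
  exact and_iff_left (mem_jet_zero _)

theorem jet_anti {m n : ℕ} (h : m ≤ n) {φ : CircleFun 𝕜} (hφ : φ ∈ jet 𝕜 n) : φ ∈ jet 𝕜 m :=
  jetSet_anti h hφ

theorem jet_smul {n : ℕ} (c : 𝕜) {φ : CircleFun 𝕜} (hφ : φ ∈ jet 𝕜 n) : c • φ ∈ jet 𝕜 n :=
  Submodule.smul_of_tower_mem _ c hφ

/-- Induction on the total order m + n: by the Leibniz rule the derivative of the product is a sum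
of two products of total order one less. -/
theorem jet_mul {m n : ℕ} {φ ψ : CircleFun 𝕜} (hφ : φ ∈ jet 𝕜 m) (hψ : ψ ∈ jet 𝕜 n) :
    φ * ψ ∈ jet 𝕜 (m + n) := by
  induction hN : m + n generalizing m n φ ψ with
  | zero => exact mem_jet_zero _
  | succ N ih =>
    refine mem_jet_succ.2 ⟨?_, ?_⟩
    · rw [mul_val]
      rcases m with _ | m
      · rcases n with _ | n
        · omega
        · rw [(mem_jet_succ.1 hψ).1, mul_zero]
      · rw [(mem_jet_succ.1 hφ).1, zero_mul]
    · rw [ddx_mul]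
      refine Ideal.add_mem _ ?_ ?_
      · rcases m with _ | m
        · exact Ideal.mul_mem_left _ _ (jet_anti (by omega) hψ)
        · exact ih (mem_jet_succ.1 hφ).2 hψ (by omega)
      · rcases n with _ | n
        · exact Ideal.mul_mem_right _ _ (jet_anti (by omega) hφ)
        · exact ih hφ (mem_jet_succ.1 hψ).2 (by omega)

theorem jet_ddx_iterate {n : ℕ} (i : ℕ) {φ : CircleFun 𝕜} (hφ : φ ∈ jet 𝕜 n) :
    (ddx 𝕜)^[i] φ ∈ jet 𝕜 (n - i) := fun j hj => by
  rw [← Function.iterate_add_apply]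
  exact hφ _ (by omega)

theorem jet_pullback {f : CircleDiffeo} (hf : f.toEquiv 0 = 0) {n : ℕ} {φ : CircleFun 𝕜}
    (hφ : φ ∈ jet 𝕜 n) : f.pullback φ ∈ jet 𝕜 n := by
  obtain ⟨w, hw⟩ := ddx_pullback (𝕜 := 𝕜) f
  induction n generalizing φ with
  | zero => exact mem_jet_zero _
  | succ n ih =>
    refine mem_jet_succ.2 ⟨?_, ?_⟩
    · rw [pullback_apply, hf, (mem_jet_succ.1 hφ).1]
    · rw [hw]
      exact Ideal.mul_mem_left _ _ (ih (mem_jet_succ.1 hφ).2)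

theorem jet_of_eventuallyEq {φ ψ : CircleFun 𝕜} (h : φ.1 =ᶠ[𝓝 0] ψ.1) (n : ℕ) :
    φ - ψ ∈ jet 𝕜 n := fun j _ => by
  rw [ddx_iterate_sub, sub_val, (ddx_iterate_congr h j).eq_of_nhds, sub_self]

theorem zc_pow_mem_jet (r : ℕ) : zc 𝕜 ^ r ∈ jet 𝕜 r := fun j hj => by
  rw [ddx_iterate_zc_pow_zero, if_neg hj.ne]

theorem ddx_iterate_zc_pow_sub_mem (r j n : ℕ) :
    (ddx 𝕜)^[j] (zc 𝕜 ^ r) - (r.descFactorial j : 𝕜) • zc 𝕜 ^ (r - j) ∈ jet 𝕜 n := by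
  refine jet_of_eventuallyEq ?_ n
  filter_upwards [ddx_iterate_zc_pow (𝕜 := 𝕜) r j, zc_eventuallyEq (𝕜 := 𝕜)] with x hx hz
  rw [hx, smul_val, pow_val, hz]

end Jet

/-! ### Expansion of the action of x ↦ x + τ x^(M+2) at its fixed point -/

section Expansion

/-- The logarithmic derivative of (f')^lam is lam f''/f', written here without division. Together
with the value at 0 it determines the jet of (f')^lam from that of f'. -/
theorem ddx_derivPow (f : CircleDiffeo) (lam : 𝕜) :
    f.derivPow 1 * ddx 𝕜 (f.derivPow lam) = lam • (ddx 𝕜 (f.derivPow 1) * f.derivPow lam) := by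
  set g : CircleFun ℝ := ⟨deriv f.toEquiv, f.contDiff_deriv, f.deriv_periodic⟩ with hg
  have h1 : f.derivPow (1 : 𝕜) = ofReal g := Subtype.ext (funext fun x => f.derivPow_one x)
  have hlog : ∀ x, HasDerivAt (fun y => ((Real.log (deriv f.toEquiv y) : ℝ) : 𝕜))
      (((g.1 x)⁻¹ * (ddx ℝ g).1 x : ℝ) : 𝕜) x := fun x => by
    have := (Real.hasDerivAt_log (f.deriv_pos x).ne').comp x (CircleFun.hasDerivAt g x)
    exact (RCLike.ofRealCLM (K := 𝕜)).hasFDerivAt.comp_hasDerivAt x this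
  ext x
  have h3 := (HasDerivAt.scomp x
    (hasDerivAt_exp (𝕂 := 𝕜) (x := lam * ((Real.log (deriv f.toEquiv x) : ℝ) : 𝕜)))
    ((hlog x).const_mul lam)).deriv
  change (f.derivPow 1).1 x * deriv (f.derivPow lam).1 x
    = lam * ((ddx 𝕜 (f.derivPow 1)).1 x * (f.derivPow lam).1 x)
  have h4 : deriv (f.derivPow lam).1 x = lam * (((g.1 x)⁻¹ * (ddx ℝ g).1 x : ℝ) : 𝕜)
      * (f.derivPow lam).1 x := h3
  have h5 : ((g.1 x : ℝ) : 𝕜) ≠ 0 := by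
    exact_mod_cast (f.deriv_pos x).ne'
  rw [h4, h1, ddx_ofReal, ofReal_apply, ofReal_apply]
  push_cast
  field_simp

variable {f : CircleDiffeo} {τ : ℝ} {M : ℕ}

theorem map_zero_of_expansion (hf : f.toEquiv =ᶠ[𝓝 0] fun x => x + τ * x ^ (M + 2)) :
    f.toEquiv 0 = 0 := by
  simpa using hf.eq_of_nhds

theorem derivPow_one_expansion (hf : f.toEquiv =ᶠ[𝓝 0] fun x => x + τ * x ^ (M + 2)) (n : ℕ) :
    f.derivPow 1 - (1 + ((M + 2 : 𝕜) * τ) • zc 𝕜 ^ (M + 1)) ∈ jet 𝕜 n := by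
  refine jet_of_eventuallyEq ?_ n
  filter_upwards [hf.deriv, zc_eventuallyEq (𝕜 := 𝕜)] with x hx hz
  rw [derivPow_one, hx]
  have : HasDerivAt (fun x => x + τ * x ^ (M + 2)) (1 + τ * ((M + 2 : ℕ) * x ^ (M + 1))) x :=
    (hasDerivAt_id x).add ((hasDerivAt_pow (M + 2) x).const_mul τ)
  rw [this.deriv]
  simp only [add_val, one_val, smul_val, pow_val, hz]
  push_cast
  ring

theorem derivPow_zero_of_expansion (hf : f.toEquiv =ᶠ[𝓝 0] fun x => x + τ * x ^ (M + 2))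
    (lam : 𝕜) : (f.derivPow lam).1 0 = 1 := by
  have h1 : deriv f.toEquiv 0 = 1 := by
    have h := mem_jet_one.1 (derivPow_one_expansion (𝕜 := ℝ) hf 1)
    simp only [sub_val, add_val, one_val, smul_val, pow_val, zc_zero, derivPow_one] at h
    simp at h
    linarith
  rw [derivPow_apply, h1]
  simp

theorem derivPow_expansion (hf : f.toEquiv =ᶠ[𝓝 0] fun x => x + τ * x ^ (M + 2)) (lam : 𝕜) :
    f.derivPow lam - (1 + (lam * (M + 2) * τ) • zc 𝕜 ^ (M + 1)) ∈ jet 𝕜 (M + 2) := by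
  have hW1 := derivPow_one_expansion (𝕜 := 𝕜) hf (M + 2)
  have hode := ddx_derivPow f lam
  have hW0 : f.derivPow lam - 1 ∈ jet 𝕜 1 := mem_jet_one.2 <| by
    rw [sub_val, derivPow_zero_of_expansion hf, one_val, sub_self]
  have hz := zc_pow_mem_jet (𝕜 := 𝕜) (M + 1)
  set W := f.derivPow lam
  set W1 := f.derivPow (1 : 𝕜)
  have hW1' : W1 - 1 ∈ jet 𝕜 (M + 1) := by
    have := Ideal.add_mem _ (jet_anti (by omega) hW1) (jet_smul ((M + 2 : 𝕜) * τ) hz)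
    convert this using 1
    ring
  have hDW1 : ddx 𝕜 W1 - ((M + 2 : 𝕜) * τ) • ddx 𝕜 (zc 𝕜 ^ (M + 1)) ∈ jet 𝕜 (M + 1) := by
    have := (mem_jet_succ.1 hW1).2
    rwa [map_sub, map_add, ddx_one, zero_add, map_smul] at this
  refine mem_jet_succ.2 ⟨?_, ?_⟩
  · rw [sub_val, derivPow_zero_of_expansion hf]
    simp
  -- The differential equation for W = (f')^lam writes the derivative of the error as three terms,
  -- each vanishing to order M + 1: the differentiated error of f' itself and two products involving
  -- f' - 1.
  · have e : ddx 𝕜 (W - (1 + (lam * (M + 2) * τ) • zc 𝕜 ^ (M + 1)))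
        = lam • (ddx 𝕜 W1 - ((M + 2 : 𝕜) * τ) • ddx 𝕜 (zc 𝕜 ^ (M + 1)))
          + lam • (ddx 𝕜 (W1 - 1) * (W - 1)) - (W1 - 1) * ddx 𝕜 W := by
      have e1 : (W1 - 1) * ddx 𝕜 W = lam • (ddx 𝕜 W1 * W) - ddx 𝕜 W := by
        rw [sub_mul, hode, one_mul]
      rw [e1]
      simp only [map_sub, map_add, ddx_one, map_smul, zero_add, sub_zero, mul_sub, mul_one,
        smul_sub, smul_smul, mul_assoc]
      abel
    rw [e]
    refine Ideal.sub_mem _ (Ideal.add_mem _ (jet_smul _ hDW1) (jet_smul _ ?_))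
      (Ideal.mul_mem_right _ _ hW1')
    exact jet_mul (mem_jet_succ.1 hW1').2 hW0

theorem zc_add_pow_expansion (c : 𝕜) (r : ℕ) :
    (zc 𝕜 + c • zc 𝕜 ^ (M + 2)) ^ r - (zc 𝕜 ^ r + ((r : 𝕜) * c) • zc 𝕜 ^ (r + M + 1))
      ∈ jet 𝕜 (r + M + 2) := by
  induction r with
  | zero => simp
  | succ r ih =>
    have e : (zc 𝕜 + c • zc 𝕜 ^ (M + 2)) ^ (r + 1)
          - (zc 𝕜 ^ (r + 1) + (((r + 1 : ℕ) : 𝕜) * c) • zc 𝕜 ^ (r + 1 + M + 1))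
        = ((zc 𝕜 + c • zc 𝕜 ^ (M + 2)) ^ r - (zc 𝕜 ^ r + ((r : 𝕜) * c) • zc 𝕜 ^ (r + M + 1)))
            * (zc 𝕜 + c • zc 𝕜 ^ (M + 2))
          + ((r : 𝕜) * c * c) • zc 𝕜 ^ (r + M + 1 + (M + 2)) := by
      ext x
      simp
      ring
    rw [e]
    refine Ideal.add_mem _ ?_ (jet_smul _ (jet_anti (by omega) (zc_pow_mem_jet _)))
    have h1 : zc 𝕜 + c • zc 𝕜 ^ (M + 2) ∈ jet 𝕜 1 := mem_jet_one.2 (by simp)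
    exact jet_anti (by omega) (jet_mul ih h1)

/-- The first correction to z^r has two sources: substituting f into z^r contributes r, and the
factor (f')^lam contributes lam (M + 2). Everything else is of higher order. -/
theorem densityPullback_expansion (hf : f.toEquiv =ᶠ[𝓝 0] fun x => x + τ * x ^ (M + 2))
    (lam : 𝕜) (r : ℕ) :
    f.densityPullback lam (zc 𝕜 ^ r)
      - (zc 𝕜 ^ r + ((r + lam * (M + 2)) * τ) • zc 𝕜 ^ (r + M + 1)) ∈ jet 𝕜 (r + M + 2) := by
  have h1 := derivPow_expansion hf lam
  have h2 : f.pullback (zc 𝕜 ^ r) - (zc 𝕜 ^ r + ((r : 𝕜) * τ) • zc 𝕜 ^ (r + M + 1))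
      ∈ jet 𝕜 (r + M + 2) := by
    have h3 : f.pullback (zc 𝕜 ^ r) - (zc 𝕜 + (τ : 𝕜) • zc 𝕜 ^ (M + 2)) ^ r
        ∈ jet 𝕜 (r + M + 2) := by
      refine jet_of_eventuallyEq ?_ _
      have hc : Tendsto f.toEquiv (𝓝 0) (𝓝 0) := by
        have := f.continuous.tendsto 0
        rwa [map_zero_of_expansion hf] at this
      filter_upwards [hf, zc_eventuallyEq (𝕜 := 𝕜),
        hc.eventually (zc_eventuallyEq (𝕜 := 𝕜))] with x hx hz hz'
      simp only [pullback_apply, pow_val, add_val, smul_val, hz, hz']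
      rw [hx]
      push_cast
      rfl
    have := Ideal.add_mem _ h3 (zc_add_pow_expansion (𝕜 := 𝕜) (M := M) (τ : 𝕜) r)
    convert this using 1
    ring
  have h3 : f.pullback (zc 𝕜 ^ r) ∈ jet 𝕜 r :=
    jet_pullback (map_zero_of_expansion hf) (zc_pow_mem_jet r)
  set W := f.derivPow lam
  set F := f.pullback (zc 𝕜 ^ r)
  have e : f.densityPullback lam (zc 𝕜 ^ r)
        - (zc 𝕜 ^ r + ((r + lam * (M + 2)) * τ) • zc 𝕜 ^ (r + M + 1))
      = (W - (1 + (lam * (M + 2) * τ) • zc 𝕜 ^ (M + 1))) * F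
        + (1 + (lam * (M + 2) * τ) • zc 𝕜 ^ (M + 1))
          * (F - (zc 𝕜 ^ r + ((r : 𝕜) * τ) • zc 𝕜 ^ (r + M + 1)))
        + (lam * (M + 2) * τ * (r * τ)) • zc 𝕜 ^ (r + M + 1 + (M + 1)) := by
    rw [densityPullback_eq]
    ext x
    simp [W, F]
    ring
  rw [e]
  refine Ideal.add_mem _ (Ideal.add_mem _ ?_ (Ideal.mul_mem_left _ _ h2))
    (jet_smul _ (jet_anti (by omega) (zc_pow_mem_jet _)))
  exact jet_anti (by omega) (jet_mul h1 h3)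

theorem jet_densityPullback (hf : f.toEquiv 0 = 0) (lam : 𝕜) {n : ℕ} {φ : CircleFun 𝕜} :
    f.densityPullback lam φ ∈ jet 𝕜 n ↔ φ ∈ jet 𝕜 n := by
  constructor
  · intro h
    have hf' : f.symm.toEquiv 0 = 0 := by
      conv_lhs => rw [← hf]
      exact f.symm_toEquiv_apply 0
    have := Ideal.mul_mem_left _ (f.symm.derivPow lam) (jet_pullback hf' h)
    rwa [← densityPullback_eq, show f.symm.densityPullback lam (f.densityPullback lam φ) = φ from
      f.symm.densityPullback_symm lam φ] at this
  · exact fun h => Ideal.mul_mem_left _ _ (jet_pullback hf h)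

end Expansion

end

/-! ### A functional equation for a contraction, and locality of the action -/

noncomputable section

open Filter Topology CircleFun CircleDiffeo

variable {𝕜 : Type*} [RCLike 𝕜]

/-- A smooth solution `b` of the functional equation `b x = ρ * b (c * x) + a x`, for `a`
vanishing to sufficiently high order at the fixed point. -/
theorem exists_eq_smul_comp_mul_add (N : ℕ) {c : ℝ} (hc0 : 0 < c) (hc1 : c < 1) (ρ : ℝ)
    (hρ : |ρ| * c ^ N < 1) (a : ℝ → 𝕜) (ha : ContDiff ℝ ∞ a)
    (hb : ∀ j, ∃ C, ∀ x, ‖iteratedDeriv j a x‖ ≤ C) (h0 : ∀ j < N, iteratedDeriv j a 0 = 0) :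
    ∃ b : ℝ → 𝕜, ContDiff ℝ ∞ b ∧ ∀ x, b x = ρ • b (c * x) + a x := by
  induction N generalizing a ρ with
  | zero =>
    rw [pow_zero, mul_one] at hρ
    choose C hC using hb
    have hsm : ∀ n : ℕ, ContDiff ℝ ∞ fun x => ρ ^ n • a (c ^ n * x) := fun n =>
      (ha.comp ((contDiff_const (c := c ^ n)).mul contDiff_id)).const_smul (ρ ^ n)
    have hbound : ∀ (k n : ℕ) (x : ℝ), (k : ℕ∞) ≤ ⊤ →
        ‖iteratedFDeriv ℝ k (fun x => ρ ^ n • a (c ^ n * x)) x‖ ≤ |ρ| ^ n * C k := by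
      intro k n x _
      have hak : ContDiff ℝ k a := ha.of_le (by exact_mod_cast le_top)
      have hcomp : iteratedDeriv k (fun x => a (c ^ n * x)) x
          = (c ^ n) ^ k • iteratedDeriv k a (c ^ n * x) := by
        simpa only [smul_eq_mul] using congrFun (iteratedDeriv_comp_const_smul hak (c ^ n)) x
      rw [norm_iteratedFDeriv_eq_norm_iteratedDeriv,
        iteratedDeriv_fun_const_smul_field, hcomp, norm_smul, norm_smul, norm_pow, norm_pow,
        norm_pow,
        Real.norm_eq_abs, Real.norm_eq_abs, abs_of_pos hc0]
      have h1 : (c ^ n) ^ k ≤ 1 := pow_le_one₀ (by positivity) (pow_le_one₀ hc0.le hc1.le)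
      gcongr
      calc (c ^ n) ^ k * ‖iteratedDeriv k a (c ^ n * x)‖
          ≤ 1 * ‖iteratedDeriv k a (c ^ n * x)‖ := by gcongr
        _ ≤ C k := by rw [one_mul]; exact hC k _
    have hsum : ∀ k : ℕ, Summable fun n => |ρ| ^ n * C k := fun k =>
      (summable_geometric_of_lt_one (abs_nonneg ρ) hρ).mul_right _
    -- Iterating the equation leads to this series. Since c < 1, differentiation only multiplies the
    -- terms by factors (c^n)^k ≤ 1, so every derivative is dominated by a geometric series.
    refine ⟨fun x => ∑' n : ℕ, ρ ^ n • a (c ^ n * x),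
      contDiff_tsum hsm (fun k _ => hsum k) hbound, fun x => ?_⟩
    have hs : ∀ x, Summable fun n : ℕ => ρ ^ n • a (c ^ n * x) := fun x =>
      Summable.of_norm_bounded (hsum 0) fun n => by
        simpa using hbound 0 n x le_top
    beta_reduce
    rw [(hs x).tsum_eq_zero_add, add_comm, ← tsum_const_smul'']
    congr 1
    · refine tsum_congr fun n => ?_
      rw [smul_smul, pow_succ', pow_succ, mul_assoc]
    · simp
  | succ N ih =>
    -- The derivative of a solution solves the same equation with a' for a and ρ c for ρ, which
    -- gains one factor c towards contraction. Its primitive from 0 solves the original equation up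
    -- to a constant, which is zero because a vanishes at 0.
    obtain ⟨b, hbs, hbe⟩ := ih (ρ * c) (by
      rw [abs_mul, abs_of_pos hc0, mul_assoc, ← pow_succ']
      exact hρ) (deriv a) (contDiff_infty_iff_deriv.1 ha).2
      (fun j => by simpa only [iteratedDeriv_succ'] using hb (j + 1))
      (fun j hj => by simpa only [iteratedDeriv_succ'] using h0 (j + 1) (by omega))
    have hB : ∀ x, HasDerivAt (fun x => ∫ t in (0 : ℝ)..x, b t) (b x) x := fun x =>
      intervalIntegral.integral_hasDerivAt_right (hbs.continuous.intervalIntegrable _ _)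
        (hbs.continuous.stronglyMeasurableAtFilter _ _) hbs.continuous.continuousAt
    set B : ℝ → 𝕜 := fun x => ∫ t in (0 : ℝ)..x, b t with hBdef
    have hBs : ContDiff ℝ ∞ B := by
      refine contDiff_infty_iff_deriv.2 ⟨fun x => (hB x).differentiableAt, ?_⟩
      rwa [show deriv B = b from funext fun x => (hB x).deriv]
    refine ⟨B, hBs, fun x => ?_⟩
    have hd : ∀ x, HasDerivAt (fun x => B x - (ρ • B (c * x) + a x)) 0 x := fun x => by
      have h1 := ((hB (c * x)).scomp x ((hasDerivAt_id x).const_mul c)).const_smul ρ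
      have h2 := (ha.differentiable (by simp) x).hasDerivAt
      have h3 := (hB x).sub (h1.add h2)
      rw [mul_one, smul_smul, ← hbe x, sub_self] at h3
      exact h3
    have hconst := is_const_of_deriv_eq_zero (fun x => (hd x).differentiableAt)
      (fun x => (hd x).deriv) x 0
    have ha0 : a 0 = 0 := by simpa using h0 0 N.succ_pos
    have hB0 : B 0 = 0 := by simp [hBdef]
    simp only [mul_zero, hB0, ha0, smul_zero, add_zero, sub_zero] at hconst
    exact sub_eq_zero.1 hconst

section Vanish

variable {k : ℕ} {lam mu : 𝕜}

/-- The operator `A` vanishes in a neighbourhood of `x`. -/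
def VanishNear (A : DiffOp k lam mu) (x : ℝ) : Prop := ∀ᶠ y in 𝓝 x, ∀ φ, (A.1 φ).1 y = 0

theorem CircleDiffeo.densityPullback_eventuallyEq_of_translation {f : CircleDiffeo} {x s : ℝ}
    (h : f.toEquiv =ᶠ[𝓝 x] fun y => y + s) (lam : 𝕜) (φ : CircleFun 𝕜) :
    (f.densityPullback lam φ).1 =ᶠ[𝓝 x] ((rot s).pullback φ).1 := by
  filter_upwards [h, h.deriv] with y hy hy'
  rw [densityPullback_apply, derivPow_apply, hy', hy]
  simp

/-- An operator vanishing near `0` is invariant under diffeomorphisms supported near `0`. -/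
theorem exists_diffOpAct_eq_self {A : DiffOp k lam mu} (hA : VanishNear A 0) :
    ∃ χ : CircleFun ℝ, (∀ᶠ x in 𝓝 0, χ.1 x = 1) ∧ ∀ η : CircleFun ℝ, ∃ ε > 0, ∀ s : ℝ, |s| < ε →
      ∃ f : CircleDiffeo, (∀ x, f.toEquiv x = x + s * (χ * η).1 x) ∧
        diffOpAct k lam mu f A = A := by
  obtain ⟨r, hr, hrA⟩ := Metric.eventually_nhds_iff.1 hA
  obtain ⟨χ, hχ1, hχ0⟩ := exists_bump (r / 2) (by positivity)
  refine ⟨χ, hχ1, fun η => ?_⟩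
  obtain ⟨ε, hε, hf⟩ := exists_perturb (χ * η)
  obtain ⟨C, hC, hCb⟩ := CircleFun.exists_bound (χ * η)
  -- The bound r/2/C keeps displacements below r/2. Points where the cut-off may be non-zero lie in
  -- |x| < r/2 and so stay in the region |x| < r where A vanishes.
  refine ⟨min ε (r / 2 / C), by positivity, fun s hs => ?_⟩
  obtain ⟨f, hf⟩ := hf s (hs.trans_le (min_le_left _ _))
  refine ⟨f, hf, diffOpAct_eq_of_intertwine _ fun φ => ?_⟩
  rw [← sub_eq_zero]
  refine eq_zero_of_forall_abs_le fun x hx => ?_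
  rw [sub_val, sub_eq_zero]
  -- For |x| < r both sides vanish, as x and f x lie where A is zero; for larger |x| the
  -- diffeomorphism is the identity near x.
  rcases lt_or_ge |x| r with hxr | hxr
  · have h1 : |f.toEquiv x| < r := by
      rw [hf]
      rcases lt_or_ge |x| (r / 2) with h | h
      · have h2 : |s * (χ * η).1 x| < r / 2 := by
          rw [abs_mul]
          have h3 := hCb x
          rw [Real.norm_eq_abs] at h3
          have h4 := hs.trans_le (min_le_right _ _)
          rw [lt_div_iff₀ hC] at h4
          nlinarith [abs_nonneg s]
        linarith [abs_add_le x (s * (χ * η).1 x)]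
      · rw [mul_val, hχ0 x (by linarith) h]
        simpa using hxr
    rw [densityPullback_apply, hrA (by simpa using h1), hrA (by simpa using hxr), mul_zero]
  · have h1 : f.toEquiv =ᶠ[𝓝 x] fun y => y + 0 := by
      have hc : ContinuousAt (fun y : ℝ => |y|) x := by fun_prop
      filter_upwards [hc.eventually (lt_mem_nhds (show r / 2 < |x| by linarith)),
        hc.eventually (gt_mem_nhds (show |x| < 3 / 4 by linarith))] with y hy hy'
      rw [hf, mul_val, hχ0 y hy'.le hy.le]
      simp
    have h2 : ∀ ψ : CircleFun 𝕜, (rot 0).pullback ψ = ψ := fun ψ => by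
      ext y
      change ψ.1 (y + 0) = ψ.1 y
      rw [add_zero]
    have h3 := (densityPullback_eventuallyEq_of_translation h1 mu (A.1 φ)).eq_of_nhds
    have h4 := (DiffOp.congr A (densityPullback_eventuallyEq_of_translation h1 lam φ)).eq_of_nhds
    rw [h3, h4, h2, h2]

end Vanish

end

noncomputable section

open Filter Topology CircleFun CircleDiffeo

variable {𝕜 : Type*} [RCLike 𝕜]

/-- `c ^ s = exp (s * log c)` for real positive `c`. -/
def expLog (c : ℝ) (s : 𝕜) : 𝕜 := NormedSpace.exp (s * ((Real.log c : ℝ) : 𝕜))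

theorem expLog_add (c : ℝ) (s t : 𝕜) : expLog c (s + t) = expLog c s * expLog c t := by
  let _ : NormedAlgebra ℚ 𝕜 := NormedAlgebra.restrictScalars ℚ ℝ 𝕜
  rw [expLog, add_mul, NormedSpace.exp_add]
  rfl

theorem expLog_zero (c : ℝ) : expLog c (0 : 𝕜) = 1 := by
  rw [expLog, zero_mul, NormedSpace.exp_zero]

theorem expLog_ne_zero (c : ℝ) (s : 𝕜) : expLog c s ≠ 0 := by
  intro h
  have := expLog_add c s (-s)
  rw [add_neg_cancel, expLog_zero, h, zero_mul] at this
  exact one_ne_zero this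

theorem expLog_nat {c : ℝ} (hc : 0 < c) (n : ℕ) : expLog c (n : 𝕜) = (c : 𝕜) ^ n := by
  have h1 : expLog c (1 : 𝕜) = c := by
    rw [expLog, one_mul]
    have h := congrArg (algebraMap ℝ 𝕜) (Real.exp_log hc)
    rw [Real.exp_eq_exp_ℝ, NormedSpace.algebraMap_exp_comm] at h
    exact h
  induction n with
  | zero => simp [expLog_zero]
  | succ n ih => rw [Nat.cast_succ, expLog_add, ih, h1, pow_succ]

/-- The derivative of (1 + u)^s at u = 0 is s. -/
theorem eq_zero_of_expLog_eq_one {s : 𝕜} (h : ∀ᶠ u in 𝓝 (0 : ℝ), expLog (1 + u) s = 1) :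
    s = 0 := by
  have hl : HasDerivAt (fun u : ℝ => s * ((Real.log (1 + u) : ℝ) : 𝕜)) (s * ((1 : ℝ) : 𝕜)) 0 := by
    have h1 : HasDerivAt (fun u : ℝ => Real.log (1 + u)) 1 0 := by
      have := ((hasDerivAt_id (0 : ℝ)).const_add 1).log (by simp)
      simpa using this
    exact ((RCLike.ofRealCLM (K := 𝕜)).hasFDerivAt.comp_hasDerivAt 0 h1).const_mul s
  have h2 := HasDerivAt.scomp (0 : ℝ)
    (hasDerivAt_exp (𝕂 := 𝕜) (x := s * ((Real.log (1 + 0) : ℝ) : 𝕜))) hl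
  have h3 : HasDerivAt (fun u : ℝ => expLog (1 + u) s) 0 0 :=
    (hasDerivAt_const (0 : ℝ) (1 : 𝕜)).congr_of_eventuallyEq h
  have := h2.unique h3
  simpa using this

/-! ### Dilations near the fixed point 0 -/

section Dilation

variable {k : ℕ} {lam mu : 𝕜} {f : CircleDiffeo} {c : ℝ}

theorem CircleDiffeo.eventually_map_symm (f : CircleDiffeo) (hf : f.toEquiv 0 = 0) {p : ℝ → Prop}
    (h : ∀ᶠ x in 𝓝 0, p (f.toEquiv x)) : ∀ᶠ y in 𝓝 0, p y := by
  have hs : f.symm.toEquiv 0 = 0 := by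
    conv_lhs => rw [← hf]
    exact f.symm_toEquiv_apply 0
  have ht : Tendsto f.symm.toEquiv (𝓝 0) (𝓝 0) := by
    have := f.symm.continuous.tendsto 0
    rwa [hs] at this
  filter_upwards [ht.eventually h] with y hy
  rwa [toEquiv_symm_apply] at hy

/-- The derivatives of the pullback under a diffeomorphism that is a dilation near `0`. -/
theorem ddx_iterate_densityPullback_dilation (hf : f.toEquiv =ᶠ[𝓝 0] fun x => c * x) (lam : 𝕜)
    (i : ℕ) : ∀ᶠ x in 𝓝 0, ∀ φ : CircleFun 𝕜,
      ((ddx 𝕜)^[i] (f.densityPullback lam φ)).1 x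
        = expLog c lam * (c : 𝕜) ^ i * ((ddx 𝕜)^[i] φ).1 (f.toEquiv x) := by
  induction i with
  | zero =>
    filter_upwards [hf.deriv] with x hx φ
    have hd : deriv (fun x => c * x) x = c := by simp
    rw [Function.iterate_zero, id, densityPullback_apply, derivPow_apply, hx, hd]
    simp [expLog]
  | succ i ih =>
    have h := eventually_eventually_nhds.2 ih
    filter_upwards [h, hf.deriv, hf] with x hx hx' hfx φ
    have hd : deriv (fun x => c * x) x = c := by simp
    rw [hd] at hx'
    rw [Function.iterate_succ_apply', Function.iterate_succ_apply', ddx_apply]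
    have he : ((ddx 𝕜)^[i] (f.densityPullback lam φ)).1 =ᶠ[𝓝 x]
        fun y => expLog c lam * (c : 𝕜) ^ i * ((ddx 𝕜)^[i] φ).1 (f.toEquiv y) := by
      filter_upwards [hx] with y hy using hy φ
    have h1 := ((CircleFun.hasDerivAt ((ddx 𝕜)^[i] φ) (f.toEquiv x)).scomp x
      (f.differentiable x).hasDerivAt).const_mul (expLog c lam * (c : 𝕜) ^ i)
    rw [he.deriv_eq]
    refine h1.deriv.trans ?_
    rw [hx', RCLike.real_smul_eq_coe_mul, pow_succ]
    ring

/-- A dilation has constant derivative, so the chain rule produces no lower order terms: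
coefficients of different orders do not mix and each is merely rescaled. -/
theorem coefAt_diffOpAct_dilation (hf : f.toEquiv =ᶠ[𝓝 0] fun x => c * x) (l : ℕ) :
    ∀ᶠ x in 𝓝 0, ∀ A : DiffOp k lam mu,
      expLog c mu * coefAt k lam mu l (f.toEquiv x) (diffOpAct k lam mu f A)
        = expLog c lam * (c : 𝕜) ^ l * coefAt k lam mu l x A := by
  have h := (Finset.eventually_all (Finset.range (k + 1))).2 fun i _ =>
    ddx_iterate_densityPullback_dilation (𝕜 := 𝕜) hf lam i
  filter_upwards [h, ddx_iterate_densityPullback_dilation (𝕜 := 𝕜) hf mu 0] with x hx h0 A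
  have h1 := f.opAct_apply_map lam mu A.1 (testFun 𝕜 l (f.toEquiv x)) x
  have h2 := h0 1
  simp only [Function.iterate_zero, id, densityPullback_apply, one_val, mul_one, pow_zero] at h2
  rw [h2] at h1
  rw [coefAt_apply, diffOpAct_coe, h1, apply_eq_sum_coefAt]
  rw [Finset.sum_congr rfl fun i hi => by rw [hx i hi, ddx_iterate_testFun]]
  rcases le_or_gt l k with hl | hl
  · rw [Finset.sum_eq_single l]
    · simp
      ring
    · intro j _ hj
      simp [hj]
    · intro h
      exact absurd (Finset.mem_range.2 (by omega)) h
  · obtain ⟨a, rfl⟩ := op_surjective A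
    rw [coefAt_op_of_lt _ hl, mul_zero]
    refine Finset.sum_eq_zero fun j hj => ?_
    have := Finset.mem_range.1 hj
    rw [if_neg (by omega), mul_zero, mul_zero]

theorem exists_dilation : ∃ ε > 0, ∀ s : ℝ, |s| < ε →
    ∃ f : CircleDiffeo, f.toEquiv =ᶠ[𝓝 0] fun x => (1 + s) * x := by
  obtain ⟨ε, hε, h⟩ := exists_perturb coord
  refine ⟨ε, hε, fun s hs => ?_⟩
  obtain ⟨f, hf⟩ := h s hs
  refine ⟨f, ?_⟩
  filter_upwards [coord_eventuallyEq] with x hx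
  rw [hf, hx]
  ring

end Dilation

/-! ### Locality of symmetries -/

section Locality

variable {k : ℕ} {lam mu : 𝕜} {T : Module.End 𝕜 (DiffOp k lam mu)}

/-- Diffeomorphisms supported near 0 fix A, hence also T A. Among them are maps equal to x ↦ (1 + s)
x near 0, under which the coefficient of order l at 0 is multiplied by (1 + s)^(l - (mu - lam)). A
non-zero value would make this factor 1 for all small s. -/
theorem coefAt_symm_eq_zero_of_ne (hT : T ∈ SymmAlg k lam mu) {A : DiffOp k lam mu}
    (hA : VanishNear A 0) {l : ℕ} (hl : (l : 𝕜) ≠ mu - lam) : coefAt k lam mu l 0 (T A) = 0 := by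
  by_contra hne
  refine hl (sub_eq_zero.1 (eq_zero_of_expLog_eq_one ?_))
  obtain ⟨χ, hχ, h⟩ := exists_diffOpAct_eq_self hA
  obtain ⟨ε, hε, h⟩ := h coord
  rw [Metric.eventually_nhds_iff]
  refine ⟨min ε 1, by positivity, fun s hs => ?_⟩
  have hs' : |s| < min ε 1 := by simpa using hs
  obtain ⟨f, hf, hfA⟩ := h s (hs'.trans_le (min_le_left _ _))
  have hf' : f.toEquiv =ᶠ[𝓝 0] fun x => (1 + s) * x := by
    filter_upwards [coord_eventuallyEq, hχ] with x hx hx'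
    rw [hf, mul_val, hx, hx']
    ring
  have h1 := (coefAt_diffOpAct_dilation (k := k) (lam := lam) (mu := mu) hf' l).self_of_nhds (T A)
  have h0 : f.toEquiv 0 = 0 := by simpa using hf'.eq_of_nhds
  rw [h0, ← mem_symmAlg_iff.1 hT, hfA] at h1
  have hs1 : 0 < 1 + s := by
    have := (abs_lt.1 (hs'.trans_le (min_le_right _ _))).1
    linarith
  have h2 := mul_right_cancel₀ hne h1
  rw [← expLog_nat hs1, ← expLog_add] at h2
  have h3 : expLog (1 + s) ((l : 𝕜) - (mu - lam)) * expLog (1 + s) mu = expLog (1 + s) mu := by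
    rw [← expLog_add, h2]
    congr 1
    ring
  exact mul_right_cancel₀ (expLog_ne_zero (1 + s) mu) (by rw [h3, one_mul])

/-- At 0 only the coefficient of order r + M + 1 of T A survives. Test it on z^r: a map equal to x +
τ x^(M+2) near 0 fixes T A and turns z^r into z^r + (r + lam (M+2)) τ z^(r+M+1) + ..., whose image
at 0 must remain zero. -/
theorem weight_eq_of_coefAt_ne_zero (hT : T ∈ SymmAlg k lam mu) {A : DiffOp k lam mu}
    (hA : VanishNear A 0) {M r : ℕ} (hl : ((r + M + 1 : ℕ) : 𝕜) = mu - lam) (hk : r + M + 1 ≤ k)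
    (hne : coefAt k lam mu (r + M + 1) 0 (T A) ≠ 0) : (r : 𝕜) + lam * (M + 2) = 0 := by
  obtain ⟨χ, hχ, h⟩ := exists_diffOpAct_eq_self hA
  obtain ⟨ε, hε, h⟩ := h (coord ^ (M + 2))
  obtain ⟨f, hf, hfA⟩ := h (ε / 2) (by rw [abs_of_pos (by positivity)]; linarith)
  have hf' : f.toEquiv =ᶠ[𝓝 0] fun x => x + (ε / 2) * x ^ (M + 2) := by
    filter_upwards [coord_eventuallyEq, hχ] with x hx hx'
    rw [hf, mul_val, pow_val, hx, hx']
    ring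
  have h0 := map_zero_of_expansion hf'
  have h1 := f.opAct_apply_map lam mu (T A).1 (zc 𝕜 ^ r) 0
  rw [derivPow_zero_of_expansion hf', one_mul, h0, ← diffOpAct_coe, ← mem_symmAlg_iff.1 hT,
    hfA] at h1
  have key : ∀ φ : CircleFun 𝕜, ((T A).1 φ).1 0
      = coefAt k lam mu (r + M + 1) 0 (T A) * ((ddx 𝕜)^[r + M + 1] φ).1 0 := fun φ => by
    rw [apply_eq_sum_coefAt, Finset.sum_eq_single (r + M + 1)]
    · intro j _ hj
      rw [coefAt_symm_eq_zero_of_ne hT hA, zero_mul]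
      rw [← hl]
      exact_mod_cast hj
    · intro h
      exact absurd (Finset.mem_range.2 (by omega)) h
  rw [key, key, ddx_iterate_zc_pow_zero, if_neg (by omega), mul_zero] at h1
  have h2 := mem_jet.1 (densityPullback_expansion (𝕜 := 𝕜) hf' lam r) (r + M + 1) (by omega)
  rw [ddx_iterate_sub, ddx_iterate_add, ddx_iterate_smul, sub_val, add_val, smul_val,
    ddx_iterate_zc_pow_zero, ddx_iterate_zc_pow_zero, if_neg (by omega), if_pos rfl, zero_add,
    sub_eq_zero] at h2
  rw [h2] at h1
  have h3 := (mul_eq_zero.1 h1.symm).resolve_left hne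
  have h4 := (mul_eq_zero.1 h3).resolve_right (Nat.cast_ne_zero.2 (Nat.factorial_ne_zero _))
  refine (mul_eq_zero.1 h4).resolve_right ?_
  have : ε / 2 ≠ 0 := by positivity
  exact_mod_cast this

/-- Symmetries are local, apart from two exceptional coefficients. -/
theorem coefAt_symm_eq_zero (hT : T ∈ SymmAlg k lam mu) {A : DiffOp k lam mu}
    (hA : VanishNear A 0) {l : ℕ} (hk : l ≤ k)
    (hl : ¬((l : 𝕜) = mu - lam ∧ (l = 0 ∨ (l = 1 ∧ lam = 0)))) :
    coefAt k lam mu l 0 (T A) = 0 := by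
  by_contra hne
  have hl0 : (l : 𝕜) = mu - lam := by
    by_contra h
    exact hne (coefAt_symm_eq_zero_of_ne hT hA h)
  refine hl ⟨hl0, ?_⟩
  rcases l with _ | _ | l
  · exact Or.inl rfl
  · have := weight_eq_of_coefAt_ne_zero (M := 0) (r := 0) hT hA hl0 hk hne
    simp at this
    exact Or.inr ⟨rfl, this⟩
  -- From order 2 on, both M = 0 and M = 1 are available. With the order written l + 2 they give l +
  -- 1 + 2 lam = 0 and l + 3 lam = 0; eliminating lam leaves l + 3 = 0.
  · exfalso
    have h1 := weight_eq_of_coefAt_ne_zero (M := 0) (r := l + 1) hT hA hl0 hk hne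
    have h2 := weight_eq_of_coefAt_ne_zero (M := 1) (r := l) hT hA hl0 hk hne
    push_cast at h1 h2
    have h3 : ((l + 3 : ℕ) : 𝕜) = 0 := by
      push_cast
      linear_combination 3 * h1 - 2 * h2
    exact absurd h3 (Nat.cast_ne_zero.2 (by omega))

/-- Where an operator vanishes, its image under a symmetry has locally constant coefficients. -/
theorem coefAt_symm_eventually_const (hT : T ∈ SymmAlg k lam mu) {A : DiffOp k lam mu}
    (hA : VanishNear A 0) (l : ℕ) :
    ∀ᶠ s in 𝓝 0, coefAt k lam mu l s (T A) = coefAt k lam mu l 0 (T A) := by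
  obtain ⟨χ, hχ, h⟩ := exists_diffOpAct_eq_self hA
  -- With η = 1 the diffeomorphisms fixing A are translations by s near 0, and these compare the
  -- coefficients of T A at 0 and at s.
  obtain ⟨ε, hε, h⟩ := h 1
  rw [Metric.eventually_nhds_iff]
  refine ⟨ε, hε, fun s hs => ?_⟩
  obtain ⟨f, hf, hfA⟩ := h s (by simpa using hs)
  have hf' : f.toEquiv =ᶠ[𝓝 0] fun x => x + s := by
    filter_upwards [hχ] with x hx'
    rw [hf, mul_val, hx']
    simp
  have h1 := f.opAct_apply_map lam mu (T A).1 (testFun 𝕜 l (0 + s)) 0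
  have h2 : ∀ ψ : CircleFun 𝕜, (f.densityPullback mu ψ).1 0 = ψ.1 (0 + s) := fun ψ =>
    (densityPullback_eventuallyEq_of_translation hf' mu ψ).eq_of_nhds
  have h3 := h2 1
  rw [densityPullback_apply, one_val, mul_one, one_val] at h3
  rw [h3, one_mul, hf'.eq_of_nhds, ← diffOpAct_coe, ← mem_symmAlg_iff.1 hT, hfA,
    (DiffOp.congr (T A) (densityPullback_eventuallyEq_of_translation hf' lam _)).eq_of_nhds,
    pullback_rot_testFun] at h1
  rw [zero_add] at h1
  exact h1

end Locality

end

noncomputable section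

open Filter Topology CircleFun CircleDiffeo

variable {𝕜 : Type*} [RCLike 𝕜]

/-! ### Functionals that are local at 0 and homogeneous under dilations -/

section Functional

variable {k : ℕ} {lam mu : 𝕜}

theorem vanishNear_diffOpAct_mon_sub {f : CircleDiffeo} {c : ℝ}
    (hf : f.toEquiv =ᶠ[𝓝 0] fun x => c * x) {i : ℕ} (hi : i ≤ k) {b b' : CircleFun 𝕜}
    (hb : ∀ᶠ x in 𝓝 0, expLog c mu * b'.1 (c * x) = expLog c lam * (c : 𝕜) ^ i * b.1 x) :
    VanishNear (diffOpAct k lam mu f (mon k lam mu i b) - mon k lam mu i b') 0 := by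
  have h0 : f.toEquiv 0 = 0 := by simpa using hf.eq_of_nhds
  refine f.eventually_map_symm h0 ?_
  filter_upwards [hb, hf, ddx_iterate_densityPullback_dilation (𝕜 := 𝕜) hf lam i,
    ddx_iterate_densityPullback_dilation (𝕜 := 𝕜) hf mu 0] with x hbx hfx hx hx0 φ
  have h1 := f.opAct_apply_map lam mu (mon k lam mu i b).1 φ x
  have h2 := hx0 1
  simp only [Function.iterate_zero, id, densityPullback_apply, one_val, mul_one, pow_zero] at h2
  rw [h2, mon_apply hi, mul_val, hx] at h1
  have h3 : expLog c mu * (f.opAct lam mu (mon k lam mu i b).1 φ).1 (f.toEquiv x)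
      = expLog c mu * ((mon k lam mu i b').1 φ).1 (f.toEquiv x) := by
    rw [h1, mon_apply hi, mul_val, hfx]
    linear_combination -((ddx 𝕜)^[i] φ).1 (c * x) * hbx
  have h4 := mul_left_cancel₀ (expLog_ne_zero c mu) h3
  rw [DiffOp.sub_apply, diffOpAct_coe, sub_val, h4, sub_self]

/-- The Taylor polynomial of `a` at `0`. -/
theorem sub_taylor_mem_jet (a : CircleFun 𝕜) (n : ℕ) :
    a - ∑ j ∈ Finset.range n, (((ddx 𝕜)^[j] a).1 0 * ((j.factorial : 𝕜)⁻¹)) • zc 𝕜 ^ j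
      ∈ jet 𝕜 n := by
  intro m hm
  have hlin : (ddx 𝕜)^[m] (∑ j ∈ Finset.range n,
      (((ddx 𝕜)^[j] a).1 0 * ((j.factorial : 𝕜)⁻¹)) • zc 𝕜 ^ j)
      = ∑ j ∈ Finset.range n, (((ddx 𝕜)^[j] a).1 0 * ((j.factorial : 𝕜)⁻¹)) •
        (ddx 𝕜)^[m] (zc 𝕜 ^ j) := by
    simp only [← Module.End.pow_apply, map_sum, map_smul]
  rw [ddx_iterate_sub, sub_val, hlin, sum_val, Finset.sum_eq_single m]
  · rw [smul_val, ddx_iterate_zc_pow_zero, if_pos rfl, mul_assoc,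
      inv_mul_cancel₀ (Nat.cast_ne_zero.2 (Nat.factorial_ne_zero m)), mul_one, sub_self]
  · intro j _ hj
    rw [smul_val, ddx_iterate_zc_pow_zero, if_neg hj.symm, mul_zero]
  · intro h
    exact absurd (Finset.mem_range.2 hm) h

variable {τ : DiffOp k lam mu →ₗ[𝕜] 𝕜} {l e : ℕ}

/-- Near 0 the operator z^j d^i is an eigenvector of every dilation. A functional homogeneous of a
different weight must vanish on it. The parameter e is 0 for the value of the coefficient of order l
at 0, and 1 for the value of its derivative. -/
theorem functional_mon_pow_eq_zero (hloc : ∀ A, VanishNear A 0 → τ A = 0)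
    (hdil : ∀ (f : CircleDiffeo) (c : ℝ), 0 < c → f.toEquiv =ᶠ[𝓝 0] (fun x => c * x) → ∀ A,
      expLog c mu * (c : 𝕜) ^ e * τ (diffOpAct k lam mu f A) = expLog c lam * (c : 𝕜) ^ l * τ A)
    {i : ℕ} (hi : i ≤ k) {j : ℕ} (hj : l + j ≠ i + e) : τ (mon k lam mu i (zc 𝕜 ^ j)) = 0 := by
  obtain ⟨ε, hε, h⟩ := exists_dilation
  obtain ⟨s, hs0, hsε, hs1⟩ : ∃ s : ℝ, 0 < s ∧ s < ε ∧ s < 1 :=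
    ⟨min (ε / 2) (1 / 2), by positivity, by linarith [min_le_left (ε / 2) (1 / 2 : ℝ)],
      by linarith [min_le_right (ε / 2) (1 / 2 : ℝ)]⟩
  obtain ⟨f, hf⟩ := h (-s) (by rwa [abs_neg, abs_of_pos hs0])
  set c : ℝ := 1 + -s with hc
  have hc0 : 0 < c := by linarith
  have hc1 : c < 1 := by linarith
  have hcK : (c : 𝕜) ≠ 0 := by exact_mod_cast hc0.ne'
  have hmu := expLog_ne_zero c mu
  have hla := expLog_ne_zero c lam
  set K : 𝕜 := expLog c lam * (c : 𝕜) ^ i / (expLog c mu * (c : 𝕜) ^ j) with hK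
  have h1 : VanishNear (diffOpAct k lam mu f (mon k lam mu i (zc 𝕜 ^ j))
      - mon k lam mu i (K • zc 𝕜 ^ j)) 0 := by
    refine vanishNear_diffOpAct_mon_sub hf hi ?_
    have hz := zc_eventuallyEq (𝕜 := 𝕜)
    have ht : Tendsto (fun x : ℝ => c * x) (𝓝 0) (𝓝 0) := by
      have : Continuous fun x : ℝ => c * x := by fun_prop
      simpa using this.tendsto 0
    filter_upwards [hz, ht.eventually hz] with x hx hx'
    rw [smul_val, pow_val, pow_val, hx, hx', hK]
    push_cast
    field_simp
    rw [mul_pow]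
  have h2 := hloc _ h1
  rw [map_sub, sub_eq_zero, map_smul, map_smul, smul_eq_mul] at h2
  have h3 := hdil f c hc0 hf (mon k lam mu i (zc 𝕜 ^ j))
  rw [h2, hK] at h3
  by_contra hne
  field_simp at h3
  rw [← pow_add, ← pow_add] at h3
  have h4 : c ^ (e + i) = c ^ (l + j) := by
    have h5 : (c : 𝕜) ^ (e + i) = (c : 𝕜) ^ (l + j) := by
      rw [h3]
      ring
    exact_mod_cast h5
  have := (pow_right_strictAnti₀ hc0 hc1).injective h4
  omega

/-- This replaces continuity. Let K be the factor by which τ scales under the dilation. If a is flat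
enough, there is β such that, near 0, the transform of β d^i equals (K β + a) d^i. Applying τ gives
K τ(β d^i) on the left and K τ(β d^i) + τ(a d^i) on the right. -/
theorem functional_mon_eq_zero_of_mem_jet (he : e ≤ 1) (hloc : ∀ A, VanishNear A 0 → τ A = 0)
    (hdil : ∀ (f : CircleDiffeo) (c : ℝ), 0 < c → f.toEquiv =ᶠ[𝓝 0] (fun x => c * x) → ∀ A,
      expLog c mu * (c : 𝕜) ^ e * τ (diffOpAct k lam mu f A) = expLog c lam * (c : 𝕜) ^ l * τ A)
    {i : ℕ} (hi : i ≤ k) {a : CircleFun 𝕜} (ha : a ∈ jet 𝕜 (i + 2)) :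
    τ (mon k lam mu i a) = 0 := by
  obtain ⟨ε, hε, h⟩ := exists_dilation
  obtain ⟨s, hs0, hsε, hs1⟩ : ∃ s : ℝ, 0 < s ∧ s < ε ∧ s < 1 :=
    ⟨min (ε / 2) (1 / 2), by positivity, by linarith [min_le_left (ε / 2) (1 / 2 : ℝ)],
      by linarith [min_le_right (ε / 2) (1 / 2 : ℝ)]⟩
  obtain ⟨f, hf⟩ := h (-s) (by rwa [abs_neg, abs_of_pos hs0])
  set c : ℝ := 1 + -s with hc
  have hc0 : 0 < c := by linarith
  have hc1 : c < 1 := by linarith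
  have hcK : (c : 𝕜) ≠ 0 := by exact_mod_cast hc0.ne'
  have hmu := expLog_ne_zero c mu
  have hla := expLog_ne_zero c lam
  set κ : 𝕜 := expLog c mu / (expLog c lam * (c : 𝕜) ^ i) with hκ
  have hiter : ∀ j x, iteratedDeriv j (fun x => κ • a.1 (c * x)) x
      = κ * ((c : 𝕜) ^ j * ((ddx 𝕜)^[j] a).1 (c * x)) := by
    intro j x
    have h1 : iteratedDeriv j (fun x => a.1 (c * x)) x = c ^ j • iteratedDeriv j a.1 (c * x) := by
      have haj : ContDiff ℝ j a.1 := a.2.1.of_le (by exact_mod_cast le_top)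
      simpa only [smul_eq_mul] using congrFun (iteratedDeriv_comp_const_smul haj c) x
    rw [iteratedDeriv_fun_const_smul_field, h1, iteratedDeriv_eq_iterate, ddx_iterate_apply,
      smul_eq_mul, RCLike.real_smul_eq_coe_mul]
    push_cast
    rfl
  -- Solvability needs c^(l - e - i) c^(i + 2) < 1. This holds because e ≤ 1, and it is the reason
  -- for flatness of order i + 2.
  obtain ⟨b, hbs, hbe⟩ := exists_eq_smul_comp_mul_add (i + 2) hc0 hc1 (c ^ l / c ^ (e + i))
    (by
      rw [abs_of_pos (by positivity), div_mul_eq_mul_div, div_lt_one (by positivity), ← pow_add]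
      exact pow_lt_pow_right_of_lt_one₀ hc0 hc1 (by omega))
    (fun x => κ • a.1 (c * x)) ((a.2.1.comp (contDiff_const.mul contDiff_id)).const_smul κ)
    (fun j => by
      obtain ⟨C, _, hC⟩ := CircleFun.exists_bound ((ddx 𝕜)^[j] a)
      refine ⟨‖κ‖ * (‖(c : 𝕜) ^ j‖ * C), fun x => ?_⟩
      rw [hiter, norm_mul, norm_mul]
      gcongr
      exact hC _)
    (fun j hj => by rw [hiter, mul_zero, mem_jet.1 ha j hj, mul_zero, mul_zero])
  obtain ⟨β, hβ⟩ := exists_eventuallyEq b hbs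
  set K : 𝕜 := expLog c lam * (c : 𝕜) ^ l / (expLog c mu * (c : 𝕜) ^ e) with hK
  have h1 : VanishNear (diffOpAct k lam mu f (mon k lam mu i β)
      - mon k lam mu i (K • β + a)) 0 := by
    refine vanishNear_diffOpAct_mon_sub hf hi ?_
    have ht : Tendsto (fun x : ℝ => c * x) (𝓝 0) (𝓝 0) := by
      have : Continuous fun x : ℝ => c * x := by fun_prop
      simpa using this.tendsto 0
    filter_upwards [hβ, ht.eventually hβ] with x hx hx'
    have hbx := hbe x
    rw [RCLike.real_smul_eq_coe_mul, smul_eq_mul, hκ] at hbx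
    rw [add_val, smul_val, hx, hx', hbx, hK]
    push_cast
    field_simp
    ring
  have h2 := hloc _ h1
  rw [map_sub, sub_eq_zero, map_add, map_add, map_smul, map_smul, smul_eq_mul] at h2
  have h3 := hdil f c hc0 hf (mon k lam mu i β)
  rw [h2, hK] at h3
  field_simp at h3
  have h4 : expLog c mu * (c : 𝕜) ^ e * τ (mon k lam mu i a) = 0 := by linear_combination h3
  exact (mul_eq_zero.1 h4).resolve_left (mul_ne_zero hmu (pow_ne_zero _ hcK))

/-- Split a into its Taylor polynomial of degree i + 1 and a flat remainder, which contributes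
nothing. By homogeneity only the monomial of degree i + e - l can contribute. -/
theorem functional_mon (he : e ≤ 1) (hloc : ∀ A, VanishNear A 0 → τ A = 0)
    (hdil : ∀ (f : CircleDiffeo) (c : ℝ), 0 < c → f.toEquiv =ᶠ[𝓝 0] (fun x => c * x) → ∀ A,
      expLog c mu * (c : 𝕜) ^ e * τ (diffOpAct k lam mu f A) = expLog c lam * (c : 𝕜) ^ l * τ A) :
    ∃ u : ℕ → 𝕜, ∀ i ≤ k, ∀ a, τ (mon k lam mu i a)
      = if l ≤ i + e then u i * ((ddx 𝕜)^[i + e - l] a).1 0 else 0 := by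
  refine ⟨fun i => (((i + e - l).factorial : 𝕜)⁻¹) * τ (mon k lam mu i (zc 𝕜 ^ (i + e - l))),
    fun i hi a => ?_⟩
  have h1 := functional_mon_eq_zero_of_mem_jet he hloc hdil hi (sub_taylor_mem_jet a (i + 2))
  rw [map_sub, map_sub, sub_eq_zero] at h1
  rw [h1, map_sum, map_sum]
  simp only [map_smul, smul_eq_mul]
  split_ifs with hl
  · rw [Finset.sum_eq_single (i + e - l)]
    · ring
    · intro j _ hj
      rw [functional_mon_pow_eq_zero hloc hdil hi (by omega), mul_zero]
    · intro h
      exact absurd (Finset.mem_range.2 (by omega)) h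
  · refine Finset.sum_eq_zero fun j _ => ?_
    rw [functional_mon_pow_eq_zero hloc hdil hi (by omega), mul_zero]

end Functional

/-! ### The general form of a symmetry -/

section Form

variable {k : ℕ} {lam mu : 𝕜} {T : Module.End 𝕜 (DiffOp k lam mu)}

variable (k lam mu) in
/-- The coefficient of `d^i/dx^i` as a function on the circle. -/
def coefFun (i : ℕ) : DiffOp k lam mu →ₗ[𝕜] CircleFun 𝕜 where
  toFun A := ⟨fun x => coefAt k lam mu i x A, by
    obtain ⟨a, rfl⟩ := op_surjective A
    rcases le_or_gt i k with hi | hi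
    · simp only [coefAt_op a hi]
      exact (a i).2
    · simp only [coefAt_op_of_lt a hi]
      exact (0 : CircleFun 𝕜).2⟩
  map_add' A B := Subtype.ext (funext fun x => map_add (coefAt k lam mu i x) A B)
  map_smul' c A := Subtype.ext (funext fun x => map_smul (coefAt k lam mu i x) c A)

@[simp] theorem coefFun_apply (i : ℕ) (A : DiffOp k lam mu) (x : ℝ) :
    (coefFun k lam mu i A).1 x = coefAt k lam mu i x A := rfl

theorem coefFun_mon {i j : ℕ} (hj : j ≤ k) (a : CircleFun 𝕜) :
    coefFun k lam mu j (mon k lam mu i a) = if j = i then a else 0 := by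
  ext x
  change coefAt k lam mu j x (mon k lam mu i a) = (if j = i then a else 0 : CircleFun 𝕜).1 x
  rw [coefAt_mon hj]
  split_ifs <;> rfl

theorem coefAt_symm_mon (hT : T ∈ SymmAlg k lam mu) (l i : ℕ) (a : CircleFun 𝕜) (x : ℝ) :
    coefAt k lam mu l x (T (mon k lam mu i a))
      = coefAt k lam mu l 0 (T (mon k lam mu i ((rot x).pullback a))) := by
  have h := coefAt_diffOpAct_rot (k := k) l x 0 (T (mon k lam mu i ((rot x).pullback a)))
  rwa [← mem_symmAlg_iff.1 hT, diffOpAct_rot_mon, zero_add] at h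

theorem coefAt_symm_mon_eq (hT : T ∈ SymmAlg k lam mu) {l : ℕ} (hk : l ≤ k)
    (hl : ¬((l : 𝕜) = mu - lam ∧ (l = 0 ∨ (l = 1 ∧ lam = 0)))) :
    ∃ u : ℕ → 𝕜, ∀ i ≤ k, ∀ a x, coefAt k lam mu l x (T (mon k lam mu i a))
      = if l ≤ i then u i * ((ddx 𝕜)^[i - l] a).1 x else 0 := by
  obtain ⟨u, hu⟩ := functional_mon (e := 0) (l := l) (τ := coefAt k lam mu l 0 ∘ₗ T) zero_le_one
    (fun A hA => coefAt_symm_eq_zero hT hA hk hl) (fun f c hc hf A => by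
      have h := (coefAt_diffOpAct_dilation (k := k) (lam := lam) (mu := mu) hf l).self_of_nhds (T A)
      rw [show f.toEquiv 0 = 0 by simpa using hf.eq_of_nhds] at h
      rw [pow_zero, mul_one, LinearMap.comp_apply, mem_symmAlg_iff.1 hT, h]
      rfl)
  refine ⟨u, fun i hi a x => ?_⟩
  rw [coefAt_symm_mon hT]
  refine (hu i hi _).trans ?_
  rw [add_zero, ddx_iterate_rot, pullback_apply, rot_apply, zero_add]

theorem eq_const_of_ddx_eq_zero {φ : CircleFun 𝕜} (h : ddx 𝕜 φ = 0) (x : ℝ) :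
    φ.1 x = φ.1 0 :=
  is_const_of_deriv_eq_zero (φ.2.1.differentiable (by simp))
    (fun y => congrArg (fun g => g.1 y) h) x 0

theorem eq_zero_of_ddx_eq_const {φ : CircleFun 𝕜} {s : 𝕜} (h : ∀ x, (ddx 𝕜 φ).1 x = s) :
    s = 0 := by
  have hd : ∀ x : ℝ, HasDerivAt (fun x : ℝ => φ.1 x - x • s) 0 x := fun x => by
    have h1 := (CircleFun.hasDerivAt φ x).sub ((hasDerivAt_id x).smul_const s)
    rw [h, one_smul, sub_self] at h1
    exact h1
  have h2 := is_const_of_deriv_eq_zero (fun x => (hd x).differentiableAt) (fun x => (hd x).deriv)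
    1 0
  have h3 := φ.2.2 0
  rw [zero_add] at h3
  simpa [h3] using h2

/-- This form also covers the coefficient at which locality may fail. Where A vanishes, the
coefficients of T A are locally constant, so the derivative of a coefficient is a local functional
of weight e = 1. Integrating it back leaves a constant that depends linearly on A; this constant is
c. -/
theorem coefAt_symm_mon_eq_add (hT : T ∈ SymmAlg k lam mu) {l : ℕ} :
    ∃ (u : ℕ → 𝕜) (c : DiffOp k lam mu →ₗ[𝕜] 𝕜), ∀ i ≤ k, ∀ a x,
      coefAt k lam mu l x (T (mon k lam mu i a))
        = (if l ≤ i then u i * ((ddx 𝕜)^[i - l] a).1 x else 0) + c (mon k lam mu i a) := by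
  let ev : CircleFun 𝕜 →ₗ[𝕜] 𝕜 :=
    { toFun := fun φ => φ.1 0, map_add' := fun _ _ => rfl, map_smul' := fun _ _ => rfl }
  have hev : ∀ φ, ev φ = φ.1 0 := fun _ => rfl
  obtain ⟨u, hu⟩ := functional_mon (e := 1) (l := l)
    (τ := ev ∘ₗ ddx 𝕜 ∘ₗ coefFun k lam mu l ∘ₗ T) le_rfl
    (fun A hA => by
      have h := coefAt_symm_eventually_const hT hA l
      change deriv (coefFun k lam mu l (T A)).1 0 = 0
      refine (EventuallyEq.deriv_eq (f := fun _ => coefAt k lam mu l 0 (T A)) h).trans ?_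
      exact deriv_const _ _)
    (fun f c hc hf A => by
      have h := coefAt_diffOpAct_dilation (k := k) (lam := lam) (mu := mu) hf l
      have h0 : f.toEquiv 0 = 0 := by simpa using hf.eq_of_nhds
      have hf1 : HasDerivAt f.toEquiv c 0 := by
        have := (hasDerivAt_id (0 : ℝ)).const_mul c
        rw [mul_one] at this
        exact this.congr_of_eventuallyEq hf
      have h1 : HasDerivAt (coefFun k lam mu l (T (diffOpAct k lam mu f A))).1
          ((ddx 𝕜 (coefFun k lam mu l (T (diffOpAct k lam mu f A)))).1 0) (f.toEquiv 0) := by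
        rw [h0]
        exact CircleFun.hasDerivAt _ 0
      have h2 := (h1.scomp 0 hf1).const_mul (expLog c mu)
      have h3 := (CircleFun.hasDerivAt (coefFun k lam mu l (T A)) 0).const_mul
        (expLog c lam * (c : 𝕜) ^ l)
      have h4 := h2.unique (h3.congr_of_eventuallyEq (by
        filter_upwards [h] with x hx
        have := hx (T A)
        rw [← mem_symmAlg_iff.1 hT] at this
        exact this))
      rw [RCLike.real_smul_eq_coe_mul] at h4
      rw [pow_one, mul_assoc]
      exact h4)
  have hu' : ∀ i ≤ k, ∀ a x, (ddx 𝕜 (coefFun k lam mu l (T (mon k lam mu i a)))).1 x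
      = if l ≤ i + 1 then u i * ((ddx 𝕜)^[i + 1 - l] a).1 x else 0 := by
    intro i hi a x
    have h1 := hu i hi ((rot x).pullback a)
    rw [ddx_iterate_rot, pullback_apply, rot_apply, zero_add] at h1
    rw [← h1]
    have h2 : (coefFun k lam mu l (T (mon k lam mu i ((rot x).pullback a))))
        = (rot x).pullback (coefFun k lam mu l (T (mon k lam mu i a))) := by
      ext y
      change coefAt k lam mu l y (T (mon k lam mu i ((rot x).pullback a)))
        = coefAt k lam mu l (y + x) (T (mon k lam mu i a))
      rw [← coefAt_diffOpAct_rot l x y, ← mem_symmAlg_iff.1 hT, diffOpAct_rot_mon]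
    change _ = (ddx 𝕜 (coefFun k lam mu l (T (mon k lam mu i ((rot x).pullback a))))).1 0
    rw [h2]
    have h3 := congrArg (fun g => g.1 0)
      (ddx_iterate_rot x 1 (coefFun k lam mu l (T (mon k lam mu i a))))
    simp only [Function.iterate_one, pullback_apply, rot_apply, zero_add] at h3
    exact h3.symm
  -- The constant of integration, read off at the point 0: the coefficient of T A minus its local
  -- part.
  let c : DiffOp k lam mu →ₗ[𝕜] 𝕜 := coefAt k lam mu l 0 ∘ₗ T
    - ∑ i ∈ Finset.range (k + 1), (if l ≤ i then u i else 0) •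
      (ev ∘ₗ ((ddx 𝕜) ^ (i - l)) ∘ₗ coefFun k lam mu i)
  have hc : ∀ i ≤ k, ∀ a, c (mon k lam mu i a) = coefAt k lam mu l 0 (T (mon k lam mu i a))
      - if l ≤ i then u i * ((ddx 𝕜)^[i - l] a).1 0 else 0 := by
    intro i hi a
    simp only [c, LinearMap.sub_apply, LinearMap.sum_apply, LinearMap.comp_apply,
      LinearMap.smul_apply, smul_eq_mul]
    congr 1
    rw [Finset.sum_eq_single i]
    · rw [coefFun_mon hi, if_pos rfl, Module.End.pow_apply, hev]
      split_ifs
      · rfl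
      · rw [zero_mul]
    · intro j hj hji
      rw [coefFun_mon (by simpa [Nat.lt_succ_iff] using hj), if_neg hji, map_zero, map_zero,
        mul_zero]
    · intro h
      exact absurd (Finset.mem_range.2 (by omega)) h
  refine ⟨u, c, fun i hi a x => ?_⟩
  rw [hc i hi]
  rcases le_or_gt l i with hl | hl
  · have h1 : ddx 𝕜 (coefFun k lam mu l (T (mon k lam mu i a)) - u i • (ddx 𝕜)^[i - l] a) = 0 := by
      ext y
      change (ddx 𝕜 (coefFun k lam mu l (T (mon k lam mu i a))
        - u i • (ddx 𝕜)^[i - l] a)).1 y = 0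
      rw [map_sub, map_smul, ← Function.iterate_succ_apply' (ddx 𝕜), sub_val, smul_val, hu' i hi,
        if_pos (by omega), show i + 1 - l = (i - l).succ by omega, sub_self]
    have h2 := eq_const_of_ddx_eq_zero h1 x
    simp only [sub_val, coefFun_apply, smul_val] at h2
    rw [if_pos hl, if_pos hl]
    linear_combination h2
  · have h1 : ddx 𝕜 (coefFun k lam mu l (T (mon k lam mu i a))) = 0 := by
      ext y
      change (ddx 𝕜 (coefFun k lam mu l (T (mon k lam mu i a)))).1 y = 0
      rw [hu' i hi]
      split_ifs with h
      · have h2 : u i = 0 := by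
          refine eq_zero_of_ddx_eq_const (φ := coefFun k lam mu l (T (mon k lam mu i 1)))
            fun x => ?_
          rw [hu' i hi, if_pos h, show i + 1 - l = 0 by omega]
          simp
        rw [h2, zero_mul]
      · rfl
    have h2 := eq_const_of_ddx_eq_zero h1 x
    rw [if_neg (by omega), if_neg (by omega), sub_zero, zero_add]
    exact h2

variable (k lam mu) in
/-- The map `a d^i/dx^i ↦ ∑ j ≤ i, t i j * a^(j) d^(i-j)/dx^(i-j)`. -/
def locOp (t : ℕ → ℕ → 𝕜) : Module.End 𝕜 (DiffOp k lam mu) :=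
  ∑ i ∈ Finset.range (k + 1), ∑ j ∈ Finset.range (i + 1),
    t i j • (mon k lam mu (i - j) ∘ₗ ((ddx 𝕜) ^ j) ∘ₗ coefFun k lam mu i)

theorem locOp_mon (t : ℕ → ℕ → 𝕜) {i : ℕ} (hi : i ≤ k) (a : CircleFun 𝕜) :
    locOp k lam mu t (mon k lam mu i a)
      = ∑ j ∈ Finset.range (i + 1), t i j • mon k lam mu (i - j) ((ddx 𝕜)^[j] a) := by
  rw [locOp, LinearMap.sum_apply, Finset.sum_eq_single i]
  · simp [coefFun_mon hi, Module.End.pow_apply]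
  · intro j hj hji
    simp [coefFun_mon (k := k) (lam := lam) (mu := mu) (i := i) (j := j)
      (by simpa [Nat.lt_succ_iff] using hj), hji]
  · intro h
    exact absurd (Finset.mem_range.2 (by omega)) h

theorem coefAt_locOp_mon (t : ℕ → ℕ → 𝕜) {i l : ℕ} (hi : i ≤ k) (hl : l ≤ k) (a : CircleFun 𝕜)
    (x : ℝ) : coefAt k lam mu l x (locOp k lam mu t (mon k lam mu i a))
      = if l ≤ i then t i (i - l) * ((ddx 𝕜)^[i - l] a).1 x else 0 := by
  rw [locOp_mon t hi, map_sum]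
  simp only [map_smul, smul_eq_mul, coefAt_mon hl]
  split_ifs with h
  · rw [Finset.sum_eq_single (i - l)]
    · rw [if_pos (by omega)]
    · intro j hj hji
      have := Finset.mem_range.1 hj
      rw [if_neg (by omega), mul_zero]
    · intro h'
      exact absurd (Finset.mem_range.2 (by omega)) h'
  · refine Finset.sum_eq_zero fun j hj => ?_
    rw [if_neg (by omega), mul_zero]

theorem exists_eq_locOp (hT : T ∈ SymmAlg k lam mu)
    (h : ∀ l : ℕ, ¬((l : 𝕜) = mu - lam ∧ (l = 0 ∨ (l = 1 ∧ lam = 0)))) :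
    ∃ t, T = locOp k lam mu t := by
  have h' : ∀ l, ∃ u : ℕ → 𝕜, l ≤ k → ∀ i ≤ k, ∀ a x, coefAt k lam mu l x (T (mon k lam mu i a))
      = if l ≤ i then u i * ((ddx 𝕜)^[i - l] a).1 x else 0 := by
    intro l
    by_cases hl : l ≤ k
    · obtain ⟨u, hu⟩ := coefAt_symm_mon_eq hT hl (h l)
      exact ⟨u, fun _ => hu⟩
    · exact ⟨0, fun h => absurd h hl⟩
  choose u hu using h'
  refine ⟨fun i j => u (i - j) i, ext_mon fun i hi a => DiffOp.ext_coefAt fun l hl x => ?_⟩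
  rw [hu l hl i hi, coefAt_locOp_mon _ hi hl]
  split_ifs with hli
  · rw [Nat.sub_sub_self hli]
  · rfl

/-- Only the coefficient of order mu - lam can fail to be local, so the non-local part has rank at
most one, with values in the multiples of d^l₀. -/
theorem exists_eq_locOp_add (hT : T ∈ SymmAlg k lam mu) {l₀ : ℕ} (hl₀ : (l₀ : 𝕜) = mu - lam) :
    ∃ (t : ℕ → ℕ → 𝕜) (c : DiffOp k lam mu →ₗ[𝕜] 𝕜),
      T = locOp k lam mu t + c.smulRight (mon k lam mu l₀ 1) := by
  obtain ⟨u₀, c, hu₀⟩ := coefAt_symm_mon_eq_add hT (l := l₀)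
  have h' : ∀ l, ∃ u : ℕ → 𝕜, l ≤ k → l ≠ l₀ → ∀ i ≤ k, ∀ a x,
      coefAt k lam mu l x (T (mon k lam mu i a))
        = if l ≤ i then u i * ((ddx 𝕜)^[i - l] a).1 x else 0 := by
    intro l
    by_cases hl : l ≤ k ∧ l ≠ l₀
    · obtain ⟨u, hu⟩ := coefAt_symm_mon_eq hT hl.1 fun h => hl.2 (by
        have := h.1.trans hl₀.symm
        exact_mod_cast this)
      exact ⟨u, fun _ _ => hu⟩
    · exact ⟨0, fun h1 h2 => absurd ⟨h1, h2⟩ hl⟩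
  choose u hu using h'
  refine ⟨fun i j => if i - j = l₀ then u₀ i else u (i - j) i, c,
    ext_mon fun i hi a => DiffOp.ext_coefAt fun l hl x => ?_⟩
  rw [LinearMap.add_apply, LinearMap.smulRight_apply, map_add, coefAt_locOp_mon _ hi hl, map_smul,
    coefAt_mon hl]
  by_cases hll : l = l₀
  · subst hll
    rw [hu₀ i hi, if_pos rfl]
    split_ifs with hli h2
    · simp
    · omega
    · simp
  · rw [hu l hl hll i hi, if_neg hll]
    split_ifs with hli h2
    · omega
    · rw [Nat.sub_sub_self hli]
      simp
    · simp

end Form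

end

noncomputable section

open Filter Topology CircleFun CircleDiffeo

variable {𝕜 : Type*} [RCLike 𝕜]

/-! ### Relations imposed on a local symmetry by x ↦ x + τ x^(M+2) -/

section Relation

variable {k : ℕ} {lam mu : 𝕜}

theorem mon_zc_pow_sub_mem {i : ℕ} (hi : i ≤ k) (q r n : ℕ) :
    (mon k lam mu i (zc 𝕜 ^ q)).1 (zc 𝕜 ^ r)
      - (r.descFactorial i : 𝕜) • zc 𝕜 ^ (q + (r - i)) ∈ jet 𝕜 n := by
  have h := (jet 𝕜 n).mul_mem_left (zc 𝕜 ^ q) (ddx_iterate_zc_pow_sub_mem r i n)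
  rw [mul_sub, mul_smul_comm, ← pow_add] at h
  rw [mon_apply hi]
  exact h

theorem mon_mem_jet {i : ℕ} (hi : i ≤ k) (q : ℕ) {n : ℕ} {φ : CircleFun 𝕜} (hφ : φ ∈ jet 𝕜 n) :
    (mon k lam mu i (zc 𝕜 ^ q)).1 φ ∈ jet 𝕜 (q + n - i) := by
  rw [mon_apply hi]
  exact jet_anti (by omega) (jet_mul (zc_pow_mem_jet q) (jet_ddx_iterate i hφ))

theorem apply_eq_sum_coefFun (A : DiffOp k lam mu) (φ : CircleFun 𝕜) :
    A.1 φ = ∑ i ∈ Finset.range (k + 1), coefFun k lam mu i A * (ddx 𝕜)^[i] φ := by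
  ext x
  refine (apply_eq_sum_coefAt A φ x).trans ?_
  rw [sum_val]
  rfl

/-- Triangular inversion: testing on z^m isolates the coefficient of order m, since the terms of
order below m are controlled by induction and those above vanish near 0. -/
theorem coefFun_mem_jet {E : DiffOp k lam mu} {a b : ℕ}
    (h : ∀ r ≤ k, E.1 (zc 𝕜 ^ r) ∈ jet 𝕜 (r + a - b)) {m : ℕ} (hm : m ≤ k) :
    coefFun k lam mu m E ∈ jet 𝕜 (m + a - b) := by
  induction m using Nat.strong_induction_on with
  | _ m ih =>
  have h1 := h m hm
  rw [apply_eq_sum_coefFun, ← Finset.add_sum_erase _ _ (Finset.mem_range.2 (by omega : m < k + 1))]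
    at h1
  have h2 : ∑ j ∈ (Finset.range (k + 1)).erase m, coefFun k lam mu j E * (ddx 𝕜)^[j] (zc 𝕜 ^ m)
      ∈ jet 𝕜 (m + a - b) := by
    refine Ideal.sum_mem _ fun j hj => ?_
    obtain ⟨hjm, hjk⟩ := Finset.mem_erase.1 hj
    rw [Finset.mem_range] at hjk
    rcases lt_or_gt_of_ne hjm with hlt | hgt
    · exact jet_anti (by omega)
        (jet_mul (ih j hlt (by omega)) (jet_ddx_iterate j (zc_pow_mem_jet m)))
    · have := ddx_iterate_zc_pow_sub_mem (𝕜 := 𝕜) m j (m + a - b)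
      rw [Nat.descFactorial_of_lt hgt, Nat.cast_zero, zero_smul, sub_zero] at this
      exact Ideal.mul_mem_left _ _ this
  have h3 := (Ideal.add_mem_iff_left _ h2).1 h1
  have h4 := ddx_iterate_zc_pow_sub_mem (𝕜 := 𝕜) m m (m + a - b)
  rw [Nat.sub_self, pow_zero, Nat.descFactorial_self] at h4
  have h5 := (jet 𝕜 (m + a - b)).sub_mem h3 (Ideal.mul_mem_left _ (coefFun k lam mu m E) h4)
  rw [mul_sub, sub_sub_cancel, mul_smul_comm, mul_one] at h5
  have h6 := jet_smul ((m.factorial : 𝕜)⁻¹) h5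
  rwa [smul_smul, inv_mul_cancel₀ (Nat.cast_ne_zero.2 (Nat.factorial_ne_zero m)), one_smul] at h6

theorem descFactorial_smul_pow_congr {n j a b : ℕ} (h : j ≤ n → a = b) :
    (n.descFactorial j : 𝕜) • zc 𝕜 ^ a = (n.descFactorial j : 𝕜) • zc 𝕜 ^ b := by
  rcases le_or_gt j n with hj | hj
  · rw [h hj]
  · rw [Nat.descFactorial_of_lt hj, Nat.cast_zero, zero_smul, zero_smul]

variable (k lam mu) in
/-- The leading terms at `0` of the image of `x^q d^i/dx^i` under `x ↦ x + τ x^(M+2)`. -/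
def actModel (M i q : ℕ) (τ : 𝕜) (c : ℕ → 𝕜) : DiffOp k lam mu :=
  mon k lam mu i (zc 𝕜 ^ q)
    + τ • ∑ p ∈ Finset.range (M + 2), c p • mon k lam mu (i - p) (zc 𝕜 ^ (q + (M + 1) - p))

theorem actModel_apply_zc_pow {M i q : ℕ} (hi : i ≤ k) (hq : q + (M + 1) ≤ i) (τ : 𝕜) (c : ℕ → 𝕜)
    (r n : ℕ) : (actModel k lam mu M i q τ c).1 (zc 𝕜 ^ r)
      - ((r.descFactorial i : 𝕜) • zc 𝕜 ^ (q + (r - i))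
        + (τ * ∑ p ∈ Finset.range (M + 2), c p * (r.descFactorial (i - p) : 𝕜)) •
          zc 𝕜 ^ (r + q + (M + 1) - i)) ∈ jet 𝕜 n := by
  have h : ∀ p ∈ Finset.range (M + 2), c p • (mon k lam mu (i - p) (zc 𝕜 ^ (q + (M + 1) - p))).1
      (zc 𝕜 ^ r) - (c p * (r.descFactorial (i - p) : 𝕜)) • zc 𝕜 ^ (r + q + (M + 1) - i)
        ∈ jet 𝕜 n := by
    intro p hp
    rw [Finset.mem_range] at hp
    have h1 := jet_smul (c p) (mon_zc_pow_sub_mem (k := k) (lam := lam) (mu := mu)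
      (by omega : i - p ≤ k) (q + (M + 1) - p) r n)
    rw [descFactorial_smul_pow_congr (b := r + q + (M + 1) - i) (by omega), smul_sub,
      smul_smul] at h1
    exact h1
  have h2 := (jet 𝕜 n).add_mem (mon_zc_pow_sub_mem (k := k) (lam := lam) (mu := mu) hi q r n)
    (jet_smul τ (Ideal.sum_mem _ h))
  rw [Finset.sum_sub_distrib, ← Finset.sum_smul] at h2
  have h3 : (actModel k lam mu M i q τ c).1 (zc 𝕜 ^ r) = (mon k lam mu i (zc 𝕜 ^ q)).1 (zc 𝕜 ^ r)
      + τ • ∑ p ∈ Finset.range (M + 2), c p •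
        (mon k lam mu (i - p) (zc 𝕜 ^ (q + (M + 1) - p))).1 (zc 𝕜 ^ r) := by
    simp [actModel, LinearMap.sum_apply]
  rw [h3]
  convert h2 using 1
  rw [smul_sub, smul_smul, add_sub_add_comm]

variable {f : CircleDiffeo} {τ : ℝ} {M : ℕ}

/-- Pulling both operators back by f avoids the inverse of f, so only expansions of f itself are
needed. The hypothesis on c matches the terms of first order in τ: what f does to z^r before
differentiation, minus what it does to the result, must equal the contribution of the correction
terms of the model. -/
theorem diffOpAct_sub_actModel_mem (hf : f.toEquiv =ᶠ[𝓝 0] fun x => x + τ * x ^ (M + 2)) {i q : ℕ}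
    (hi : i ≤ k) (hq : q + (M + 1) ≤ i) {c : ℕ → 𝕜} {r : ℕ}
    (hc : ((r : 𝕜) + lam * (M + 2)) * ((r + (M + 1)).descFactorial i : 𝕜)
      - (r.descFactorial i : 𝕜) * ((q : 𝕜) + r - i + mu * (M + 2))
      = ∑ p ∈ Finset.range (M + 2), c p * (r.descFactorial (i - p) : 𝕜)) :
    (diffOpAct k lam mu f (mon k lam mu i (zc 𝕜 ^ q)) - actModel k lam mu M i q τ c).1 (zc 𝕜 ^ r)
      ∈ jet 𝕜 (r + (q + (M + 2)) - i) := by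
  set e := r + (q + (M + 2)) - i with he
  have hf0 := map_zero_of_expansion hf
  rw [← jet_densityPullback hf0 mu, DiffOp.sub_apply, map_sub, diffOpAct_coe,
    densityPullback_opAct]
  set J := jet 𝕜 e with hJ
  set A := mon k lam mu i (zc 𝕜 ^ q) with hA
  set y : CircleFun 𝕜 := zc 𝕜 ^ (r + q + (M + 1) - i) with hy
  set x : CircleFun 𝕜 := zc 𝕜 ^ (q + (r - i)) with hx
  -- the image of the transformed test function
  have h1 : A.1 (f.densityPullback lam (zc 𝕜 ^ r)) - ((r.descFactorial i : 𝕜) • x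
      + ((((r : 𝕜) + lam * (M + 2)) * τ) * ((r + (M + 1)).descFactorial i : 𝕜)) • y) ∈ J := by
    have e1 : A.1 (f.densityPullback lam (zc 𝕜 ^ r)
        - (zc 𝕜 ^ r + (((r : 𝕜) + lam * (M + 2)) * τ) • zc 𝕜 ^ (r + M + 1))) ∈ J :=
      jet_anti (by omega) (mon_mem_jet hi q (densityPullback_expansion hf lam r))
    have e2 : A.1 (zc 𝕜 ^ r) - (r.descFactorial i : 𝕜) • x ∈ J := mon_zc_pow_sub_mem hi q r e
    have e3 : A.1 (zc 𝕜 ^ (r + M + 1)) - ((r + (M + 1)).descFactorial i : 𝕜) • y ∈ J := by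
      have := mon_zc_pow_sub_mem (k := k) (lam := lam) (mu := mu) hi q (r + (M + 1)) e
      rwa [descFactorial_smul_pow_congr (b := r + q + (M + 1) - i) (by omega)] at this
    have e4 := J.add_mem (J.add_mem e1 e2)
      (jet_smul (((r : 𝕜) + lam * (M + 2)) * τ) e3)
    rw [map_sub, map_add, map_smul] at e4
    convert e4 using 1
    module
  -- the image of the model
  have hP : ∀ φ ∈ J, f.densityPullback mu φ ∈ J := fun φ hφ => (jet_densityPullback hf0 mu).2 hφ
  have h2 : f.densityPullback mu ((actModel k lam mu M i q τ c).1 (zc 𝕜 ^ r))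
      - ((r.descFactorial i : 𝕜) • x + ((r.descFactorial i : 𝕜) *
          (((q : 𝕜) + r - i + mu * (M + 2)) * τ)) • y
        + (τ * ∑ p ∈ Finset.range (M + 2), c p * (r.descFactorial (i - p) : 𝕜)) • y) ∈ J := by
    have e1 := hP _ (actModel_apply_zc_pow (lam := lam) (mu := mu) hi hq (τ : 𝕜) c r e)
    have e2 : (r.descFactorial i : 𝕜) • f.densityPullback mu x - ((r.descFactorial i : 𝕜) • x
        + ((r.descFactorial i : 𝕜) * (((q : 𝕜) + r - i + mu * (M + 2)) * τ)) • y) ∈ J := by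
      rcases le_or_gt i r with hir | hir
      · have := densityPullback_expansion hf mu (q + (r - i))
        have e3 := jet_smul (r.descFactorial i : 𝕜) (jet_anti (by omega : e ≤ _) this)
        rw [show q + (r - i) + M + 1 = r + q + (M + 1) - i by omega] at e3
        push_cast [hir] at e3
        convert e3 using 1
        rw [show (q : 𝕜) + r - i = q + (r - i) by ring]
        module
      · rw [Nat.descFactorial_of_lt hir]
        simp
    have e3 : f.densityPullback mu y - y ∈ J := by
      have := densityPullback_expansion hf mu (r + q + (M + 1) - i)
      have e4 := J.add_mem (jet_anti (by omega : e ≤ _) this)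
        (jet_smul (((r + q + (M + 1) - i : ℕ) + mu * (M + 2)) * τ)
          (jet_anti (by omega : e ≤ _) (zc_pow_mem_jet (𝕜 := 𝕜) (r + q + (M + 1) - i + M + 1))))
      convert e4 using 1
      module
    rw [map_sub, map_add, map_smul, map_smul] at e1
    have e5 := J.add_mem (J.add_mem e1 e2)
      (jet_smul (τ * ∑ p ∈ Finset.range (M + 2), c p * (r.descFactorial (i - p) : 𝕜)) e3)
    convert e5 using 1
    module
  rw [← hc] at h2
  have h3 := J.sub_mem h1 h2
  convert h3 using 1
  module

/-- The relation between the coefficients of an equivariant local map which comes from a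
diffeomorphism `x ↦ x + τ x^(M+2)`. -/
theorem locOp_relation {t : ℕ → ℕ → 𝕜} (ht : locOp k lam mu t ∈ SymmAlg k lam mu) {i q : ℕ}
    (hi : i ≤ k) (hq : q + (M + 1) ≤ i) {c : ℕ → 𝕜}
    (hc : ∀ r : ℕ, ((r : 𝕜) + lam * (M + 2)) * ((r + (M + 1)).descFactorial i : 𝕜)
      - (r.descFactorial i : 𝕜) * ((q : 𝕜) + r - i + mu * (M + 2))
      = ∑ p ∈ Finset.range (M + 2), c p * (r.descFactorial (i - p) : 𝕜)) :
    t i q * (q.factorial * (i - q).factorial) * ((i - q - (M + 1) : ℕ) + lam * (M + 2))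
      = (i - q - (M + 1)).factorial * ∑ p ∈ Finset.range (M + 2),
        c p * t (i - p) (q + (M + 1) - p) * (q + (M + 1) - p).factorial := by
  obtain ⟨ε, hε, hε'⟩ := exists_perturb (coord ^ (M + 2))
  obtain ⟨f, hf⟩ := hε' (ε / 2) (by rw [abs_of_pos (by positivity)]; linarith)
  set τ : ℝ := ε / 2
  have hτ : (τ : 𝕜) ≠ 0 := by
    have : τ ≠ 0 := by positivity
    exact_mod_cast this
  have hf' : f.toEquiv =ᶠ[𝓝 0] fun x => x + τ * x ^ (M + 2) := by
    filter_upwards [coord_eventuallyEq] with x hx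
    rw [hf, pow_val, hx]
  -- At 0 the coefficient of this order sees the first correction only. It vanishes on T(z^q d^i)
  -- itself, and on each correction term of the model it picks one entry of t. On the other side,
  -- the coefficient of order i - q of T A meets the correction z^(l+M+1) of z^l.
  set l := i - q - (M + 1) with hl
  set A := mon k lam mu i (zc 𝕜 ^ q) with hA
  set T := locOp k lam mu t with hT
  -- comparison with the model
  have h1 : coefAt k lam mu l 0 (T (diffOpAct k lam mu f A))
      = coefAt k lam mu l 0 (T (actModel k lam mu M i q τ c)) := by
    rw [← sub_eq_zero, ← map_sub, ← map_sub]
    -- The coefficient of order m of the error is flat to order m + q + M + 2 - i = m - l + 1,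
    -- whereas the coefficient of order l of its image involves only the derivative of order m - l.
    have hE := fun m hm => coefFun_mem_jet (m := m)
      (fun r _ => diffOpAct_sub_actModel_mem hf' hi hq (hc r)) hm
    set E := diffOpAct k lam mu f A - actModel k lam mu M i q τ c
    have hEs : E = ∑ m ∈ Finset.range (k + 1), mon k lam mu m (coefFun k lam mu m E) := by
      rw [← op_eq_sum_mon]
      refine DiffOp.ext_coefAt fun m hm x => ?_
      rw [coefAt_op _ hm]
      rfl
    rw [hEs, map_sum, map_sum]
    refine Finset.sum_eq_zero fun m hm => ?_
    have hm' : m ≤ k := by simpa [Nat.lt_succ_iff] using hm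
    rw [hT, coefAt_locOp_mon _ hm' (by omega)]
    split_ifs with hlm
    · rw [mem_jet.1 (hE m hm') _ (by omega), mul_zero]
    · rfl
  have hz : ∀ m ≤ k, ∀ p, l ≤ m → coefAt k lam mu l 0 (T (mon k lam mu m (zc 𝕜 ^ p)))
      = if m - l = p then t m p * p.factorial else 0 := by
    intro m hm p hlm
    rw [hT, coefAt_locOp_mon _ hm (by omega), if_pos hlm, ddx_iterate_zc_pow_zero]
    split_ifs with h
    · rw [h]
    · rw [mul_zero]
  have h2 : coefAt k lam mu l 0 (T (actModel k lam mu M i q τ c))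
      = τ * ∑ p ∈ Finset.range (M + 2),
        c p * t (i - p) (q + (M + 1) - p) * (q + (M + 1) - p).factorial := by
    rw [actModel, map_add, map_add, hz i hi q (by omega), if_neg (by omega), zero_add, map_smul,
      map_smul, smul_eq_mul, map_sum, map_sum]
    congr 1
    refine Finset.sum_congr rfl fun p hp => ?_
    rw [Finset.mem_range] at hp
    rw [map_smul, map_smul, hz _ (by omega) _ (by omega), if_pos (by omega), smul_eq_mul, mul_assoc]
  -- the other side of the equivariance
  have h3 : (l.factorial : 𝕜) * coefAt k lam mu l 0 (diffOpAct k lam mu f (T A))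
      = t i q * q.factorial * ((i - q).factorial * ((l + lam * (M + 2)) * τ)) := by
    have e1 : ∀ B : DiffOp k lam mu, (B.1 (zc 𝕜 ^ l)).1 0
        = (l.factorial : 𝕜) * coefAt k lam mu l 0 B := by
      intro B
      rw [apply_eq_sum_coefAt, Finset.sum_eq_single l]
      · rw [ddx_iterate_zc_pow_zero, if_pos rfl, mul_comm]
      · intro j _ hj
        rw [ddx_iterate_zc_pow_zero, if_neg hj, mul_zero]
      · intro h
        exact absurd (Finset.mem_range.2 (by omega)) h
    rw [← e1]
    have e2 := f.opAct_apply_map lam mu (T A).1 (zc 𝕜 ^ l) 0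
    rw [derivPow_zero_of_expansion hf', one_mul, map_zero_of_expansion hf'] at e2
    rw [diffOpAct_coe, e2, apply_eq_sum_coefAt, Finset.sum_eq_single (i - q)]
    · rw [hT, hA, coefAt_locOp_mon _ hi (by omega), if_pos (by omega),
        ddx_iterate_zc_pow_zero, if_pos (by omega), show i - (i - q) = q by omega]
      congr 1
      have e3 := mem_jet.1 (densityPullback_expansion hf' lam l) (i - q) (by omega)
      rw [ddx_iterate_sub, sub_val, sub_eq_zero] at e3
      rw [e3, ddx_iterate_add, ddx_iterate_smul, add_val, smul_val, ddx_iterate_zc_pow_zero,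
        ddx_iterate_zc_pow_zero, if_neg (by omega), if_pos (by omega), zero_add,
        show l + M + 1 = i - q by omega]
      ring
    · intro j hj hjq
      rw [hT, hA, coefAt_locOp_mon _ hi (by simpa [Nat.lt_succ_iff] using hj)]
      split_ifs with hji
      · rw [ddx_iterate_zc_pow_zero, if_neg (by omega), mul_zero, zero_mul]
      · rw [zero_mul]
    · intro h
      exact absurd (Finset.mem_range.2 (by omega)) h
  rw [← mem_symmAlg_iff.1 ht, h1, h2] at h3
  refine mul_right_cancel₀ hτ ?_
  linear_combination -h3

end Relation

end

/-! ### The linear system for the entries of a local symmetry -/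

noncomputable section

open Filter Topology CircleFun CircleDiffeo

variable {𝕜 : Type*} [RCLike 𝕜]

/-- The relations between the coefficients of an equivariant local map which come from
diffeomorphisms with trivial first, respectively second, jet at a fixed point. -/
structure LocRel (k : ℕ) (lam dl : 𝕜) (t : ℕ → ℕ → 𝕜) : Prop where
  -- The neighbouring indices are separate variables tied by equations, so that for numerals the
  -- entries of t appear with literal indices.
  quad : ∀ {i j q p : ℕ}, i = j + 1 → p = q + 1 → q ≤ j → i ≤ k →
    ((i : 𝕜) - q) * (i - q - 1 + 2 * lam) * t i q - (2 * (i - dl) - q) * (q + 1) * t i p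
      - i * (i - 1 + 2 * lam) * t j q = 0
  cubic : ∀ {i j m q p r : ℕ}, i = j + 1 → j = m + 1 → p = q + 1 → r = q + 2 → q ≤ m → i ≤ k →
    ((i : 𝕜) - q) * (i - q - 1) * (i - q - 2 + 3 * lam) * t i q
      - (3 * (i - dl) - q) * (q + 2) * (q + 1) * t i r - 3 * i * (i - 1 + 2 * lam) * (q + 1) * t j p
      - i * (i - 1) * (i - 2 + 3 * lam) * t m q = 0

theorem cast_descFactorial_succ (r j : ℕ) :
    (r.descFactorial (j + 1) : 𝕜) = (r - j) * (r.descFactorial j : 𝕜) := by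
  rw [Nat.descFactorial_succ, Nat.cast_mul]
  rcases le_or_gt j r with h | h
  · rw [Nat.cast_sub h]
  · rw [Nat.descFactorial_of_lt h, Nat.cast_zero, mul_zero, mul_zero]

/-- The cases M = 0 and M = 1 of the relation. No others are used; infinitesimally, x² d/dx and x³
d/dx already generate all xⁿ d/dx with n ≥ 2. -/
theorem locRel_of_mem {k : ℕ} {lam mu : 𝕜} {t : ℕ → ℕ → 𝕜}
    (ht : locOp k lam mu t ∈ SymmAlg k lam mu) : LocRel k lam (mu - lam) t where
  quad := by
    rintro i j q p rfl rfl hq hi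
    have h := locOp_relation (M := 0) ht (i := j + 1) (q := q) hi (by omega)
      -- After division by r (r-1) ⋯ (r-j+1) the condition is a polynomial identity in r of degree
      -- one; its value at r = j gives c 1 and its slope gives c 0.
      (c := fun p => if p = 0 then 2 * ((j : 𝕜) + 1 - (mu - lam)) - q
        else ((j : 𝕜) + 1) * (j + 2 * lam)) (fun r => by
        rw [Finset.sum_range_succ, Finset.sum_range_one]
        simp only [if_true, one_ne_zero, if_false, Nat.sub_zero, Nat.add_sub_cancel, zero_add,
          Nat.succ_descFactorial_succ, cast_descFactorial_succ]
        push_cast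
        ring)
    rw [Finset.sum_range_succ, Finset.sum_range_one] at h
    obtain ⟨l, rfl⟩ := Nat.exists_eq_add_of_le hq
    simp only [if_true, one_ne_zero, if_false, Nat.sub_zero, Nat.add_sub_cancel, zero_add,
      show q + l + 1 - q = l + 1 by omega, Nat.factorial_succ] at h
    have hl := Nat.cast_ne_zero (R := 𝕜).2 (Nat.factorial_ne_zero l)
    have hq := Nat.cast_ne_zero (R := 𝕜).2 (Nat.factorial_ne_zero q)
    refine mul_left_cancel₀ (mul_ne_zero hl hq) ?_
    push_cast at h ⊢
    linear_combination h
  cubic := by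
    rintro i j m q p r rfl rfl rfl rfl hq hi
    have h := locOp_relation (M := 1) ht (i := m + 1 + 1) (q := q) hi (by omega)
      (c := fun p => if p = 0 then 3 * ((m : 𝕜) + 2 - (mu - lam)) - q
        else if p = 1 then 3 * ((m : 𝕜) + 2) * (m + 1 + 2 * lam)
        else ((m : 𝕜) + 2) * (m + 1) * (m + 3 * lam)) (fun r => by
        rw [Finset.sum_range_succ, Finset.sum_range_succ, Finset.sum_range_one]
        simp only [if_true, one_ne_zero, if_false, Nat.sub_zero,
          show m + 1 + 1 - 1 = m + 1 by omega, show m + 1 + 1 - 2 = m by omega,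
          show r + (1 + 1) = r + 1 + 1 by omega,
          Nat.succ_descFactorial_succ, Nat.cast_mul, cast_descFactorial_succ]
        push_cast
        ring)
    rw [Finset.sum_range_succ, Finset.sum_range_succ, Finset.sum_range_one] at h
    obtain ⟨l, rfl⟩ := Nat.exists_eq_add_of_le hq
    simp only [if_true, one_ne_zero, if_false, Nat.sub_zero,
      show q + l + 1 + 1 - q = l + 1 + 1 by omega,
      show l + 1 + 1 - (1 + 1) = l by omega, show q + l + 1 + 1 - 1 = q + l + 1 by omega,
      show q + l + 1 + 1 - 2 = q + l by omega, show q + (1 + 1) - 1 = q + 1 by omega,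
      show q + (1 + 1) - 2 = q by omega, show q + (1 + 1) = q + 1 + 1 by omega,
      Nat.factorial_succ] at h
    have hl := Nat.cast_ne_zero (R := 𝕜).2 (Nat.factorial_ne_zero l)
    have hq := Nat.cast_ne_zero (R := 𝕜).2 (Nat.factorial_ne_zero q)
    refine mul_left_cancel₀ (mul_ne_zero hl hq) ?_
    rw [show q + 2 = q + 1 + 1 by omega]
    push_cast at h ⊢
    linear_combination h

/-! ### Propagation of zeros through the levels i -/

section Levels

variable {k : ℕ} {lam dl : 𝕜} {t : ℕ → ℕ → 𝕜}

/-- Once the lower levels and the two preceding entries vanish, the quadratic and the cubic relation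
are both multiples of t i (q+2) alone, with factors linear in dl. Eliminating dl leaves
(q+1)(q+2)(q+3) t i (q+2) = 0. -/
theorem LocRel.eq_zero_of_first (h : LocRel k lam dl t) {i : ℕ} (hi : i ≤ k)
    (hlow : ∀ l < i, ∀ j ≤ l, t l j = 0) (h0 : t i 0 = 0) (h1 : 1 ≤ i → t i 1 = 0) :
    ∀ j ≤ i, t i j = 0 := by
  intro j
  induction j using Nat.strong_induction_on with
  | _ j ih =>
  intro hj
  match j, hj, ih with
  | 0, _, _ => exact h0
  | 1, hj, _ => exact h1 hj
  | q + 2, hj, ih =>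
    have e2 := h.quad (i := i) (j := i - 1) (q := q + 1) (p := q + 2) (by omega) rfl (by omega) hi
    have e3 := h.cubic (i := i) (j := i - 1) (m := i - 2) (q := q) (p := q + 1) (r := q + 2)
      (by omega) (by omega) rfl rfl (by omega) hi
    rw [ih (q + 1) (by omega) (by omega), hlow (i - 1) (by omega) (q + 1) (by omega)] at e2
    rw [ih q (by omega) (by omega), hlow (i - 1) (by omega) (q + 1) (by omega),
      hlow (i - 2) (by omega) q (by omega)] at e3
    push_cast at e2
    have e : ((q : 𝕜) + 1) * (q + 2) * (q + 3) * t i (q + 2) = 0 := by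
      linear_combination 3 * (q + 1) * e2 - 2 * e3
    refine (mul_eq_zero.1 e).resolve_left ?_
    exact_mod_cast (by positivity : (q + 1) * (q + 2) * (q + 3) ≠ 0)

/-- With the lower levels zero, four quadratic and three cubic relations constrain the five entries
t i 0, ..., t i 4. Elimination gives a multiple of each of the first two entries by a factor that
depends on i only. -/
theorem LocRel.first_eq_zero (h : LocRel k lam dl t) {i : ℕ} (h4 : 4 ≤ i) (hi : i ≤ k)
    (hlow : ∀ l < i, ∀ j ≤ l, t l j = 0) : t i 0 = 0 ∧ t i 1 = 0 := by
  have e2 := fun q (hq : q < 4) => h.quad (i := i) (j := i - 1) (q := q) (p := q + 1) (by omega) rfl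
    (by omega) hi
  have e3 := fun q (hq : q < 3) => h.cubic (i := i) (j := i - 1) (m := i - 2) (q := q) (p := q + 1)
    (r := q + 2) (by omega) (by omega) rfl rfl (by omega) hi
  have e20 := e2 0 (by decide)
  have e21 := e2 1 (by decide)
  have e22 := e2 2 (by decide)
  have e23 := e2 3 (by decide)
  have e30 := e3 0 (by decide)
  have e31 := e3 1 (by decide)
  have e32 := e3 2 (by decide)
  rw [hlow (i - 1) (by omega) _ (by omega)] at e20 e21 e22 e23
  rw [hlow (i - 1) (by omega) _ (by omega), hlow (i - 2) (by omega) _ (by omega)] at e30 e31 e32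
  clear e2 e3
  simp only [zero_add, Nat.reduceAdd, Nat.cast_zero, Nat.cast_one, Nat.cast_ofNat]
    at e20 e21 e22 e23 e30 e31 e32
  obtain ⟨m, rfl⟩ := Nat.exists_eq_add_of_le h4
  set n : 𝕜 := ((4 + m : ℕ) : 𝕜) with hn
  -- The relations contain dl only through x = i - dl.
  obtain ⟨x, rfl⟩ : ∃ x, dl = n - x := ⟨n - dl, by ring⟩
  -- Among the levels i ≥ 0 this factor vanishes exactly for i ≤ 3, which is why those levels have
  -- to be treated separately.
  have k0 : n * (n - 1) * (n + 1) * (n - 2) * (n + 2) * (n - 3) ≠ 0 := by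
    have : ((4 + m) * (3 + m) * (5 + m) * (2 + m) * (6 + m) * (1 + m) : ℕ) ≠ 0 := by positivity
    have e := Nat.cast_ne_zero (R := 𝕜).2 this
    push_cast at e hn
    rw [hn]
    convert e using 1
    ring
  have h0 : t (4 + m) 0 = 0 := by
    refine (mul_eq_zero.1 (?_ : n * (n - 1) * (n + 1) * (n - 2) * (n + 2) * (n - 3) *
      t (4 + m) 0 = 0)).resolve_left k0
    linear_combination
      (-144 * x ^ 3 + 264 * x ^ 2 - 72 * x) * e32 + (144 * lam * x ^ 2 * n - 432 * lam * x ^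
      2 - 120 * lam * x * n + 360 * lam * x + 72 * x ^ 2 * n ^ 2 - 360 * x ^ 2 * n + 432 * x
      ^ 2 - 60 * x * n ^ 2 + 276 * x * n - 288 * x) * e31 + (-72 * lam ^ 2 * x * n ^ 2 + 360
      * lam ^ 2 * x * n - 432 * lam ^ 2 * x + 24 * lam ^ 2 * n ^ 2 - 120 * lam ^ 2 * n + 144
      * lam ^ 2 - 72 * lam * x * n ^ 3 + 468 * lam * x * n ^ 2 - 972 * lam * x * n + 648 *
      lam * x + 24 * lam * n ^ 3 - 144 * lam * n ^ 2 + 264 * lam * n - 144 * lam - 18 * x *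
      n ^ 4 + 144 * x * n ^ 3 - 414 * x * n ^ 2 + 504 * x * n - 216 * x + 6 * n ^ 4 - 44 * n
      ^ 3 + 108 * n ^ 2 - 94 * n + 12) * e30 + (648 * x ^ 3 - 648 * x ^ 2 + 144 * x) * e23 +
      (-216 * lam * x ^ 2 * n + 648 * lam * x ^ 2 + 72 * lam * x * n - 216 * lam * x - 108 *
      x ^ 2 * n ^ 2 + 324 * x ^ 2 * n + 36 * x * n ^ 2 - 108 * x * n) * e22 + (-108 * lam *
      x ^ 2 * n ^ 2 + 540 * lam * x ^ 2 * n - 648 * lam * x ^ 2 + 144 * lam * x * n ^ 2 -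
      720 * lam * x * n + 864 * lam * x - 36 * x ^ 2 * n ^ 3 + 324 * x ^ 2 * n ^ 2 - 936 * x
      ^ 2 * n + 864 * x ^ 2 + 48 * x * n ^ 3 - 378 * x * n ^ 2 + 978 * x * n - 828 * x) *
      e21 + (108 * lam ^ 2 * x * n ^ 3 - 648 * lam ^ 2 * x * n ^ 2 + 1188 * lam ^ 2 * x * n
      - 648 * lam ^ 2 * x - 36 * lam ^ 2 * n ^ 3 + 216 * lam ^ 2 * n ^ 2 - 396 * lam ^ 2 * n
      + 216 * lam ^ 2 + 90 * lam * x * n ^ 4 - 720 * lam * x * n ^ 3 + 2070 * lam * x * n ^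
      2 - 2520 * lam * x * n + 1080 * lam * x - 30 * lam * n ^ 4 + 222 * lam * n ^ 3 - 582 *
      lam * n ^ 2 + 642 * lam * n - 252 * lam + 18 * x * n ^ 5 - 180 * x * n ^ 4 + 702 * x *
      n ^ 3 - 1332 * x * n ^ 2 + 1224 * x * n - 432 * x - 6 * n ^ 5 + 57 * n ^ 4 - 198 * n ^
      3 + 303 * n ^ 2 - 192 * n + 36) * e20
  refine ⟨h0, ?_⟩
  rw [h0] at e20 e30
  refine (mul_eq_zero.1 (?_ : n * (n - 1) * (n + 1) * (n - 2) * (n + 2) * (n - 3) *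
      t (4 + m) 1 = 0)).resolve_left k0
  linear_combination (n + 2) * (
    (48 * lam * x ^ 2 - 88 * lam * x + 24 * lam + 24 * x ^ 2 * n - 44 * x * n + 8 * x + 12 * n
    - 12) * e32 + (-24 * lam ^ 2 * x * n + 72 * lam ^ 2 * x + 16 * lam ^ 2 * n - 48 * lam ^ 2
    - 24 * lam * x * n ^ 2 + 114 * lam * x * n - 126 * lam * x + 16 * lam * n ^ 2 - 76 * lam *
    n + 84 * lam - 6 * x * n ^ 3 + 41 * x * n ^ 2 - 75 * x * n + 18 * x + 4 * n ^ 3 - 28 * n ^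
    2 + 58 * n - 30) * e31 + (-10 * lam ^ 2 * n ^ 2 + 50 * lam ^ 2 * n - 60 * lam ^ 2 - 28 / 3
    * lam * n ^ 3 + 187 / 3 * lam * n ^ 2 - 403 / 3 * lam * n + 94 * lam - 13 / 6 * n ^ 4 + 21
    * n ^ 3 - 409 / 6 * n ^ 2 + 248 / 3 * n - 26) * e30 + (-216 * lam * x ^ 2 + 216 * lam * x
    - 48 * lam - 108 * x ^ 2 * n + 108 * x * n - 36 * x - 24 * n + 24) * e23 + (18 * lam * x *
    n - 54 * lam * x - 12 * lam * n + 36 * lam + 3 * x * n ^ 2 + 9 * x * n - 54 * x - 4 * n ^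
    2 + 18 * n - 18) * e22 + (36 * lam ^ 2 * x * n ^ 2 - 180 * lam ^ 2 * x * n + 216 * lam ^ 2
    * x - 24 * lam ^ 2 * n ^ 2 + 120 * lam ^ 2 * n - 144 * lam ^ 2 + 30 * lam * x * n ^ 3 -
    198 * lam * x * n ^ 2 + 420 * lam * x * n - 288 * lam * x - 20 * lam * n ^ 3 + 142 * lam *
    n ^ 2 - 330 * lam * n + 252 * lam + 6 * x * n ^ 4 - 54 * x * n ^ 3 + 156 * x * n ^ 2 - 144
    * x * n - 4 * n ^ 4 + 41 * n ^ 3 - 144 * n ^ 2 + 201 * n - 90) * e21 + (15 * lam ^ 2 * n ^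
    3 - 90 * lam ^ 2 * n ^ 2 + 165 * lam ^ 2 * n - 90 * lam ^ 2 + 27 / 2 * lam * n ^ 4 - 105 *
    lam * n ^ 3 + 585 / 2 * lam * n ^ 2 - 345 * lam * n + 144 * lam + 5 / 2 * n ^ 5 - 57 / 2 *
    n ^ 4 + 235 / 2 * n ^ 3 - 435 / 2 * n ^ 2 + 180 * n - 54) * e20)

theorem LocRel.eq_zero_of_levels (h : LocRel k lam dl t) (h00 : t 0 0 = 0)
    (h10 : t 1 0 = 0) (h11 : t 1 1 = 0) (h20 : t 2 0 = 0) (h21 : t 2 1 = 0) (h30 : t 3 0 = 0)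
    (h31 : t 3 1 = 0) : ∀ i ≤ k, ∀ j ≤ i, t i j = 0 := by
  intro i
  induction i using Nat.strong_induction_on with
  | _ i ih =>
  intro hi
  have hlow : ∀ l < i, ∀ j ≤ l, t l j = 0 := fun l hl => ih l hl (by omega)
  have h01 : t i 0 = 0 ∧ (1 ≤ i → t i 1 = 0) := by
    match i, hlow with
    | 0, _ => exact ⟨h00, fun h => absurd h (by decide)⟩
    | 1, _ => exact ⟨h10, fun _ => h11⟩
    | 2, _ => exact ⟨h20, fun _ => h21⟩
    | 3, _ => exact ⟨h30, fun _ => h31⟩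
    | i + 4, hlow =>
      have := h.first_eq_zero (by omega) hi hlow
      exact ⟨this.1, fun _ => this.2⟩
  exact h.eq_zero_of_first hi hlow h01.1 h01.2

end Levels

/-! ### Elimination in the levels up to 3, case by case -/

section Certificates

variable {k : ℕ} {lam dl : 𝕜} {t : ℕ → ℕ → 𝕜}

/-- With dl = mu - lam the three factors are lam, mu - 1 and lam + mu - 1, whose zeros are the
exceptional lines. The linear combination expresses their product times t 1 0 through the relations
of levels at most 5; using level 5 requires k ≥ 5. -/
theorem LocRel.coeff_one_zero_eq_zero_of_generic (hl : lam ≠ 0) (ha : lam + dl - 1 ≠ 0)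
    (hb : 2 * lam + dl - 1 ≠ 0)
    (h : LocRel k lam dl t) (hk : 5 ≤ k) (h00 : t 0 0 = 0) :
    t 1 0 = 0 := by
  have e2_54 := h.quad (i := 5) (j := 4) (q := 4) (p := 5) rfl rfl (by decide) (by omega)
  have e3_53 := h.cubic (i := 5) (j := 4) (m := 3) (q := 3) (p := 4) (r := 5) rfl rfl rfl rfl
    (by decide) (by omega)
  have e2_53 := h.quad (i := 5) (j := 4) (q := 3) (p := 4) rfl rfl (by decide) (by omega)
  have e3_52 := h.cubic (i := 5) (j := 4) (m := 3) (q := 2) (p := 3) (r := 4) rfl rfl rfl rfl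
    (by decide) (by omega)
  have e2_52 := h.quad (i := 5) (j := 4) (q := 2) (p := 3) rfl rfl (by decide) (by omega)
  have e3_51 := h.cubic (i := 5) (j := 4) (m := 3) (q := 1) (p := 2) (r := 3) rfl rfl rfl rfl
    (by decide) (by omega)
  have e2_51 := h.quad (i := 5) (j := 4) (q := 1) (p := 2) rfl rfl (by decide) (by omega)
  have e3_50 := h.cubic (i := 5) (j := 4) (m := 3) (q := 0) (p := 1) (r := 2) rfl rfl rfl rfl
    (by decide) (by omega)
  have e2_50 := h.quad (i := 5) (j := 4) (q := 0) (p := 1) rfl rfl (by decide) (by omega)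
  have e2_43 := h.quad (i := 4) (j := 3) (q := 3) (p := 4) rfl rfl (by decide) (by omega)
  have e3_42 := h.cubic (i := 4) (j := 3) (m := 2) (q := 2) (p := 3) (r := 4) rfl rfl rfl rfl
    (by decide) (by omega)
  have e2_42 := h.quad (i := 4) (j := 3) (q := 2) (p := 3) rfl rfl (by decide) (by omega)
  have e3_41 := h.cubic (i := 4) (j := 3) (m := 2) (q := 1) (p := 2) (r := 3) rfl rfl rfl rfl
    (by decide) (by omega)
  have e2_41 := h.quad (i := 4) (j := 3) (q := 1) (p := 2) rfl rfl (by decide) (by omega)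
  have e3_40 := h.cubic (i := 4) (j := 3) (m := 2) (q := 0) (p := 1) (r := 2) rfl rfl rfl rfl
    (by decide) (by omega)
  have e2_40 := h.quad (i := 4) (j := 3) (q := 0) (p := 1) rfl rfl (by decide) (by omega)
  have e2_32 := h.quad (i := 3) (j := 2) (q := 2) (p := 3) rfl rfl (by decide) (by omega)
  have e3_31 := h.cubic (i := 3) (j := 2) (m := 1) (q := 1) (p := 2) (r := 3) rfl rfl rfl rfl
    (by decide) (by omega)
  have e2_31 := h.quad (i := 3) (j := 2) (q := 1) (p := 2) rfl rfl (by decide) (by omega)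
  have e3_30 := h.cubic (i := 3) (j := 2) (m := 1) (q := 0) (p := 1) (r := 2) rfl rfl rfl rfl
    (by decide) (by omega)
  have e2_30 := h.quad (i := 3) (j := 2) (q := 0) (p := 1) rfl rfl (by decide) (by omega)
  have e2_21 := h.quad (i := 2) (j := 1) (q := 1) (p := 2) rfl rfl (by decide) (by omega)
  have e3_20 := h.cubic (i := 2) (j := 1) (m := 0) (q := 0) (p := 1) (r := 2) rfl rfl rfl rfl
    (by decide) (by omega)
  have e2_20 := h.quad (i := 2) (j := 1) (q := 0) (p := 1) rfl rfl (by decide) (by omega)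
  have e2_10 := h.quad (i := 1) (j := 0) (q := 0) (p := 1) rfl rfl (by decide) (by omega)
  rw [h00] at e3_20
  rw [h00] at e2_10
  have e : (lam * (lam + dl - 1) * (2 * lam + dl - 1)) * t 1 0 = 0 := by
    linear_combination
      (9 / 8 * dl - 9 / 2) * e2_54 + (-3 / 16 * dl + 9 / 16) * e3_53 + (3 / 10 * lam *
      dl ^ 3 - 139 / 40 * lam * dl ^ 2 + 53 / 4 * lam * dl - 267 / 16 * lam + 3 / 20 *
      dl ^ 4 - 151 / 80 * dl ^ 3 + 669 / 80 * dl ^ 2 - 61 / 4 * dl + 39 / 4) * e2_53 +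
      (-1 / 15 * lam * dl ^ 3 + 43 / 60 * lam * dl ^ 2 - 61 / 24 * lam * dl + 47 / 16 *
      lam - 1 / 30 * dl ^ 4 + 47 / 120 * dl ^ 3 - 391 / 240 * dl ^ 2 + 17 / 6 * dl - 7 /
      4) * e3_52 + (1 / 20 * lam ^ 2 * dl ^ 2 - 49 / 80 * lam ^ 2 * dl + 29 / 16 * lam ^
      2 - 1 / 20 * lam * dl ^ 3 + 53 / 80 * lam * dl ^ 2 - 16 / 5 * lam * dl + 97 / 16 *
      lam + 1 / 10 * dl ^ 3 - 127 / 120 * dl ^ 2 + 823 / 240 * dl - 25 / 8) * e2_52 +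
      (-1 / 12 * lam ^ 2 * dl ^ 2 + 157 / 240 * lam ^ 2 * dl - 21 / 16 * lam ^ 2 - 1 /
      60 * lam * dl ^ 3 + 1 / 48 * lam * dl ^ 2 + 23 / 40 * lam * dl - 13 / 8 * lam - 1
      / 20 * dl ^ 3 + 37 / 80 * dl ^ 2 - 53 / 40 * dl + 9 / 8) * e3_51 + (3 / 10 * lam ^
      2 * dl ^ 2 - 81 / 40 * lam ^ 2 * dl + 51 / 16 * lam ^ 2 + 3 / 20 * lam * dl ^ 3 -
      91 / 80 * lam * dl ^ 2 + 97 / 40 * lam * dl - 3 / 2 * lam + 1 / 20 * dl ^ 3 - 29 /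
      80 * dl ^ 2 + 57 / 80 * dl - 3 / 8) * e2_51 + (-1 / 20 * lam ^ 3 * dl + 29 / 80 *
      lam ^ 3 + 1 / 20 * lam ^ 2 * dl ^ 2 - 29 / 80 * lam ^ 2 * dl + 57 / 40 * lam ^ 2 +
      1 / 20 * lam * dl ^ 2 - 17 / 80 * lam * dl + 41 / 40 * lam - 1 / 10 * dl ^ 2 + 5 /
      8 * dl - 3 / 4) * e3_50 + (3 / 10 * lam ^ 3 * dl - 87 / 40 * lam ^ 3 - 3 / 10 *
      lam ^ 2 * dl ^ 2 + 15 / 8 * lam ^ 2 * dl - 51 / 8 * lam ^ 2 - 3 / 10 * lam * dl -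
      39 / 20 * lam + 3 / 10 * dl ^ 2 - 15 / 8 * dl + 9 / 4) * e2_50 + (3 / 4 * lam * dl
      ^ 3 - 47 / 8 * lam * dl ^ 2 + 129 / 8 * lam * dl - 37 / 2 * lam + 3 / 8 * dl ^ 4 -
      53 / 16 * dl ^ 3 + 11 * dl ^ 2 - 29 / 2 * dl - 2) * e2_43 + (-1 / 6 * lam * dl ^ 3
      + 7 / 6 * lam * dl ^ 2 - 71 / 24 * lam * dl + 139 / 48 * lam - 1 / 12 * dl ^ 4 + 2
      / 3 * dl ^ 3 - 33 / 16 * dl ^ 2 + 59 / 24 * dl - 1 / 24) * e3_42 + (-5 / 4 * lam ^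
      2 * dl ^ 2 + 139 / 16 * lam ^ 2 * dl - 243 / 16 * lam ^ 2 - 5 / 8 * lam * dl ^ 3 +
      39 / 16 * lam * dl ^ 2 + 45 / 8 * lam * dl - 173 / 8 * lam - 5 / 4 * dl ^ 3 + 475
      / 48 * dl ^ 2 - 189 / 8 * dl + 53 / 3) * e2_42 + (1 / 6 * lam ^ 2 * dl ^ 2 - 59 /
      48 * lam ^ 2 * dl + 101 / 48 * lam ^ 2 + 1 / 12 * lam * dl ^ 3 - 3 / 16 * lam * dl
      ^ 2 - 37 / 24 * lam * dl + 91 / 24 * lam + 1 / 4 * dl ^ 3 - 29 / 16 * dl ^ 2 + 33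
      / 8 * dl - 3) * e3_41 + (-1 / 4 * lam ^ 3 * dl + 29 / 16 * lam ^ 3 + 1 / 2 * lam ^
      2 * dl ^ 2 - 55 / 16 * lam ^ 2 * dl + 171 / 16 * lam ^ 2 + 1 / 8 * lam * dl ^ 3 -
      9 / 16 * lam * dl ^ 2 - 5 / 48 * lam * dl + 25 / 3 * lam - 15 / 16 * dl ^ 2 + 65 /
      12 * dl - 73 / 12) * e2_41 + (1 / 4 * lam ^ 3 * dl - 17 / 16 * lam ^ 3 + 43 / 48 *
      lam ^ 2 * dl - 91 / 24 * lam ^ 2 + 5 / 24 * lam * dl ^ 2 - 13 / 48 * lam * dl - 13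
      / 6 * lam + 3 / 8 * dl ^ 2 - 15 / 8 * dl + 2) * e3_40 + (-3 / 4 * lam ^ 3 * dl +
      33 / 16 * lam ^ 3 - 3 / 8 * lam ^ 2 * dl ^ 2 - 9 / 16 * lam ^ 2 * dl + 15 / 4 *
      lam ^ 2 - 9 / 8 * lam * dl ^ 2 + 59 / 16 * lam * dl - 23 / 8 * lam - 1 / 4 * dl ^
      2 + 5 / 8 * dl - 1 / 4) * e2_40 + (-3 / 2 * lam ^ 2 * dl ^ 2 + 63 / 8 * lam ^ 2 *
      dl - 111 / 8 * lam ^ 2 - 19 / 8 * lam * dl ^ 2 + 21 / 2 * lam * dl - 185 / 8 * lam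
      - 3 / 4 * dl ^ 3 + 5 * dl ^ 2 - 199 / 16 * dl + 21 / 16) * e2_32 + (1 / 6 * lam ^
      2 * dl ^ 2 - 9 / 8 * lam ^ 2 * dl + 53 / 24 * lam ^ 2 - 1 / 6 * lam * dl ^ 3 + 25
      / 24 * lam * dl ^ 2 - 31 / 12 * lam * dl + 43 / 12 * lam - 3 / 8 * dl ^ 2 + 23 /
      16 * dl - 7 / 16) * e3_31 + (lam ^ 3 * dl - 11 / 4 * lam ^ 3 - 1 / 2 * lam ^ 2 *
      dl ^ 2 + 19 / 2 * lam ^ 2 * dl - 181 / 8 * lam ^ 2 - 1 / 2 * lam * dl ^ 3 + 43 / 8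
      * lam * dl ^ 2 - 85 / 12 * lam * dl - 103 / 12 * lam - 1 / 2 * dl ^ 3 + 49 / 8 *
      dl ^ 2 - 67 / 4 * dl + 107 / 8) * e2_31 + (-1 / 2 * lam ^ 3 * dl + 9 / 8 * lam ^ 3
      - 1 / 2 * lam ^ 2 * dl ^ 2 + 13 / 24 * lam ^ 2 * dl + 17 / 12 * lam ^ 2 - 5 / 6 *
      lam * dl ^ 2 + 41 / 24 * lam * dl + 17 / 48 * lam - 1 / 2 * dl ^ 2 + 13 / 8 * dl -
      11 / 8) * e3_30 + (3 * lam ^ 3 + 3 / 2 * lam ^ 2 * dl ^ 2 - 15 / 2 * lam ^ 2 * dl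
      + 149 / 8 * lam ^ 2 + 1 / 4 * lam * dl ^ 2 - 1 / 8 * lam * dl + 113 / 16 * lam -
      dl ^ 2 + 47 / 8 * dl - 53 / 8) * e2_30 + (-3 / 2 * lam ^ 3 * dl + 15 / 8 * lam ^ 3
      - 9 / 2 * lam ^ 2 * dl ^ 2 + 135 / 8 * lam ^ 2 * dl - 189 / 8 * lam ^ 2 - 3 / 4 *
      lam * dl ^ 3 + 1 / 8 * lam * dl ^ 2 + 21 / 8 * lam * dl - 143 / 16 * lam - 1 / 2 *
      dl ^ 3 + 13 / 8 * dl ^ 2 - 61 / 16 * dl + 13 / 16) * e2_21 + (1 / 2 * lam ^ 3 * dl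
      - 5 / 8 * lam ^ 3 + lam ^ 2 * dl ^ 2 - 27 / 8 * lam ^ 2 * dl + 17 / 4 * lam ^ 2 +
      3 / 4 * lam * dl ^ 2 - 29 / 24 * lam * dl + 13 / 48 * lam + 1 / 3 * dl ^ 2 - 2 / 3
      * dl + 1 / 3) * e3_20 + (3 / 2 * lam ^ 3 * dl - 33 / 8 * lam ^ 3 + 3 / 4 * lam ^ 2
      * dl ^ 2 + 21 / 8 * lam ^ 2 * dl - 99 / 8 * lam ^ 2 + 3 * lam * dl ^ 2 - 8 * lam *
      dl + 33 / 16 * lam + 3 / 2 * dl ^ 2 - 39 / 8 * dl + 33 / 8) * e2_20 + (-3 / 2 *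
      lam ^ 3 * dl + 15 / 8 * lam ^ 3 - 3 * lam ^ 2 * dl ^ 2 + 81 / 8 * lam ^ 2 * dl -
      47 / 4 * lam ^ 2 - 9 / 4 * lam * dl ^ 2 + 41 / 8 * lam * dl - 37 / 16 * lam - 1 /
      2 * dl ^ 2 + dl - 1 / 2) * e2_10
  exact (mul_eq_zero.1 e).resolve_left (mul_ne_zero (mul_ne_zero hl ha) hb)

/-- After t 1 0, the remaining entries are obstructed at most by lam and mu - 1, no longer by lam +
mu - 1. -/
theorem LocRel.coeff_one_one_eq_zero_of_generic (hl : lam ≠ 0) (ha : lam + dl - 1 ≠ 0)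
    (h : LocRel k lam dl t) (hk : 5 ≤ k) (h00 : t 0 0 = 0) (h10 : t 1 0 = 0) :
    t 1 1 = 0 := by
  have e2_43 := h.quad (i := 4) (j := 3) (q := 3) (p := 4) rfl rfl (by decide) (by omega)
  have e3_42 := h.cubic (i := 4) (j := 3) (m := 2) (q := 2) (p := 3) (r := 4) rfl rfl rfl rfl
    (by decide) (by omega)
  have e2_42 := h.quad (i := 4) (j := 3) (q := 2) (p := 3) rfl rfl (by decide) (by omega)
  have e3_41 := h.cubic (i := 4) (j := 3) (m := 2) (q := 1) (p := 2) (r := 3) rfl rfl rfl rfl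
    (by decide) (by omega)
  have e2_41 := h.quad (i := 4) (j := 3) (q := 1) (p := 2) rfl rfl (by decide) (by omega)
  have e3_40 := h.cubic (i := 4) (j := 3) (m := 2) (q := 0) (p := 1) (r := 2) rfl rfl rfl rfl
    (by decide) (by omega)
  have e2_40 := h.quad (i := 4) (j := 3) (q := 0) (p := 1) rfl rfl (by decide) (by omega)
  have e2_32 := h.quad (i := 3) (j := 2) (q := 2) (p := 3) rfl rfl (by decide) (by omega)
  have e3_31 := h.cubic (i := 3) (j := 2) (m := 1) (q := 1) (p := 2) (r := 3) rfl rfl rfl rfl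
    (by decide) (by omega)
  have e2_31 := h.quad (i := 3) (j := 2) (q := 1) (p := 2) rfl rfl (by decide) (by omega)
  have e3_30 := h.cubic (i := 3) (j := 2) (m := 1) (q := 0) (p := 1) (r := 2) rfl rfl rfl rfl
    (by decide) (by omega)
  have e2_30 := h.quad (i := 3) (j := 2) (q := 0) (p := 1) rfl rfl (by decide) (by omega)
  have e2_21 := h.quad (i := 2) (j := 1) (q := 1) (p := 2) rfl rfl (by decide) (by omega)
  have e3_20 := h.cubic (i := 2) (j := 1) (m := 0) (q := 0) (p := 1) (r := 2) rfl rfl rfl rfl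
    (by decide) (by omega)
  have e2_20 := h.quad (i := 2) (j := 1) (q := 0) (p := 1) rfl rfl (by decide) (by omega)
  have e2_10 := h.quad (i := 1) (j := 0) (q := 0) (p := 1) rfl rfl (by decide) (by omega)
  rw [h10] at e3_30
  rw [h00] at e3_20
  rw [h10] at e2_20
  rw [h10, h00] at e2_10
  have e : (lam * (lam + dl - 1)) * t 1 1 = 0 := by
    linear_combination
      (-1 / 4 * lam * dl ^ 3 + 7 / 3 * lam * dl ^ 2 - 7 * lam * dl + 20 / 3 * lam - 1 /
      8 * dl ^ 4 + 31 / 24 * dl ^ 3 - 14 / 3 * dl ^ 2 + 41 / 6 * dl - 10 / 3) * e2_43 +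
      (1 / 18 * lam * dl ^ 3 - 17 / 36 * lam * dl ^ 2 + 23 / 18 * lam * dl - 10 / 9 *
      lam + 1 / 36 * dl ^ 4 - 19 / 72 * dl ^ 3 + 7 / 8 * dl ^ 2 - 43 / 36 * dl + 5 / 9)
      * e3_42 + (1 / 24 * lam ^ 2 * dl ^ 2 - 1 / 4 * lam ^ 2 * dl + 1 / 3 * lam ^ 2 + 1
      / 12 * lam * dl ^ 3 - 3 / 4 * lam * dl ^ 2 + 13 / 6 * lam * dl - 2 * lam) * e2_42
      + (1 / 72 * lam ^ 2 * dl ^ 2 - 1 / 12 * lam ^ 2 * dl + 1 / 9 * lam ^ 2 - 1 / 72 *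
      lam * dl ^ 3 + 5 / 36 * lam * dl ^ 2 - 4 / 9 * lam * dl + 4 / 9 * lam) * e3_41 +
      (-1 / 12 * lam ^ 2 * dl ^ 2 + 1 / 2 * lam ^ 2 * dl - 2 / 3 * lam ^ 2 - 1 / 24 *
      lam * dl ^ 3 + 1 / 3 * lam * dl ^ 2 - 5 / 6 * lam * dl + 2 / 3 * lam) * e2_41 +
      (-1 / 36 * lam ^ 3 * dl + 1 / 18 * lam ^ 3 - 1 / 18 * lam ^ 2 * dl ^ 2 + 5 / 24 *
      lam ^ 2 * dl - 7 / 36 * lam ^ 2 - 1 / 12 * lam * dl ^ 2 + 3 / 8 * lam * dl - 5 /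
      12 * lam) * e3_40 + (1 / 8 * lam ^ 3 * dl - 1 / 4 * lam ^ 3 + 1 / 4 * lam ^ 2 * dl
      ^ 2 - 25 / 24 * lam ^ 2 * dl + 13 / 12 * lam ^ 2 + 1 / 6 * lam * dl ^ 2 - 3 / 4 *
      lam * dl + 5 / 6 * lam) * e2_40 + (3 / 2 * lam ^ 2 * dl ^ 2 - 49 / 6 * lam ^ 2 *
      dl + 32 / 3 * lam ^ 2 + lam * dl ^ 3 - 5 * lam * dl ^ 2 + 29 / 6 * lam * dl + 8 /
      3 * lam + 11 / 12 * dl ^ 3 - 211 / 36 * dl ^ 2 + 203 / 18 * dl - 19 / 3) * e2_32 +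
      (-7 / 18 * lam ^ 2 * dl ^ 2 + 11 / 6 * lam ^ 2 * dl - 19 / 9 * lam ^ 2 - 5 / 18 *
      lam * dl ^ 3 + 23 / 18 * lam * dl ^ 2 - 25 / 18 * lam * dl - 1 / 9 * lam - 2 / 9 *
      dl ^ 3 + 5 / 4 * dl ^ 2 - 79 / 36 * dl + 7 / 6) * e3_31 + (-1 / 6 * lam ^ 3 * dl +
      1 / 3 * lam ^ 3 - 1 / 3 * lam ^ 2 * dl ^ 2 + 19 / 12 * lam ^ 2 * dl - 2 * lam ^ 2
      - 1 / 3 * lam * dl ^ 2 + 31 / 18 * lam * dl - 13 / 6 * lam) * e2_31 + (-2 / 9 *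
      lam ^ 3 * dl + 5 / 9 * lam ^ 3 - 1 / 9 * lam ^ 2 * dl ^ 2 + 1 / 12 * lam ^ 2 * dl
      + 4 / 9 * lam ^ 2 - 1 / 12 * lam * dl ^ 2 + 1 / 6 * lam * dl + 1 / 18 * lam) *
      e3_30 + (5 / 6 * lam ^ 3 * dl - 2 * lam ^ 3 + 2 / 3 * lam ^ 2 * dl ^ 2 - 2 * lam ^
      2 * dl + 19 / 18 * lam ^ 2 + 5 / 12 * lam * dl ^ 2 - 5 / 3 * lam * dl + 29 / 18 *
      lam) * e2_30 + (-5 / 2 * lam ^ 3 * dl + 6 * lam ^ 3 - 3 / 2 * lam ^ 2 * dl ^ 2 + 1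
      / 2 * lam ^ 2 * dl + 7 * lam ^ 2 + 1 / 4 * lam * dl ^ 3 - 53 / 12 * lam * dl ^ 2 +
      32 / 3 * lam * dl - 13 / 3 * lam + 1 / 6 * dl ^ 3 - 9 / 4 * dl ^ 2 + 71 / 12 * dl
      - 23 / 6) * e2_21 + (5 / 6 * lam ^ 3 * dl - 2 * lam ^ 3 + 2 / 3 * lam ^ 2 * dl ^ 2
      - 3 / 2 * lam ^ 2 * dl - 1 / 6 * lam ^ 2 + 3 / 4 * lam * dl ^ 2 - 85 / 36 * lam *
      dl + 25 / 18 * lam + 7 / 36 * dl ^ 2 - 2 / 3 * dl + 17 / 36) * e3_20 + (-1 / 4 *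
      lam ^ 3 * dl + 1 / 2 * lam ^ 3 - 1 / 2 * lam ^ 2 * dl ^ 2 + 7 / 3 * lam ^ 2 * dl -
      17 / 6 * lam ^ 2 - 1 / 3 * lam * dl ^ 2 + 3 / 2 * lam * dl - 19 / 12 * lam) *
      e2_20 + (-5 / 2 * lam ^ 3 * dl + 6 * lam ^ 3 - 2 * lam ^ 2 * dl ^ 2 + 9 / 2 * lam
      ^ 2 * dl + 2 / 3 * lam ^ 2 - 9 / 4 * lam * dl ^ 2 + 22 / 3 * lam * dl - 14 / 3 *
      lam - 1 / 2 * dl ^ 2 + 19 / 12 * dl - 13 / 12) * e2_10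
  exact (mul_eq_zero.1 e).resolve_left (mul_ne_zero hl ha)

theorem LocRel.coeff_two_zero_eq_zero_of_generic (hl : lam ≠ 0) (ha : lam + dl - 1 ≠ 0)
    (h : LocRel k lam dl t) (hk : 5 ≤ k) (h00 : t 0 0 = 0) (h10 : t 1 0 = 0) (h11 : t 1 1 = 0) :
    t 2 0 = 0 := by
  have e2_21 := h.quad (i := 2) (j := 1) (q := 1) (p := 2) rfl rfl (by decide) (by omega)
  have e3_20 := h.cubic (i := 2) (j := 1) (m := 0) (q := 0) (p := 1) (r := 2) rfl rfl rfl rfl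
    (by decide) (by omega)
  have e2_20 := h.quad (i := 2) (j := 1) (q := 0) (p := 1) rfl rfl (by decide) (by omega)
  rw [h11] at e2_21
  rw [h11, h00] at e3_20
  rw [h10] at e2_20
  have e : (lam * (lam + dl - 1)) * t 2 0 = 0 := by
    linear_combination
      (-1 / 4 * dl + 1 / 2) * e2_21 + (1 / 6 * dl - 1 / 4) * e3_20 + (1 / 4 * lam) *
      e2_20
  exact (mul_eq_zero.1 e).resolve_left (mul_ne_zero hl ha)

theorem LocRel.coeff_two_one_eq_zero_of_generic
    (h : LocRel k lam dl t) (hk : 5 ≤ k) (h00 : t 0 0 = 0) (h10 : t 1 0 = 0) (h11 : t 1 1 = 0)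
    (h20 : t 2 0 = 0) :
    t 2 1 = 0 := by
  have e2_54 := h.quad (i := 5) (j := 4) (q := 4) (p := 5) rfl rfl (by decide) (by omega)
  have e3_53 := h.cubic (i := 5) (j := 4) (m := 3) (q := 3) (p := 4) (r := 5) rfl rfl rfl rfl
    (by decide) (by omega)
  have e2_53 := h.quad (i := 5) (j := 4) (q := 3) (p := 4) rfl rfl (by decide) (by omega)
  have e3_52 := h.cubic (i := 5) (j := 4) (m := 3) (q := 2) (p := 3) (r := 4) rfl rfl rfl rfl
    (by decide) (by omega)
  have e2_52 := h.quad (i := 5) (j := 4) (q := 2) (p := 3) rfl rfl (by decide) (by omega)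
  have e3_51 := h.cubic (i := 5) (j := 4) (m := 3) (q := 1) (p := 2) (r := 3) rfl rfl rfl rfl
    (by decide) (by omega)
  have e2_51 := h.quad (i := 5) (j := 4) (q := 1) (p := 2) rfl rfl (by decide) (by omega)
  have e3_50 := h.cubic (i := 5) (j := 4) (m := 3) (q := 0) (p := 1) (r := 2) rfl rfl rfl rfl
    (by decide) (by omega)
  have e2_50 := h.quad (i := 5) (j := 4) (q := 0) (p := 1) rfl rfl (by decide) (by omega)
  have e2_43 := h.quad (i := 4) (j := 3) (q := 3) (p := 4) rfl rfl (by decide) (by omega)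
  have e3_42 := h.cubic (i := 4) (j := 3) (m := 2) (q := 2) (p := 3) (r := 4) rfl rfl rfl rfl
    (by decide) (by omega)
  have e2_42 := h.quad (i := 4) (j := 3) (q := 2) (p := 3) rfl rfl (by decide) (by omega)
  have e3_41 := h.cubic (i := 4) (j := 3) (m := 2) (q := 1) (p := 2) (r := 3) rfl rfl rfl rfl
    (by decide) (by omega)
  have e2_41 := h.quad (i := 4) (j := 3) (q := 1) (p := 2) rfl rfl (by decide) (by omega)
  have e3_40 := h.cubic (i := 4) (j := 3) (m := 2) (q := 0) (p := 1) (r := 2) rfl rfl rfl rfl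
    (by decide) (by omega)
  have e2_40 := h.quad (i := 4) (j := 3) (q := 0) (p := 1) rfl rfl (by decide) (by omega)
  have e2_32 := h.quad (i := 3) (j := 2) (q := 2) (p := 3) rfl rfl (by decide) (by omega)
  have e3_31 := h.cubic (i := 3) (j := 2) (m := 1) (q := 1) (p := 2) (r := 3) rfl rfl rfl rfl
    (by decide) (by omega)
  have e2_31 := h.quad (i := 3) (j := 2) (q := 1) (p := 2) rfl rfl (by decide) (by omega)
  have e3_30 := h.cubic (i := 3) (j := 2) (m := 1) (q := 0) (p := 1) (r := 2) rfl rfl rfl rfl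
    (by decide) (by omega)
  have e2_30 := h.quad (i := 3) (j := 2) (q := 0) (p := 1) rfl rfl (by decide) (by omega)
  have e2_21 := h.quad (i := 2) (j := 1) (q := 1) (p := 2) rfl rfl (by decide) (by omega)
  have e3_20 := h.cubic (i := 2) (j := 1) (m := 0) (q := 0) (p := 1) (r := 2) rfl rfl rfl rfl
    (by decide) (by omega)
  have e2_20 := h.quad (i := 2) (j := 1) (q := 0) (p := 1) rfl rfl (by decide) (by omega)
  rw [h20] at e3_40
  rw [h11] at e3_31
  rw [h10] at e3_30
  rw [h20] at e2_30
  rw [h11] at e2_21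
  rw [h20, h11, h00] at e3_20
  rw [h20, h10] at e2_20
  linear_combination
    (1 / 6 * dl ^ 2 + 3 / 4 * dl - 17 / 3) * e2_54 + (-1 / 36 * dl ^ 2 - 11 / 72 * dl + 17
    / 24) * e3_53 + (-1 / 4 * lam * dl ^ 2 + 193 / 60 * lam * dl - 227 / 24 * lam - 1 / 8
    * dl ^ 3 + 203 / 120 * dl ^ 2 - 389 / 60 * dl + 13 / 2) * e2_53 + (1 / 18 * lam * dl ^
    2 - 61 / 90 * lam * dl + 13 / 8 * lam + 1 / 36 * dl ^ 3 - 127 / 360 * dl ^ 2 + 221 /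
    180 * dl - 7 / 6) * e3_52 + (13 / 40 * lam ^ 2 * dl - 13 / 8 * lam ^ 2 + 49 / 120 *
    lam * dl ^ 2 - 47 / 15 * lam * dl + 149 / 24 * lam + 17 / 60 * dl ^ 2 - 43 / 24 * dl +
    2) * e2_52 + (-19 / 360 * lam ^ 2 * dl + 1 / 72 * lam ^ 2 - 13 / 120 * lam * dl ^ 2 +
    67 / 90 * lam * dl - 59 / 36 * lam - 29 / 360 * dl ^ 2 + 37 / 90 * dl - 5 / 12) *
    e3_51 + (-1 / 4 * lam ^ 2 * dl + 19 / 8 * lam ^ 2 - 1 / 8 * lam * dl ^ 2 + 43 / 30 *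
    lam * dl - 13 / 6 * lam - 1 / 24 * dl ^ 2 + 21 / 40 * dl - 5 / 6) * e2_51 + (-13 / 40
    * lam ^ 3 - 49 / 120 * lam ^ 2 * dl + 7 / 15 * lam ^ 2 - 367 / 360 * lam * dl + 77 /
    30 * lam - 73 / 180 * dl + 2 / 3) * e3_50 + (39 / 20 * lam ^ 3 + 49 / 20 * lam ^ 2 *
    dl - 19 / 4 * lam ^ 2 + 11 / 3 * lam * dl - 87 / 10 * lam + 73 / 60 * dl - 2) * e2_50
    + (7 / 4 * lam * dl ^ 2 - 83 / 12 * lam * dl - 1 / 3 * lam + 7 / 8 * dl ^ 3 - 47 / 12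
    * dl ^ 2 + 31 / 6 * dl - 14) * e2_43 + (-7 / 18 * lam * dl ^ 2 + 7 / 6 * lam * dl - 13
    / 72 * lam - 7 / 36 * dl ^ 3 + 17 / 24 * dl ^ 2 - 19 / 18 * dl + 67 / 36) * e3_42 +
    (77 / 24 * lam ^ 2 * dl - 379 / 24 * lam ^ 2 + 55 / 24 * lam * dl ^ 2 - 37 / 4 * lam *
    dl - 89 / 12 * lam + 11 / 4 * dl ^ 2 - 397 / 24 * dl + 37 / 2) * e2_42 + (-9 / 8 * lam
    ^ 2 * dl + 253 / 72 * lam ^ 2 - 19 / 24 * lam * dl ^ 2 + 85 / 36 * lam * dl + 23 / 36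
    * lam - 7 / 9 * dl ^ 2 + 271 / 72 * dl - 23 / 6) * e3_41 + (-13 / 8 * lam ^ 3 - 35 /
    24 * lam ^ 2 * dl + 29 / 8 * lam ^ 2 + 7 / 24 * lam * dl ^ 2 - 37 / 8 * lam * dl + 51
    / 4 * lam - 59 / 24 * dl + 7 / 2) * e2_41 + (-25 / 24 * lam ^ 3 - 41 / 72 * lam ^ 2 *
    dl - 23 / 12 * lam ^ 2 - 49 / 72 * lam * dl - 23 / 18 * lam + 1 / 18 * dl - 1 / 12) *
    e3_40 + (57 / 8 * lam ^ 3 + 45 / 8 * lam ^ 2 * dl + 169 / 24 * lam * dl - 45 / 4 * lam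
    + 23 / 12 * dl - 19 / 6) * e2_40 + (-77 / 12 * lam ^ 2 * dl + 89 / 12 * lam ^ 2 - 35 /
    12 * lam * dl ^ 2 - 97 / 12 * lam - 14 / 3 * dl ^ 2 + 265 / 24 * dl - 443 / 24) *
    e2_32 + (49 / 36 * lam ^ 2 * dl - 55 / 36 * lam ^ 2 + 7 / 12 * lam * dl ^ 2 - 5 / 9 *
    lam * dl + 7 / 6 * lam + 35 / 36 * dl ^ 2 - 191 / 72 * dl + 73 / 24) * e3_31 + (-19 /
    2 * lam ^ 3 - 20 / 3 * lam ^ 2 * dl - 75 / 4 * lam ^ 2 + 5 / 12 * lam * dl ^ 2 - 41 /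
    2 * lam * dl + 31 / 3 * lam + 5 / 12 * dl ^ 2 - 167 / 12 * dl + 19) * e2_31 + (15 / 4
    * lam ^ 3 + 97 / 36 * lam ^ 2 * dl + 13 / 6 * lam ^ 2 + 197 / 36 * lam * dl - 355 / 72
    * lam + 47 / 18 * dl - 11 / 3) * e3_30 + (-5 * lam ^ 3 - 14 / 3 * lam ^ 2 * dl + 125 /
    12 * lam ^ 2 - 97 / 12 * lam * dl + 421 / 24 * lam - 17 / 6 * dl + 4) * e2_30 + (21 /
    4 * lam ^ 3 - 1 / 4 * lam ^ 2 - 155 / 24 * lam - 85 / 24) * e2_21 + (-7 / 4 * lam ^ 3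
    - 7 / 4 * lam ^ 2 * dl + 25 / 12 * lam ^ 2 - 7 / 6 * lam * dl ^ 2 + 19 / 9 * lam * dl
    - 97 / 72 * lam - 7 / 9 * dl ^ 2 + 22 / 9 * dl - 133 / 72) * e3_20 + (-16 * lam ^ 3 -
    13 * lam ^ 2 * dl - 5 * lam ^ 2 - 21 * lam * dl + 283 / 12 * lam - 97 / 12 * dl + 43 /
    4) * e2_20

theorem LocRel.coeff_three_zero_eq_zero_of_generic (hl : lam ≠ 0) (ha : lam + dl - 1 ≠ 0)
    (h : LocRel k lam dl t) (hk : 5 ≤ k) (h00 : t 0 0 = 0) (h10 : t 1 0 = 0) (h11 : t 1 1 = 0)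
    (h20 : t 2 0 = 0) (h21 : t 2 1 = 0) :
    t 3 0 = 0 := by
  have e2_53 := h.quad (i := 5) (j := 4) (q := 3) (p := 4) rfl rfl (by decide) (by omega)
  have e3_52 := h.cubic (i := 5) (j := 4) (m := 3) (q := 2) (p := 3) (r := 4) rfl rfl rfl rfl
    (by decide) (by omega)
  have e2_52 := h.quad (i := 5) (j := 4) (q := 2) (p := 3) rfl rfl (by decide) (by omega)
  have e3_51 := h.cubic (i := 5) (j := 4) (m := 3) (q := 1) (p := 2) (r := 3) rfl rfl rfl rfl
    (by decide) (by omega)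
  have e2_51 := h.quad (i := 5) (j := 4) (q := 1) (p := 2) rfl rfl (by decide) (by omega)
  have e3_50 := h.cubic (i := 5) (j := 4) (m := 3) (q := 0) (p := 1) (r := 2) rfl rfl rfl rfl
    (by decide) (by omega)
  have e2_50 := h.quad (i := 5) (j := 4) (q := 0) (p := 1) rfl rfl (by decide) (by omega)
  have e2_42 := h.quad (i := 4) (j := 3) (q := 2) (p := 3) rfl rfl (by decide) (by omega)
  have e3_41 := h.cubic (i := 4) (j := 3) (m := 2) (q := 1) (p := 2) (r := 3) rfl rfl rfl rfl
    (by decide) (by omega)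
  have e2_41 := h.quad (i := 4) (j := 3) (q := 1) (p := 2) rfl rfl (by decide) (by omega)
  have e3_40 := h.cubic (i := 4) (j := 3) (m := 2) (q := 0) (p := 1) (r := 2) rfl rfl rfl rfl
    (by decide) (by omega)
  have e2_40 := h.quad (i := 4) (j := 3) (q := 0) (p := 1) rfl rfl (by decide) (by omega)
  have e2_32 := h.quad (i := 3) (j := 2) (q := 2) (p := 3) rfl rfl (by decide) (by omega)
  have e3_31 := h.cubic (i := 3) (j := 2) (m := 1) (q := 1) (p := 2) (r := 3) rfl rfl rfl rfl
    (by decide) (by omega)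
  have e2_31 := h.quad (i := 3) (j := 2) (q := 1) (p := 2) rfl rfl (by decide) (by omega)
  have e3_30 := h.cubic (i := 3) (j := 2) (m := 1) (q := 0) (p := 1) (r := 2) rfl rfl rfl rfl
    (by decide) (by omega)
  have e2_30 := h.quad (i := 3) (j := 2) (q := 0) (p := 1) rfl rfl (by decide) (by omega)
  have e2_21 := h.quad (i := 2) (j := 1) (q := 1) (p := 2) rfl rfl (by decide) (by omega)
  have e3_20 := h.cubic (i := 2) (j := 1) (m := 0) (q := 0) (p := 1) (r := 2) rfl rfl rfl rfl
    (by decide) (by omega)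
  rw [h21] at e3_41
  rw [h20] at e3_40
  rw [h11] at e3_31
  rw [h21] at e2_31
  rw [h21, h10] at e3_30
  rw [h20] at e2_30
  rw [h21, h11] at e2_21
  rw [h20, h11, h00] at e3_20
  have e : (lam * (lam + dl - 1)) * t 3 0 = 0 := by
    linear_combination
      (18 / 35 * lam ^ 2 * dl - 78 / 35 * lam ^ 2 + 72 / 35 * lam * dl - 312 / 35 * lam
      - 9 / 70 * dl ^ 4 + 51 / 35 * dl ^ 3 - 177 / 35 * dl ^ 2 + 198 / 35 * dl - 39 /
      14) * e2_53 + (-4 / 35 * lam ^ 2 * dl + 2 / 5 * lam ^ 2 - 16 / 35 * lam * dl + 8 /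
      5 * lam + 1 / 35 * dl ^ 4 - 3 / 10 * dl ^ 3 + 67 / 70 * dl ^ 2 - 73 / 70 * dl + 1
      / 2) * e3_52 + (18 / 35 * lam ^ 3 * dl - 18 / 7 * lam ^ 3 + 4 / 7 * lam ^ 2 * dl ^
      2 - 283 / 105 * lam ^ 2 * dl - 67 / 105 * lam ^ 2 - 1 / 35 * lam * dl ^ 3 + 188 /
      105 * lam * dl ^ 2 - 761 / 70 * lam * dl + 2879 / 210 * lam - 11 / 70 * dl ^ 3 +
      923 / 420 * dl ^ 2 - 1871 / 210 * dl + 263 / 28) * e2_52 + (-6 / 35 * lam ^ 3 * dl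
      + 22 / 35 * lam ^ 3 - 4 / 21 * lam ^ 2 * dl ^ 2 + 27 / 35 * lam ^ 2 * dl - 31 /
      105 * lam ^ 2 + 4 / 105 * lam * dl ^ 3 - 82 / 105 * lam * dl ^ 2 + 733 / 210 * lam
      * dl - 179 / 42 * lam + 1 / 15 * dl ^ 3 - 111 / 140 * dl ^ 2 + 58 / 21 * dl - 11 /
      4) * e3_51 + (36 / 35 * lam ^ 3 + 4 / 7 * lam ^ 2 * dl + 59 / 35 * lam ^ 2 - 9 /
      70 * lam * dl ^ 3 + 29 / 35 * lam * dl ^ 2 + 2 / 7 * lam * dl - 31 / 14 * lam - 3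
      / 70 * dl ^ 3 + 31 / 140 * dl ^ 2 + 5 / 14 * dl - 31 / 28) * e2_51 + (-18 / 35 *
      lam ^ 4 - 4 / 7 * lam ^ 3 * dl - 107 / 105 * lam ^ 3 + 1 / 35 * lam ^ 2 * dl ^ 2 -
      13 / 5 * lam ^ 2 * dl + 37 / 14 * lam ^ 2 + 31 / 210 * lam * dl ^ 2 - 1607 / 420 *
      lam * dl + 2759 / 420 * lam + 19 / 105 * dl ^ 2 - 383 / 210 * dl + 37 / 14) *
      e3_50 + (108 / 35 * lam ^ 4 + 24 / 7 * lam ^ 3 * dl + 106 / 35 * lam ^ 3 - 6 / 35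
      * lam ^ 2 * dl ^ 2 + 426 / 35 * lam ^ 2 * dl - 79 / 5 * lam ^ 2 - 5 / 7 * lam * dl
      ^ 2 + 199 / 14 * lam * dl - 1657 / 70 * lam - 19 / 35 * dl ^ 2 + 383 / 70 * dl -
      111 / 14) * e2_50 + (9 / 7 * lam ^ 3 * dl - 6 * lam ^ 3 + 54 / 7 * lam ^ 2 * dl -
      36 * lam ^ 2 - 9 / 14 * lam * dl ^ 3 + 21 / 2 * lam * dl ^ 2 - 256 / 7 * lam * dl
      + 125 / 14 * lam + 3 / 7 * dl ^ 3 + 17 / 14 * dl ^ 2 - 247 / 14 * dl + 115 / 7) *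
      e2_42 + (-3 / 7 * lam ^ 3 * dl + 10 / 7 * lam ^ 3 - 18 / 7 * lam ^ 2 * dl + 60 / 7
      * lam ^ 2 + 2 / 7 * lam * dl ^ 3 - 53 / 14 * lam * dl ^ 2 + 151 / 14 * lam * dl -
      61 / 14 * lam - 19 / 14 * dl ^ 2 + 85 / 14 * dl - 5) * e3_41 + (-18 / 7 * lam ^ 4
      - 20 / 7 * lam ^ 3 * dl - 107 / 21 * lam ^ 3 + 1 / 7 * lam ^ 2 * dl ^ 2 - 293 / 21
      * lam ^ 2 * dl + 671 / 42 * lam ^ 2 + 3 / 14 * lam * dl ^ 2 - 465 / 28 * lam * dl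
      + 2329 / 84 * lam + 19 / 14 * dl ^ 2 - 262 / 21 * dl + 235 / 14) * e2_41 + (20 /
      21 * lam ^ 3 * dl - 74 / 21 * lam ^ 3 + 2 / 3 * lam ^ 2 * dl ^ 2 - 10 / 7 * lam ^
      2 * dl - 163 / 42 * lam ^ 2 + 6 / 7 * lam * dl ^ 2 - 271 / 84 * lam * dl + 13 / 84
      * lam - 5 / 21 * dl ^ 2 + 67 / 42 * dl - 5 / 2) * e3_40 + (27 / 7 * lam ^ 4 + 151
      / 7 * lam ^ 3 - 45 / 14 * lam ^ 2 * dl ^ 2 + 383 / 14 * lam ^ 2 * dl - 33 / 2 *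
      lam ^ 2 - 33 / 14 * lam * dl ^ 2 + 727 / 28 * lam * dl - 935 / 28 * lam - 3 / 7 *
      dl ^ 2 + 83 / 14 * dl - 115 / 14) * e2_40 + (-44 / 7 * lam ^ 2 * dl + 352 / 21 *
      lam ^ 2 - 50 / 7 * lam * dl ^ 2 + 586 / 21 * lam * dl - 496 / 21 * lam - 23 / 21 *
      dl ^ 3 + 191 / 126 * dl ^ 2 + 151 / 18 * dl - 260 / 21) * e2_32 + (44 / 21 * lam ^
      2 * dl - 88 / 21 * lam ^ 2 + 50 / 21 * lam * dl ^ 2 - 54 / 7 * lam * dl + 124 / 21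
      * lam + 23 / 63 * dl ^ 3 - 11 / 42 * dl ^ 2 - 313 / 126 * dl + 65 / 21) * e3_31 +
      (-36 / 7 * lam ^ 4 - 730 / 21 * lam ^ 3 + 30 / 7 * lam ^ 2 * dl ^ 2 - 242 / 7 *
      lam ^ 2 * dl - 494 / 21 * lam ^ 2 + 3 / 7 * lam * dl ^ 3 + 103 / 21 * lam * dl ^ 2
      - 4331 / 63 * lam * dl + 1088 / 21 * lam + 3 / 7 * dl ^ 3 - 17 / 14 * dl ^ 2 - 663
      / 28 * dl + 795 / 28) * e2_31 + (12 / 7 * lam ^ 4 + 710 / 63 * lam ^ 3 - 10 / 7 *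
      lam ^ 2 * dl ^ 2 + 12 * lam ^ 2 * dl + 8 / 7 * lam ^ 2 - 52 / 21 * lam * dl ^ 2 +
      923 / 42 * lam * dl - 1238 / 63 * lam - 13 / 21 * dl ^ 2 + 160 / 21 * dl - 235 /
      28) * e3_30 + (-36 / 7 * lam ^ 4 - 40 / 7 * lam ^ 3 * dl - 194 / 21 * lam ^ 3 + 2
      / 7 * lam ^ 2 * dl ^ 2 - 536 / 21 * lam ^ 2 * dl + 2011 / 63 * lam ^ 2 + 16 / 21 *
      lam * dl ^ 2 - 82 / 3 * lam * dl + 2561 / 63 * lam + 11 / 7 * dl ^ 2 - 14 * dl +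
      515 / 28) * e2_30 + (88 / 7 * lam ^ 3 + 164 / 7 * lam ^ 2 + 335 / 21 * lam + 107 /
      21) * e2_21 + (-44 / 21 * lam ^ 3 + 50 / 7 * lam ^ 2 * dl - 94 / 7 * lam ^ 2 + 23
      / 21 * lam * dl ^ 2 + 167 / 18 * lam * dl - 713 / 42 * lam + 23 / 21 * dl ^ 2 +
      269 / 126 * dl - 79 / 14) * e3_20
  exact (mul_eq_zero.1 e).resolve_left (mul_ne_zero hl ha)

theorem LocRel.coeff_three_one_eq_zero_of_generic
    (h : LocRel k lam dl t) (hk : 5 ≤ k) (h00 : t 0 0 = 0) (h10 : t 1 0 = 0) (h11 : t 1 1 = 0)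
    (h20 : t 2 0 = 0) (h21 : t 2 1 = 0) (h30 : t 3 0 = 0) :
    t 3 1 = 0 := by
  have e2_53 := h.quad (i := 5) (j := 4) (q := 3) (p := 4) rfl rfl (by decide) (by omega)
  have e3_52 := h.cubic (i := 5) (j := 4) (m := 3) (q := 2) (p := 3) (r := 4) rfl rfl rfl rfl
    (by decide) (by omega)
  have e2_52 := h.quad (i := 5) (j := 4) (q := 2) (p := 3) rfl rfl (by decide) (by omega)
  have e3_51 := h.cubic (i := 5) (j := 4) (m := 3) (q := 1) (p := 2) (r := 3) rfl rfl rfl rfl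
    (by decide) (by omega)
  have e2_51 := h.quad (i := 5) (j := 4) (q := 1) (p := 2) rfl rfl (by decide) (by omega)
  have e3_50 := h.cubic (i := 5) (j := 4) (m := 3) (q := 0) (p := 1) (r := 2) rfl rfl rfl rfl
    (by decide) (by omega)
  have e2_50 := h.quad (i := 5) (j := 4) (q := 0) (p := 1) rfl rfl (by decide) (by omega)
  have e2_42 := h.quad (i := 4) (j := 3) (q := 2) (p := 3) rfl rfl (by decide) (by omega)
  have e3_41 := h.cubic (i := 4) (j := 3) (m := 2) (q := 1) (p := 2) (r := 3) rfl rfl rfl rfl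
    (by decide) (by omega)
  have e2_41 := h.quad (i := 4) (j := 3) (q := 1) (p := 2) rfl rfl (by decide) (by omega)
  have e3_40 := h.cubic (i := 4) (j := 3) (m := 2) (q := 0) (p := 1) (r := 2) rfl rfl rfl rfl
    (by decide) (by omega)
  have e2_40 := h.quad (i := 4) (j := 3) (q := 0) (p := 1) rfl rfl (by decide) (by omega)
  have e2_32 := h.quad (i := 3) (j := 2) (q := 2) (p := 3) rfl rfl (by decide) (by omega)
  have e3_31 := h.cubic (i := 3) (j := 2) (m := 1) (q := 1) (p := 2) (r := 3) rfl rfl rfl rfl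
    (by decide) (by omega)
  have e2_31 := h.quad (i := 3) (j := 2) (q := 1) (p := 2) rfl rfl (by decide) (by omega)
  have e3_30 := h.cubic (i := 3) (j := 2) (m := 1) (q := 0) (p := 1) (r := 2) rfl rfl rfl rfl
    (by decide) (by omega)
  have e2_30 := h.quad (i := 3) (j := 2) (q := 0) (p := 1) rfl rfl (by decide) (by omega)
  have e2_21 := h.quad (i := 2) (j := 1) (q := 1) (p := 2) rfl rfl (by decide) (by omega)
  have e3_20 := h.cubic (i := 2) (j := 1) (m := 0) (q := 0) (p := 1) (r := 2) rfl rfl rfl rfl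
    (by decide) (by omega)
  rw [h30] at e3_50
  rw [h21] at e3_41
  rw [h20] at e3_40
  rw [h30] at e2_40
  rw [h11] at e3_31
  rw [h21] at e2_31
  rw [h30, h21, h10] at e3_30
  rw [h30, h20] at e2_30
  rw [h21, h11] at e2_21
  rw [h20, h11, h00] at e3_20
  linear_combination
    (3 / 70 * lam * dl ^ 2 - 2 / 5 * lam * dl + 13 / 14 * lam + 3 / 140 * dl ^ 3 - 31 /
    140 * dl ^ 2 + 93 / 140 * dl - 13 / 28) * e2_53 + (-1 / 105 * lam * dl ^ 2 + 17 / 210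
    * lam * dl - 1 / 6 * lam - 1 / 210 * dl ^ 3 + 19 / 420 * dl ^ 2 - 13 / 105 * dl + 1 /
    12) * e3_52 + (-1 / 70 * lam ^ 2 * dl + 1 / 14 * lam ^ 2 - 1 / 35 * lam * dl ^ 2 + 17
    / 70 * lam * dl - 1 / 2 * lam - 1 / 140 * dl ^ 2 + 47 / 840 * dl - 17 / 168) * e2_52 +
    (-1 / 210 * lam ^ 2 * dl + 1 / 42 * lam ^ 2 + 1 / 210 * lam * dl ^ 2 - 11 / 210 * lam
    * dl + 1 / 7 * lam - 1 / 280 * dl + 1 / 56) * e3_51 + (3 / 70 * lam ^ 2 * dl - 3 / 14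
    * lam ^ 2 + 3 / 140 * lam * dl ^ 2 - 19 / 140 * lam * dl + 1 / 7 * lam + 1 / 140 * dl
    ^ 2 - 13 / 280 * dl + 3 / 56) * e2_51 + (1 / 70 * lam ^ 3 + 1 / 35 * lam ^ 2 * dl - 2
    / 35 * lam ^ 2 + 9 / 140 * lam * dl - 53 / 280 * lam + 1 / 70 * dl - 1 / 28) * e3_50 +
    (-3 / 35 * lam ^ 3 - 6 / 35 * lam ^ 2 * dl + 3 / 7 * lam ^ 2 - 3 / 14 * lam * dl + 87
    / 140 * lam - 3 / 70 * dl + 3 / 28) * e2_50 + (-3 / 14 * lam ^ 2 * dl + 13 / 14 * lam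
    ^ 2 - 3 / 28 * lam * dl ^ 2 + 1 / 7 * lam * dl + 39 / 28 * lam - 3 / 14 * dl ^ 2 + 8 /
    7 * dl - 13 / 14) * e2_42 + (1 / 21 * lam ^ 2 * dl - 1 / 6 * lam ^ 2 + 1 / 42 * lam *
    dl ^ 2 - 1 / 84 * lam * dl - 1 / 4 * lam + 1 / 21 * dl ^ 2 - 3 / 14 * dl + 1 / 6) *
    e3_41 + (1 / 14 * lam ^ 3 + 1 / 7 * lam ^ 2 * dl - 5 / 14 * lam ^ 2 + 9 / 28 * lam *
    dl - 185 / 168 * lam + 1 / 14 * dl - 17 / 84) * e2_41 + (1 / 42 * lam ^ 3 - 1 / 42 *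
    lam ^ 2 * dl + 4 / 21 * lam ^ 2 - 1 / 21 * lam * dl + 17 / 56 * lam + 1 / 28) * e3_40
    + (-3 / 14 * lam ^ 3 - 3 / 28 * lam ^ 2 * dl - 2 / 7 * lam ^ 2 - 1 / 4 * lam * dl + 19
    / 56 * lam - 1 / 14 * dl + 3 / 28) * e2_40 + (6 / 7 * lam ^ 2 * dl - 16 / 7 * lam ^ 2
    + 12 / 7 * lam * dl - 32 / 7 * lam + 25 / 14 * dl - 100 / 21) * e2_32 + (-2 / 7 * lam
    ^ 2 * dl + 4 / 7 * lam ^ 2 - 4 / 7 * lam * dl + 8 / 7 * lam - 25 / 42 * dl + 25 / 21)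
    * e3_31 + (2 / 7 * lam ^ 3 + 12 / 7 * lam ^ 2 + 107 / 42 * lam + 10 / 7) * e2_31 + (-8
    / 21 * lam ^ 3 - 1 / 21 * lam ^ 2 * dl - 17 / 21 * lam ^ 2 - 1 / 21 * lam * dl ^ 2 + 8
    / 21 * lam * dl - 205 / 126 * lam - 1 / 21 * dl ^ 2 + 19 / 42 * dl - 47 / 42) * e3_30
    + (lam ^ 3 + 1 / 7 * lam ^ 2 * dl + 11 / 7 * lam ^ 2 + 1 / 7 * lam * dl + 53 / 28 *
    lam + 9 / 28) * e2_30 + (-12 / 7 * lam ^ 3 - 36 / 7 * lam ^ 2 - 7 * lam - 25 / 7) *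
    e2_21 + (2 / 7 * lam ^ 3 + 6 / 7 * lam ^ 2 + 7 / 6 * lam + 25 / 42) * e3_20

theorem LocRel.eq_zero_of_generic (hl : lam ≠ 0) (ha : lam + dl - 1 ≠ 0)
    (hb : 2 * lam + dl - 1 ≠ 0)
    (h : LocRel k lam dl t) (hk : 5 ≤ k) (h00 : t 0 0 = 0) :
    ∀ i ≤ k, ∀ j ≤ i, t i j = 0 := by
  have h10 := LocRel.coeff_one_zero_eq_zero_of_generic hl ha hb h hk h00
  have h11 := LocRel.coeff_one_one_eq_zero_of_generic hl ha h hk h00 h10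
  have h20 := LocRel.coeff_two_zero_eq_zero_of_generic hl ha h hk h00 h10 h11
  have h21 := LocRel.coeff_two_one_eq_zero_of_generic h hk h00 h10 h11 h20
  have h30 := LocRel.coeff_three_zero_eq_zero_of_generic hl ha h hk h00 h10 h11 h20 h21
  have h31 := LocRel.coeff_three_one_eq_zero_of_generic h hk h00 h10 h11 h20 h21 h30
  exact h.eq_zero_of_levels h00 h10 h11 h20 h21 h30 h31

/-- The value dl = 1 - 2 lam means lam + mu = 1. Here t 1 0 is a second free entry, accounted for by
the formal adjoint; once it is zero, the rest vanishes for lam ≠ 0. -/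
theorem LocRel.coeff_one_one_eq_zero_of_adjoint (hl : lam ≠ 0)
    (h : LocRel k lam (1 - 2 * lam) t) (hk : 5 ≤ k) (h00 : t 0 0 = 0) (h10 : t 1 0 = 0) :
    t 1 1 = 0 := by
  have e2_10 := h.quad (i := 1) (j := 0) (q := 0) (p := 1) rfl rfl (by decide) (by omega)
  rw [h10, h00] at e2_10
  have e : lam * t 1 1 = 0 := by
    linear_combination
      (-1 / 4) * e2_10
  exact (mul_eq_zero.1 e).resolve_left hl

theorem LocRel.coeff_two_zero_eq_zero_of_adjoint (hl : lam ≠ 0)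
    (h : LocRel k lam (1 - 2 * lam) t) (hk : 5 ≤ k) (h00 : t 0 0 = 0) (h10 : t 1 0 = 0)
    (h11 : t 1 1 = 0) :
    t 2 0 = 0 := by
  have e2_43 := h.quad (i := 4) (j := 3) (q := 3) (p := 4) rfl rfl (by decide) (by omega)
  have e3_42 := h.cubic (i := 4) (j := 3) (m := 2) (q := 2) (p := 3) (r := 4) rfl rfl rfl rfl
    (by decide) (by omega)
  have e2_42 := h.quad (i := 4) (j := 3) (q := 2) (p := 3) rfl rfl (by decide) (by omega)
  have e3_41 := h.cubic (i := 4) (j := 3) (m := 2) (q := 1) (p := 2) (r := 3) rfl rfl rfl rfl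
    (by decide) (by omega)
  have e2_41 := h.quad (i := 4) (j := 3) (q := 1) (p := 2) rfl rfl (by decide) (by omega)
  have e3_40 := h.cubic (i := 4) (j := 3) (m := 2) (q := 0) (p := 1) (r := 2) rfl rfl rfl rfl
    (by decide) (by omega)
  have e2_40 := h.quad (i := 4) (j := 3) (q := 0) (p := 1) rfl rfl (by decide) (by omega)
  have e2_32 := h.quad (i := 3) (j := 2) (q := 2) (p := 3) rfl rfl (by decide) (by omega)
  have e3_31 := h.cubic (i := 3) (j := 2) (m := 1) (q := 1) (p := 2) (r := 3) rfl rfl rfl rfl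
    (by decide) (by omega)
  have e2_31 := h.quad (i := 3) (j := 2) (q := 1) (p := 2) rfl rfl (by decide) (by omega)
  have e3_30 := h.cubic (i := 3) (j := 2) (m := 1) (q := 0) (p := 1) (r := 2) rfl rfl rfl rfl
    (by decide) (by omega)
  have e2_30 := h.quad (i := 3) (j := 2) (q := 0) (p := 1) rfl rfl (by decide) (by omega)
  have e2_21 := h.quad (i := 2) (j := 1) (q := 1) (p := 2) rfl rfl (by decide) (by omega)
  have e3_20 := h.cubic (i := 2) (j := 1) (m := 0) (q := 0) (p := 1) (r := 2) rfl rfl rfl rfl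
    (by decide) (by omega)
  have e2_20 := h.quad (i := 2) (j := 1) (q := 0) (p := 1) rfl rfl (by decide) (by omega)
  rw [h11] at e3_31
  rw [h10] at e3_30
  rw [h11] at e2_21
  rw [h11, h00] at e3_20
  rw [h10] at e2_20
  have e : lam * t 2 0 = 0 := by
    linear_combination
      (-18 * lam ^ 3 - 45 * lam ^ 2 - 31 * lam - 7 / 2) * e2_43 + (4 * lam ^ 3 + 25 / 3
      * lam ^ 2 + 14 / 3 * lam + 1 / 2) * e3_42 + (-7 / 4 * lam - 2) * e2_42 + (-lam ^ 3
      - 7 / 6 * lam ^ 2 + 5 / 12 * lam + 1 / 2) * e3_41 + (3 * lam ^ 3 + 7 / 2 * lam ^ 2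
      + 7 / 4 * lam + 1 / 2) * e2_41 + (-2 / 3 * lam ^ 2 - 4 / 3 * lam - 1 / 2) * e3_40
      + (3 * lam ^ 2 + 7 / 2 * lam + 1) * e2_40 + (12 * lam + 13) * e2_32 + (-4 * lam ^
      3 - 28 / 3 * lam ^ 2 - 26 / 3 * lam - 3) * e3_31 + (-6 * lam ^ 2 - 27 / 2 * lam -
      8) * e2_31 + (4 * lam ^ 3 + 32 / 3 * lam ^ 2 + 59 / 6 * lam + 3) * e3_30 + (-12 *
      lam ^ 3 - 20 * lam ^ 2 - 19 / 2 * lam - 1) * e2_30 + (18 * lam ^ 3 + 57 * lam ^ 2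
      + 133 / 2 * lam + 53 / 2) * e2_21 + (-12 * lam ^ 3 - 28 * lam ^ 2 - 45 / 2 * lam -
      35 / 6) * e3_20 + (-12 * lam ^ 2 - 41 / 2 * lam - 9) * e2_20
  exact (mul_eq_zero.1 e).resolve_left hl

theorem LocRel.coeff_two_one_eq_zero_of_adjoint
    (h : LocRel k lam (1 - 2 * lam) t) (hk : 5 ≤ k) (h10 : t 1 0 = 0) (h20 : t 2 0 = 0) :
    t 2 1 = 0 := by
  have e2_42 := h.quad (i := 4) (j := 3) (q := 2) (p := 3) rfl rfl (by decide) (by omega)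
  have e3_41 := h.cubic (i := 4) (j := 3) (m := 2) (q := 1) (p := 2) (r := 3) rfl rfl rfl rfl
    (by decide) (by omega)
  have e2_41 := h.quad (i := 4) (j := 3) (q := 1) (p := 2) rfl rfl (by decide) (by omega)
  have e3_40 := h.cubic (i := 4) (j := 3) (m := 2) (q := 0) (p := 1) (r := 2) rfl rfl rfl rfl
    (by decide) (by omega)
  have e2_40 := h.quad (i := 4) (j := 3) (q := 0) (p := 1) rfl rfl (by decide) (by omega)
  have e2_31 := h.quad (i := 3) (j := 2) (q := 1) (p := 2) rfl rfl (by decide) (by omega)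
  have e3_30 := h.cubic (i := 3) (j := 2) (m := 1) (q := 0) (p := 1) (r := 2) rfl rfl rfl rfl
    (by decide) (by omega)
  have e2_30 := h.quad (i := 3) (j := 2) (q := 0) (p := 1) rfl rfl (by decide) (by omega)
  have e2_20 := h.quad (i := 2) (j := 1) (q := 0) (p := 1) rfl rfl (by decide) (by omega)
  rw [h20] at e3_40
  rw [h10] at e3_30
  rw [h20] at e2_30
  rw [h20, h10] at e2_20
  linear_combination
    (-lam ^ 2 - 17 / 6 * lam - 2) * e2_42 + (1 / 3 * lam ^ 2 + 5 / 6 * lam + 1 / 2) *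
    e3_41 + (1 / 3 * lam + 1 / 2) * e2_41 + (-1 / 3 * lam ^ 2 - 5 / 6 * lam - 1 / 2) *
    e3_40 + (3 / 2 * lam ^ 2 + 5 / 2 * lam + 1) * e2_40 + (-2 * lam ^ 2 - 17 / 3 * lam -
    4) * e2_31 + (2 / 3 * lam ^ 2 + 5 / 3 * lam + 1) * e3_30 + (2 / 3 * lam + 1) * e2_30 +
    (-3 * lam ^ 2 - 7 * lam - 7 / 2) * e2_20

theorem LocRel.coeff_three_zero_eq_zero_of_adjoint (hl : lam ≠ 0)
    (h : LocRel k lam (1 - 2 * lam) t) (hk : 5 ≤ k) (h00 : t 0 0 = 0) (h10 : t 1 0 = 0)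
    (h11 : t 1 1 = 0) (h20 : t 2 0 = 0) (h21 : t 2 1 = 0) :
    t 3 0 = 0 := by
  have e2_53 := h.quad (i := 5) (j := 4) (q := 3) (p := 4) rfl rfl (by decide) (by omega)
  have e3_52 := h.cubic (i := 5) (j := 4) (m := 3) (q := 2) (p := 3) (r := 4) rfl rfl rfl rfl
    (by decide) (by omega)
  have e2_52 := h.quad (i := 5) (j := 4) (q := 2) (p := 3) rfl rfl (by decide) (by omega)
  have e3_51 := h.cubic (i := 5) (j := 4) (m := 3) (q := 1) (p := 2) (r := 3) rfl rfl rfl rfl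
    (by decide) (by omega)
  have e2_51 := h.quad (i := 5) (j := 4) (q := 1) (p := 2) rfl rfl (by decide) (by omega)
  have e3_50 := h.cubic (i := 5) (j := 4) (m := 3) (q := 0) (p := 1) (r := 2) rfl rfl rfl rfl
    (by decide) (by omega)
  have e2_50 := h.quad (i := 5) (j := 4) (q := 0) (p := 1) rfl rfl (by decide) (by omega)
  have e2_42 := h.quad (i := 4) (j := 3) (q := 2) (p := 3) rfl rfl (by decide) (by omega)
  have e3_41 := h.cubic (i := 4) (j := 3) (m := 2) (q := 1) (p := 2) (r := 3) rfl rfl rfl rfl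
    (by decide) (by omega)
  have e2_41 := h.quad (i := 4) (j := 3) (q := 1) (p := 2) rfl rfl (by decide) (by omega)
  have e3_40 := h.cubic (i := 4) (j := 3) (m := 2) (q := 0) (p := 1) (r := 2) rfl rfl rfl rfl
    (by decide) (by omega)
  have e2_40 := h.quad (i := 4) (j := 3) (q := 0) (p := 1) rfl rfl (by decide) (by omega)
  have e2_32 := h.quad (i := 3) (j := 2) (q := 2) (p := 3) rfl rfl (by decide) (by omega)
  have e3_31 := h.cubic (i := 3) (j := 2) (m := 1) (q := 1) (p := 2) (r := 3) rfl rfl rfl rfl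
    (by decide) (by omega)
  have e2_31 := h.quad (i := 3) (j := 2) (q := 1) (p := 2) rfl rfl (by decide) (by omega)
  have e3_30 := h.cubic (i := 3) (j := 2) (m := 1) (q := 0) (p := 1) (r := 2) rfl rfl rfl rfl
    (by decide) (by omega)
  have e2_30 := h.quad (i := 3) (j := 2) (q := 0) (p := 1) rfl rfl (by decide) (by omega)
  have e2_21 := h.quad (i := 2) (j := 1) (q := 1) (p := 2) rfl rfl (by decide) (by omega)
  have e3_20 := h.cubic (i := 2) (j := 1) (m := 0) (q := 0) (p := 1) (r := 2) rfl rfl rfl rfl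
    (by decide) (by omega)
  rw [h21] at e3_41
  rw [h20] at e3_40
  rw [h11] at e3_31
  rw [h21] at e2_31
  rw [h21, h10] at e3_30
  rw [h20] at e2_30
  rw [h21, h11] at e2_21
  rw [h20, h11, h00] at e3_20
  have e : lam * t 3 0 = 0 := by
    linear_combination
      (18 / 35 * lam ^ 3 + 66 / 35 * lam ^ 2 + 69 / 35 * lam + 3 / 7) * e2_53 + (-4 / 35
      * lam ^ 3 - 13 / 35 * lam ^ 2 - 12 / 35 * lam - 1 / 14) * e3_52 + (13 / 105 * lam
      + 43 / 210) * e2_52 + (2 / 35 * lam ^ 3 + 2 / 15 * lam ^ 2 + 4 / 105 * lam - 3 /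
      70) * e3_51 + (-9 / 35 * lam ^ 3 - 39 / 70 * lam ^ 2 - 2 / 5 * lam - 4 / 35) *
      e2_51 + (2 / 35 * lam ^ 2 + 23 / 140 * lam + 1 / 10) * e3_50 + (-12 / 35 * lam ^ 2
      - 9 / 14 * lam - 3 / 10) * e2_50 + (-19 / 28 * lam - 15 / 14) * e2_42 + (1 / 7 *
      lam ^ 3 + 1 / 2 * lam ^ 2 + 19 / 28 * lam + 5 / 14) * e3_41 + (3 / 7 * lam ^ 2 +
      55 / 42 * lam + 22 / 21) * e2_41 + (-2 / 7 * lam ^ 3 - 23 / 21 * lam ^ 2 - 121 /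
      84 * lam - 9 / 14) * e3_40 + (9 / 7 * lam ^ 3 + 24 / 7 * lam ^ 2 + 83 / 28 * lam +
      11 / 14) * e2_40 + (2 / 7 * lam + 5 / 21) * e2_32 + (-2 / 21 * lam - 1 / 21) *
      e3_31 + (-6 / 7 * lam ^ 3 - 27 / 7 * lam ^ 2 - 87 / 14 * lam - 76 / 21) * e2_31 +
      (4 / 7 * lam ^ 3 + 2 * lam ^ 2 + 17 / 7 * lam + 23 / 21) * e3_30 + (8 / 7 * lam ^
      2 + 109 / 42 * lam + 31 / 21) * e2_30 + (1 / 7) * e2_21 + (1 / 7 * lam) * e3_20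
  exact (mul_eq_zero.1 e).resolve_left hl

theorem LocRel.coeff_three_one_eq_zero_of_adjoint
    (h : LocRel k lam (1 - 2 * lam) t) (hk : 5 ≤ k) (h00 : t 0 0 = 0) (h10 : t 1 0 = 0)
    (h11 : t 1 1 = 0) (h20 : t 2 0 = 0) (h21 : t 2 1 = 0) (h30 : t 3 0 = 0) :
    t 3 1 = 0 := by
  have e2_32 := h.quad (i := 3) (j := 2) (q := 2) (p := 3) rfl rfl (by decide) (by omega)
  have e3_31 := h.cubic (i := 3) (j := 2) (m := 1) (q := 1) (p := 2) (r := 3) rfl rfl rfl rfl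
    (by decide) (by omega)
  have e2_31 := h.quad (i := 3) (j := 2) (q := 1) (p := 2) rfl rfl (by decide) (by omega)
  have e3_30 := h.cubic (i := 3) (j := 2) (m := 1) (q := 0) (p := 1) (r := 2) rfl rfl rfl rfl
    (by decide) (by omega)
  have e2_30 := h.quad (i := 3) (j := 2) (q := 0) (p := 1) rfl rfl (by decide) (by omega)
  have e2_21 := h.quad (i := 2) (j := 1) (q := 1) (p := 2) rfl rfl (by decide) (by omega)
  have e3_20 := h.cubic (i := 2) (j := 1) (m := 0) (q := 0) (p := 1) (r := 2) rfl rfl rfl rfl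
    (by decide) (by omega)
  rw [h11] at e3_31
  rw [h21] at e2_31
  rw [h30, h21, h10] at e3_30
  rw [h30, h20] at e2_30
  rw [h21, h11] at e2_21
  rw [h20, h11, h00] at e3_20
  linear_combination
    (-3 / 2 * lam - 5 / 4) * e2_32 + (1 / 2 * lam + 1 / 4) * e3_31 + (1 / 4) * e2_31 + (-1
    / 4 * lam - 1 / 8) * e3_30 + (3 / 4 * lam - 1 / 8) * e2_30 + (-3 / 4) * e2_21 + (-3 /
    4 * lam) * e3_20

theorem LocRel.eq_zero_of_adjoint (hl : lam ≠ 0)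
    (h : LocRel k lam (1 - 2 * lam) t) (hk : 5 ≤ k) (h00 : t 0 0 = 0) (h10 : t 1 0 = 0) :
    ∀ i ≤ k, ∀ j ≤ i, t i j = 0 := by
  have h11 := LocRel.coeff_one_one_eq_zero_of_adjoint hl h hk h00 h10
  have h20 := LocRel.coeff_two_zero_eq_zero_of_adjoint hl h hk h00 h10 h11
  have h21 := LocRel.coeff_two_one_eq_zero_of_adjoint h hk h10 h20
  have h30 := LocRel.coeff_three_zero_eq_zero_of_adjoint hl h hk h00 h10 h11 h20 h21
  have h31 := LocRel.coeff_three_one_eq_zero_of_adjoint h hk h00 h10 h11 h20 h21 h30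
  exact h.eq_zero_of_levels h00 h10 h11 h20 h21 h30 h31

/-- For lam = 0 the second free entry t 1 0 is accounted for by the projection A ↦ A(1). The
remaining obstructions are dl = mu and mu - 1. -/
theorem LocRel.coeff_one_one_eq_zero_of_lam_zero (hd1 : dl ≠ 1)
    (h : LocRel k 0 dl t) (hk : 5 ≤ k) (h00 : t 0 0 = 0) (h10 : t 1 0 = 0) :
    t 1 1 = 0 := by
  have e2_10 := h.quad (i := 1) (j := 0) (q := 0) (p := 1) rfl rfl (by decide) (by omega)
  rw [h10, h00] at e2_10
  have e : (dl - 1) * t 1 1 = 0 := by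
    linear_combination
      (1 / 2) * e2_10
  exact (mul_eq_zero.1 e).resolve_left (sub_ne_zero.2 hd1)

theorem LocRel.coeff_two_zero_eq_zero_of_lam_zero (hd : dl ≠ 0) (hd1 : dl ≠ 1)
    (h : LocRel k 0 dl t) (hk : 5 ≤ k) (h10 : t 1 0 = 0) :
    t 2 0 = 0 := by
  have e2_53 := h.quad (i := 5) (j := 4) (q := 3) (p := 4) rfl rfl (by decide) (by omega)
  have e3_52 := h.cubic (i := 5) (j := 4) (m := 3) (q := 2) (p := 3) (r := 4) rfl rfl rfl rfl
    (by decide) (by omega)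
  have e2_52 := h.quad (i := 5) (j := 4) (q := 2) (p := 3) rfl rfl (by decide) (by omega)
  have e3_51 := h.cubic (i := 5) (j := 4) (m := 3) (q := 1) (p := 2) (r := 3) rfl rfl rfl rfl
    (by decide) (by omega)
  have e2_51 := h.quad (i := 5) (j := 4) (q := 1) (p := 2) rfl rfl (by decide) (by omega)
  have e3_50 := h.cubic (i := 5) (j := 4) (m := 3) (q := 0) (p := 1) (r := 2) rfl rfl rfl rfl
    (by decide) (by omega)
  have e2_50 := h.quad (i := 5) (j := 4) (q := 0) (p := 1) rfl rfl (by decide) (by omega)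
  have e2_42 := h.quad (i := 4) (j := 3) (q := 2) (p := 3) rfl rfl (by decide) (by omega)
  have e3_41 := h.cubic (i := 4) (j := 3) (m := 2) (q := 1) (p := 2) (r := 3) rfl rfl rfl rfl
    (by decide) (by omega)
  have e2_41 := h.quad (i := 4) (j := 3) (q := 1) (p := 2) rfl rfl (by decide) (by omega)
  have e3_40 := h.cubic (i := 4) (j := 3) (m := 2) (q := 0) (p := 1) (r := 2) rfl rfl rfl rfl
    (by decide) (by omega)
  have e2_40 := h.quad (i := 4) (j := 3) (q := 0) (p := 1) rfl rfl (by decide) (by omega)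
  have e2_31 := h.quad (i := 3) (j := 2) (q := 1) (p := 2) rfl rfl (by decide) (by omega)
  have e3_30 := h.cubic (i := 3) (j := 2) (m := 1) (q := 0) (p := 1) (r := 2) rfl rfl rfl rfl
    (by decide) (by omega)
  have e2_30 := h.quad (i := 3) (j := 2) (q := 0) (p := 1) rfl rfl (by decide) (by omega)
  have e2_20 := h.quad (i := 2) (j := 1) (q := 0) (p := 1) rfl rfl (by decide) (by omega)
  rw [h10] at e3_30
  rw [h10] at e2_20
  have e : (dl * (dl - 1)) * t 2 0 = 0 := by
    linear_combination
      (-9 / 4 * dl + 39 / 4) * e2_53 + (1 / 2 * dl - 7 / 4) * e3_52 + (1 / 4 * dl ^ 3 -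
      85 / 24 * dl ^ 2 + 89 / 6 * dl - 137 / 8) * e2_52 + (-1 / 12 * dl ^ 3 + 9 / 8 * dl
      ^ 2 - 53 / 12 * dl + 41 / 8) * e3_51 + (1 / 8 * dl ^ 2 - 5 / 4 * dl + 13 / 8) *
      e2_51 + (-1 / 3 * dl ^ 2 + 37 / 12 * dl - 19 / 4) * e3_50 + (dl ^ 2 - 37 / 4 * dl
      + 57 / 4) * e2_50 + (3 / 2 * dl ^ 3 - 131 / 8 * dl ^ 2 + 385 / 8 * dl - 19) *
      e2_42 + (-1 / 2 * dl ^ 3 + 41 / 8 * dl ^ 2 - 109 / 8 * dl + 7) * e3_41 + (-17 / 8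
      * dl ^ 2 + 481 / 24 * dl - 123 / 4) * e2_41 + (1 / 12 * dl ^ 2 - 11 / 6 * dl + 5)
      * e3_40 + (3 / 2 * dl ^ 2 - 47 / 4 * dl + 55 / 4) * e2_40 + (-31 / 4 * dl ^ 2 +
      453 / 8 * dl - 333 / 8) * e2_31 + (13 / 6 * dl ^ 2 - 185 / 12 * dl + 109 / 8) *
      e3_30 + (-5 / 2 * dl ^ 2 + 91 / 4 * dl - 269 / 8) * e2_30 + (-6 * dl ^ 2 + 183 / 4
      * dl - 327 / 8) * e2_20
  exact (mul_eq_zero.1 e).resolve_left (mul_ne_zero hd (sub_ne_zero.2 hd1))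

theorem LocRel.coeff_two_one_eq_zero_of_lam_zero
    (h : LocRel k 0 dl t) (hk : 5 ≤ k) (h10 : t 1 0 = 0) (h20 : t 2 0 = 0) :
    t 2 1 = 0 := by
  have e2_42 := h.quad (i := 4) (j := 3) (q := 2) (p := 3) rfl rfl (by decide) (by omega)
  have e3_41 := h.cubic (i := 4) (j := 3) (m := 2) (q := 1) (p := 2) (r := 3) rfl rfl rfl rfl
    (by decide) (by omega)
  have e2_41 := h.quad (i := 4) (j := 3) (q := 1) (p := 2) rfl rfl (by decide) (by omega)
  have e3_40 := h.cubic (i := 4) (j := 3) (m := 2) (q := 0) (p := 1) (r := 2) rfl rfl rfl rfl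
    (by decide) (by omega)
  have e2_40 := h.quad (i := 4) (j := 3) (q := 0) (p := 1) rfl rfl (by decide) (by omega)
  have e2_31 := h.quad (i := 3) (j := 2) (q := 1) (p := 2) rfl rfl (by decide) (by omega)
  have e3_30 := h.cubic (i := 3) (j := 2) (m := 1) (q := 0) (p := 1) (r := 2) rfl rfl rfl rfl
    (by decide) (by omega)
  have e2_30 := h.quad (i := 3) (j := 2) (q := 0) (p := 1) rfl rfl (by decide) (by omega)
  have e2_20 := h.quad (i := 2) (j := 1) (q := 0) (p := 1) rfl rfl (by decide) (by omega)
  rw [h20] at e3_40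
  rw [h10] at e3_30
  rw [h20] at e2_30
  rw [h20, h10] at e2_20
  linear_combination
    (-1 / 6 * dl ^ 3 + 107 / 72 * dl ^ 2 - 97 / 24 * dl + 55 / 18) * e2_42 + (1 / 18 * dl
    ^ 3 - 11 / 24 * dl ^ 2 + 83 / 72 * dl - 5 / 6) * e3_41 + (-1 / 24 * dl ^ 2 + 17 / 72 *
    dl - 5 / 18) * e2_41 + (1 / 12 * dl ^ 2 - 5 / 12 * dl + 5 / 12) * e3_40 + (-1 / 6 * dl
    ^ 2 + 5 / 6 * dl - 5 / 6) * e2_40 + (dl ^ 2 - 59 / 12 * dl + 55 / 12) * e2_31 + (-1 /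
    3 * dl ^ 2 + 17 / 12 * dl - 5 / 4) * e3_30 + (1 / 4 * dl - 5 / 12) * e2_30 + (2 / 3 *
    dl ^ 2 - 25 / 6 * dl + 7 / 2) * e2_20

theorem LocRel.coeff_three_zero_eq_zero_of_lam_zero (hd1 : dl ≠ 1)
    (h : LocRel k 0 dl t) (hk : 5 ≤ k) (h10 : t 1 0 = 0) (h20 : t 2 0 = 0) (h21 : t 2 1 = 0) :
    t 3 0 = 0 := by
  have e2_31 := h.quad (i := 3) (j := 2) (q := 1) (p := 2) rfl rfl (by decide) (by omega)
  have e3_30 := h.cubic (i := 3) (j := 2) (m := 1) (q := 0) (p := 1) (r := 2) rfl rfl rfl rfl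
    (by decide) (by omega)
  have e2_30 := h.quad (i := 3) (j := 2) (q := 0) (p := 1) rfl rfl (by decide) (by omega)
  rw [h21] at e2_31
  rw [h21, h10] at e3_30
  rw [h20] at e2_30
  have e : (dl - 1) * t 3 0 = 0 := by
    linear_combination
      (-1 / 4 * dl + 3 / 4) * e2_31 + (1 / 6 * dl - 5 / 12) * e3_30 + (1 / 4) * e2_30
  exact (mul_eq_zero.1 e).resolve_left (sub_ne_zero.2 hd1)

theorem LocRel.coeff_three_one_eq_zero_of_lam_zero
    (h : LocRel k 0 dl t) (hk : 5 ≤ k) (h10 : t 1 0 = 0) (h20 : t 2 0 = 0) (h21 : t 2 1 = 0)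
    (h30 : t 3 0 = 0) :
    t 3 1 = 0 := by
  have e2_53 := h.quad (i := 5) (j := 4) (q := 3) (p := 4) rfl rfl (by decide) (by omega)
  have e3_52 := h.cubic (i := 5) (j := 4) (m := 3) (q := 2) (p := 3) (r := 4) rfl rfl rfl rfl
    (by decide) (by omega)
  have e2_52 := h.quad (i := 5) (j := 4) (q := 2) (p := 3) rfl rfl (by decide) (by omega)
  have e3_51 := h.cubic (i := 5) (j := 4) (m := 3) (q := 1) (p := 2) (r := 3) rfl rfl rfl rfl
    (by decide) (by omega)
  have e2_51 := h.quad (i := 5) (j := 4) (q := 1) (p := 2) rfl rfl (by decide) (by omega)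
  have e3_50 := h.cubic (i := 5) (j := 4) (m := 3) (q := 0) (p := 1) (r := 2) rfl rfl rfl rfl
    (by decide) (by omega)
  have e2_50 := h.quad (i := 5) (j := 4) (q := 0) (p := 1) rfl rfl (by decide) (by omega)
  have e2_42 := h.quad (i := 4) (j := 3) (q := 2) (p := 3) rfl rfl (by decide) (by omega)
  have e3_41 := h.cubic (i := 4) (j := 3) (m := 2) (q := 1) (p := 2) (r := 3) rfl rfl rfl rfl
    (by decide) (by omega)
  have e2_41 := h.quad (i := 4) (j := 3) (q := 1) (p := 2) rfl rfl (by decide) (by omega)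
  have e3_40 := h.cubic (i := 4) (j := 3) (m := 2) (q := 0) (p := 1) (r := 2) rfl rfl rfl rfl
    (by decide) (by omega)
  have e2_40 := h.quad (i := 4) (j := 3) (q := 0) (p := 1) rfl rfl (by decide) (by omega)
  have e2_31 := h.quad (i := 3) (j := 2) (q := 1) (p := 2) rfl rfl (by decide) (by omega)
  have e3_30 := h.cubic (i := 3) (j := 2) (m := 1) (q := 0) (p := 1) (r := 2) rfl rfl rfl rfl
    (by decide) (by omega)
  have e2_30 := h.quad (i := 3) (j := 2) (q := 0) (p := 1) rfl rfl (by decide) (by omega)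
  rw [h30] at e3_50
  rw [h21] at e3_41
  rw [h20] at e3_40
  rw [h30] at e2_40
  rw [h21] at e2_31
  rw [h30, h21, h10] at e3_30
  rw [h30, h20] at e2_30
  linear_combination
    (-3 / 20 * dl + 13 / 20) * e2_53 + (1 / 30 * dl - 7 / 60) * e3_52 + (-1 / 20 * dl ^ 2
    + 43 / 120 * dl - 67 / 120) * e2_52 + (1 / 60 * dl ^ 2 - 13 / 120 * dl + 7 / 40) *
    e3_51 + (-1 / 40 * dl + 1 / 40) * e2_51 + (1 / 15 * dl - 3 / 20) * e3_50 + (-1 / 5 *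
    dl + 9 / 20) * e2_50 + (-1 / 5 * dl ^ 2 + 47 / 60 * dl + 17 / 30) * e2_42 + (1 / 15 *
    dl ^ 2 - 13 / 60 * dl - 1 / 30) * e3_41 + (9 / 20 * dl - 21 / 20) * e2_41 + (-1 / 15 *
    dl + 1 / 4) * e3_40 + (-1 / 5 * dl + 1 / 4) * e2_40 + (16 / 5) * e2_31 + (2 / 5 * dl -
    49 / 30) * e3_30 + (1 / 2 * dl - 1 / 4) * e2_30

theorem LocRel.eq_zero_of_lam_zero (hd : dl ≠ 0) (hd1 : dl ≠ 1)
    (h : LocRel k 0 dl t) (hk : 5 ≤ k) (h00 : t 0 0 = 0) (h10 : t 1 0 = 0) :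
    ∀ i ≤ k, ∀ j ≤ i, t i j = 0 := by
  have h11 := LocRel.coeff_one_one_eq_zero_of_lam_zero hd1 h hk h00 h10
  have h20 := LocRel.coeff_two_zero_eq_zero_of_lam_zero hd hd1 h hk h10
  have h21 := LocRel.coeff_two_one_eq_zero_of_lam_zero h hk h10 h20
  have h30 := LocRel.coeff_three_zero_eq_zero_of_lam_zero hd1 h hk h10 h20 h21
  have h31 := LocRel.coeff_three_one_eq_zero_of_lam_zero h hk h10 h20 h21 h30
  exact h.eq_zero_of_levels h00 h10 h11 h20 h21 h30 h31

theorem LocRel.coeff_one_one_eq_zero_of_zero_zero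
    (h : LocRel k 0 0 t) (hk : 5 ≤ k) (h00 : t 0 0 = 0) (h10 : t 1 0 = 0) :
    t 1 1 = 0 := by
  have e2_10 := h.quad (i := 1) (j := 0) (q := 0) (p := 1) rfl rfl (by decide) (by omega)
  rw [h10, h00] at e2_10
  linear_combination
    (-1 / 2) * e2_10

theorem LocRel.coeff_two_one_eq_zero_of_zero_zero
    (h : LocRel k 0 0 t) (hk : 5 ≤ k) (h10 : t 1 0 = 0) (h20 : t 2 0 = 0) :
    t 2 1 = 0 := by
  have e2_20 := h.quad (i := 2) (j := 1) (q := 0) (p := 1) rfl rfl (by decide) (by omega)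
  rw [h20, h10] at e2_20
  linear_combination
    (-1 / 4) * e2_20

theorem LocRel.coeff_three_zero_eq_zero_of_zero_zero
    (h : LocRel k 0 0 t) (hk : 5 ≤ k) (h10 : t 1 0 = 0) (h20 : t 2 0 = 0) (h21 : t 2 1 = 0) :
    t 3 0 = 0 := by
  have e2_31 := h.quad (i := 3) (j := 2) (q := 1) (p := 2) rfl rfl (by decide) (by omega)
  have e3_30 := h.cubic (i := 3) (j := 2) (m := 1) (q := 0) (p := 1) (r := 2) rfl rfl rfl rfl
    (by decide) (by omega)
  have e2_30 := h.quad (i := 3) (j := 2) (q := 0) (p := 1) rfl rfl (by decide) (by omega)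
  rw [h21] at e2_31
  rw [h21, h10] at e3_30
  rw [h20] at e2_30
  linear_combination
    (-3 / 4) * e2_31 + (5 / 12) * e3_30 + (-1 / 4) * e2_30

theorem LocRel.coeff_three_one_eq_zero_of_zero_zero
    (h : LocRel k 0 0 t) (hk : 5 ≤ k) (h20 : t 2 0 = 0) (h30 : t 3 0 = 0) :
    t 3 1 = 0 := by
  have e2_30 := h.quad (i := 3) (j := 2) (q := 0) (p := 1) rfl rfl (by decide) (by omega)
  rw [h30, h20] at e2_30
  linear_combination
    (-1 / 6) * e2_30

/-- At (0, 0) the obstruction dl to the vanishing of t 2 0 is zero, so t 2 0 becomes a third free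
entry. -/
theorem LocRel.eq_zero_of_zero_zero
    (h : LocRel k 0 0 t) (hk : 5 ≤ k) (h00 : t 0 0 = 0) (h10 : t 1 0 = 0) (h20 : t 2 0 = 0) :
    ∀ i ≤ k, ∀ j ≤ i, t i j = 0 := by
  have h11 := LocRel.coeff_one_one_eq_zero_of_zero_zero h hk h00 h10
  have h21 := LocRel.coeff_two_one_eq_zero_of_zero_zero h hk h10 h20
  have h30 := LocRel.coeff_three_zero_eq_zero_of_zero_zero h hk h10 h20 h21
  have h31 := LocRel.coeff_three_one_eq_zero_of_zero_zero h hk h20 h30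
  exact h.eq_zero_of_levels h00 h10 h11 h20 h21 h30 h31

theorem LocRel.coeff_two_one_eq_zero_of_zero_one
    (h : LocRel k 0 1 t) (hk : 5 ≤ k) (h10 : t 1 0 = 0) (h20 : t 2 0 = 0) :
    t 2 1 = 0 := by
  have e2_20 := h.quad (i := 2) (j := 1) (q := 0) (p := 1) rfl rfl (by decide) (by omega)
  rw [h20, h10] at e2_20
  linear_combination
    (-1 / 2) * e2_20

theorem LocRel.coeff_three_one_eq_zero_of_zero_one
    (h : LocRel k 0 1 t) (hk : 5 ≤ k) (h20 : t 2 0 = 0) (h30 : t 3 0 = 0) :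
    t 3 1 = 0 := by
  have e2_30 := h.quad (i := 3) (j := 2) (q := 0) (p := 1) rfl rfl (by decide) (by omega)
  rw [h30, h20] at e2_30
  linear_combination
    (-1 / 4) * e2_30

/-- At (0, 1) five entries are free. Besides the eigenvalues t 0 0, t 1 0, t 2 0, t 3 0 there is t 1
1, which belongs to the nilpotent map a d/dx ↦ a'. -/
theorem LocRel.eq_zero_of_zero_one
    (h : LocRel k 0 1 t) (hk : 5 ≤ k) (h00 : t 0 0 = 0) (h10 : t 1 0 = 0) (h20 : t 2 0 = 0)
    (h30 : t 3 0 = 0) (h11 : t 1 1 = 0) :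
    ∀ i ≤ k, ∀ j ≤ i, t i j = 0 := by
  have h21 := LocRel.coeff_two_one_eq_zero_of_zero_one h hk h10 h20
  have h31 := LocRel.coeff_three_one_eq_zero_of_zero_one h hk h20 h30
  exact h.eq_zero_of_levels h00 h10 h11 h20 h21 h30 h31

end Certificates

theorem locOp_eq_zero {k : ℕ} {lam mu : 𝕜} {t : ℕ → ℕ → 𝕜}
    (h : ∀ i ≤ k, ∀ j ≤ i, t i j = 0) : locOp k lam mu t = 0 := by
  refine Finset.sum_eq_zero fun i hi => Finset.sum_eq_zero fun j hj => ?_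
  rw [Finset.mem_range] at hi hj
  rw [h i (by omega) j (by omega), zero_smul]

end

noncomputable section

open Filter Topology CircleFun CircleDiffeo

variable {𝕜 : Type*} [RCLike 𝕜]

/-! ### Integration over the circle -/

namespace CircleFun

theorem continuous (φ : CircleFun 𝕜) : Continuous φ.1 := φ.2.1.continuous

theorem intervalIntegrable (φ : CircleFun 𝕜) (a b : ℝ) :
    IntervalIntegrable φ.1 MeasureTheory.volume a b :=
  (CircleFun.continuous φ).intervalIntegrable a b

/-- The integral of a function over the circle. -/
def mean : CircleFun 𝕜 →ₗ[𝕜] 𝕜 where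
  toFun φ := ∫ x in (0 : ℝ)..1, φ.1 x
  map_add' φ ψ := intervalIntegral.integral_add
    (CircleFun.intervalIntegrable φ 0 1) (CircleFun.intervalIntegrable ψ 0 1)
  map_smul' c φ := intervalIntegral.integral_const_mul c φ.1

theorem mean_apply (φ : CircleFun 𝕜) : mean φ = ∫ x in (0 : ℝ)..1, φ.1 x := rfl

theorem mean_ddx (φ : CircleFun 𝕜) : mean (ddx 𝕜 φ) = 0 := by
  rw [mean_apply, intervalIntegral.integral_eq_sub_of_hasDerivAt
    (fun x _ => CircleFun.hasDerivAt φ x) (CircleFun.intervalIntegrable _ 0 1)]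
  have := φ.2.2 0
  rw [zero_add] at this
  rw [this, sub_self]

theorem mean_one : mean (1 : CircleFun 𝕜) = 1 := by
  rw [mean_apply]
  simp

theorem hasDerivAt_primitive (φ : CircleFun 𝕜) (x : ℝ) :
    HasDerivAt (fun x => ∫ y in (0 : ℝ)..x, φ.1 y) (φ.1 x) x :=
  intervalIntegral.integral_hasDerivAt_right (CircleFun.intervalIntegrable φ 0 x)
    ((CircleFun.continuous φ).stronglyMeasurableAtFilter _ _) (CircleFun.continuous φ).continuousAt

theorem contDiff_primitive (φ : CircleFun 𝕜) : ContDiff ℝ ∞ fun x => ∫ y in (0 : ℝ)..x, φ.1 y := by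
  rw [contDiff_infty_iff_deriv]
  refine ⟨fun x => (hasDerivAt_primitive φ x).differentiableAt, ?_⟩
  rw [show deriv (fun x => ∫ y in (0 : ℝ)..x, φ.1 y) = φ.1 from
    funext fun x => (hasDerivAt_primitive φ x).deriv]
  exact φ.2.1

theorem primitive_add_one (φ : CircleFun 𝕜) (x : ℝ) :
    ∫ y in (0 : ℝ)..x + 1, φ.1 y = (∫ y in (0 : ℝ)..x, φ.1 y) + mean φ := by
  rw [← intervalIntegral.integral_add_adjacent_intervals (CircleFun.intervalIntegrable φ 0 x)
    (CircleFun.intervalIntegrable φ x (x + 1)), φ.2.2.intervalIntegral_add_eq x 0, zero_add,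
    mean_apply]

theorem exists_ddx_eq {φ : CircleFun 𝕜} (h : mean φ = 0) : ∃ ψ, ddx 𝕜 ψ = φ := by
  refine ⟨⟨fun x => ∫ y in (0 : ℝ)..x, φ.1 y, contDiff_primitive φ, fun x => ?_⟩, ?_⟩
  · change ∫ y in (0 : ℝ)..x + 1, φ.1 y = _
    rw [primitive_add_one, h, add_zero]
  · ext x
    exact (hasDerivAt_primitive φ x).deriv

theorem mean_densityPullback_one (f : CircleDiffeo) (φ : CircleFun 𝕜) :
    mean (f.densityPullback 1 φ) = mean φ := by
  have h := intervalIntegral.integral_deriv_smul_comp (a := 0) (b := 1) (f := f.toEquiv)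
    (f' := deriv f.toEquiv) (g := φ.1) (fun x _ => (f.differentiable x).hasDerivAt)
    f.contDiff_deriv.continuous.continuousOn (CircleFun.continuous φ)
  have h1 := f.map_add_one 0
  rw [zero_add] at h1
  rw [h1, φ.2.2.intervalIntegral_add_eq _ 0, zero_add] at h
  rw [mean_apply, mean_apply, ← h]
  refine intervalIntegral.integral_congr fun x _ => ?_
  simp only [densityPullback_apply, derivPow_one, Function.comp, RCLike.real_smul_eq_coe_mul]

theorem exists_eq_ofReal_add (φ : CircleFun 𝕜) :
    ∃ a b : CircleFun ℝ, φ = ofReal a + (RCLike.I : 𝕜) • ofReal b := by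
  refine ⟨⟨fun x => RCLike.re (φ.1 x), (RCLike.reCLM (K := 𝕜)).contDiff.comp φ.2.1,
    fun x => by simp only [φ.2.2 x]⟩, ⟨fun x => RCLike.im (φ.1 x),
    (RCLike.imCLM (K := 𝕜)).contDiff.comp φ.2.1, fun x => by simp only [φ.2.2 x]⟩, ?_⟩
  ext x
  change φ.1 x = ((RCLike.re (φ.1 x) : ℝ) : 𝕜) + RCLike.I * ((RCLike.im (φ.1 x) : ℝ) : 𝕜)
  rw [mul_comm]
  exact (RCLike.re_add_im _).symm

/-- Displacements and positivity arguments concern real functions only; linearity over 𝕜 then covers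
the imaginary part. -/
theorem eq_zero_of_forall_ofReal {γ : CircleFun 𝕜 →ₗ[𝕜] 𝕜} (h : ∀ η, γ (ofReal η) = 0) :
    γ = 0 := by
  refine LinearMap.ext fun φ => ?_
  obtain ⟨a, b, rfl⟩ := exists_eq_ofReal_add φ
  rw [map_add, map_smul, h, h, smul_zero, add_zero, LinearMap.zero_apply]

/-- The inverse of a nowhere vanishing function. -/
def inv (φ : CircleFun ℝ) (h : ∀ x, φ.1 x ≠ 0) : CircleFun ℝ :=
  ⟨fun x => (φ.1 x)⁻¹, φ.2.1.inv h, fun x => by simp only [φ.2.2 x]⟩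

theorem exists_pow_mul_eq_one {u : CircleFun ℝ} (hu : ∀ x, 0 < u.1 x) {n : ℕ} (hn : n ≠ 0) :
    ∃ v : CircleFun ℝ, (∀ x, 0 < v.1 x) ∧ ∀ x, u.1 x * v.1 x ^ n = 1 := by
  refine ⟨⟨fun x => Real.exp (-(Real.log (u.1 x) / n)),
    Real.contDiff_exp.comp ((u.2.1.log fun x => (hu x).ne').div_const _).neg,
    fun x => by simp only [u.2.2 x]⟩, fun x => Real.exp_pos _, fun x => ?_⟩
  change u.1 x * Real.exp (-(Real.log (u.1 x) / n)) ^ n = 1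
  have hn' : (n : ℝ) ≠ 0 := Nat.cast_ne_zero.2 hn
  rw [← Real.exp_nat_mul, mul_neg, mul_div_cancel₀ _ hn', Real.exp_neg, Real.exp_log (hu x),
    mul_inv_cancel₀ (hu x).ne']

theorem mean_pos {v : CircleFun ℝ} (hv : ∀ x, 0 < v.1 x) : 0 < mean v :=
  intervalIntegral.intervalIntegral_pos_of_pos_on (CircleFun.intervalIntegrable v 0 1)
    (fun x _ => hv x) one_pos

/-- A primitive of v advances by its mean over one period, so dividing by the mean turns it into the
lift of a diffeomorphism. -/
theorem exists_deriv_eq {v : CircleFun ℝ} (hv : ∀ x, 0 < v.1 x) :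
    ∃ f : CircleDiffeo, ∀ x, deriv f.toEquiv x = v.1 x / mean v := by
  have hm := mean_pos hv
  have hd : ∀ x, HasDerivAt (fun x => (∫ y in (0 : ℝ)..x, v.1 y) / mean v) (v.1 x / mean v) x :=
    fun x => (hasDerivAt_primitive v x).div_const _
  refine ⟨ofLift (fun x => (∫ y in (0 : ℝ)..x, v.1 y) / mean v)
    ((contDiff_primitive v).div_const _) (fun x => ?_) (fun x => ?_), fun x => (hd x).deriv⟩
  · rw [(hd x).deriv]
    exact div_pos (hv x) hm
  · rw [primitive_add_one, add_div, div_self hm.ne']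

end CircleFun

/-! ### Invariant functionals on densities -/

section Invariant

variable {γ : CircleFun 𝕜 →ₗ[𝕜] 𝕜}

/-- There are no invariant functionals on functions. -/
theorem eq_zero_of_invariant_zero
    (h : ∀ (f : CircleDiffeo) b, γ (f.densityPullback 0 b) = γ b) : γ = 0 := by
  have hf : ∀ (f : CircleDiffeo) b, γ (f.pullback b) = γ b := fun f b => by
    rw [← h f b, densityPullback_eq, derivPow_zero, one_mul]
  -- Such an η vanishes for 1/3 < |x| ≤ 1/2. Displacing by s η with s sup |η| ≤ 1/24 keeps the
  -- points with |x| ≤ 1/3 inside |x| ≤ 3/8, where the coordinate is x. So pulling the coordinate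
  -- back adds exactly s η, and invariance gives s γ(η) = 0.
  have hloc : ∀ η : CircleFun ℝ, (∀ x, Real.cos (2 * Real.pi * x) ≤ -1 / 4 → η.1 x = 0) →
      γ (ofReal η) = 0 := by
    intro η hη
    obtain ⟨ε, hε, hp⟩ := exists_perturb η
    obtain ⟨C, hC, hCη⟩ := CircleFun.exists_bound η
    obtain ⟨s, hs0, hsε, hsC⟩ : ∃ s : ℝ, 0 < s ∧ s < ε ∧ s * C ≤ 1 / 24 := by
      refine ⟨min (ε / 2) (1 / (24 * C)), by positivity,
        (min_le_left _ _).trans_lt (by linarith), ?_⟩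
      calc min (ε / 2) (1 / (24 * C)) * C ≤ 1 / (24 * C) * C := by
            gcongr
            exact min_le_right _ _
        _ = 1 / 24 := by field_simp
    obtain ⟨f, hfx⟩ := hp s (by rwa [abs_of_pos hs0])
    have h1 : f.pullback (zc 𝕜) = zc 𝕜 + (s : 𝕜) • ofReal η := by
      rw [← sub_eq_zero]
      refine eq_zero_of_forall_abs_le fun x hx => ?_
      rw [sub_val, add_val, smul_val, pullback_apply, hfx]
      rcases le_or_gt |x| (1 / 3) with hx3 | hx3
      · have h2 : |x + s * η.1 x| ≤ 3 / 8 := by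
          have h3 := hCη x
          rw [Real.norm_eq_abs] at h3
          calc |x + s * η.1 x| ≤ |x| + |s * η.1 x| := abs_add_le _ _
            _ ≤ 1 / 3 + 1 / 24 := by
              rw [abs_mul, abs_of_pos hs0]
              nlinarith
            _ = 3 / 8 := by norm_num
        rw [zc, ofReal_apply, ofReal_apply, ofReal_apply, coord_eq h2, coord_eq (by linarith)]
        push_cast
        ring
      · have h2 : η.1 x = 0 := by
          refine hη x ?_
          have h3 : Real.cos (2 * Real.pi / 3) = -(1 / 2) := by
            rw [show 2 * Real.pi / 3 = Real.pi - Real.pi / 3 by ring, Real.cos_pi_sub,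
              Real.cos_pi_div_three]
          have h4 : Real.cos (2 * Real.pi * x) ≤ Real.cos (2 * Real.pi / 3) := by
            rw [← Real.cos_abs (2 * Real.pi * x), abs_mul, abs_of_pos Real.two_pi_pos]
            exact Real.cos_le_cos_of_nonneg_of_le_pi (by positivity) (by nlinarith [Real.pi_pos])
              (by nlinarith [Real.pi_pos])
          linarith
        rw [ofReal_apply, h2]
        simp
    have h2 := hf f (zc 𝕜)
    rw [h1, map_add, map_smul, smul_eq_mul] at h2
    have h3 : (s : 𝕜) * γ (ofReal η) = 0 := by linear_combination h2
    exact (mul_eq_zero.1 h3).resolve_left (by exact_mod_cast hs0.ne')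
  refine eq_zero_of_forall_ofReal fun η => ?_
  -- A partition of unity into two arcs: the part (1 - χ) η is supported around 1/2, and a half turn
  -- brings it to the first situation.
  set χ := cut (-1 / 4) (1 / 4)
  have h1 : (ofReal η : CircleFun 𝕜) = ofReal (χ * η) + ofReal ((1 - χ) * η) := by
    ext x
    change ((η.1 x : ℝ) : 𝕜) = ((χ.1 x * η.1 x : ℝ) : 𝕜) + (((1 - χ.1 x) * η.1 x : ℝ) : 𝕜)
    push_cast
    ring
  rw [h1, map_add, hloc _ fun x hx => by rw [mul_val, cut_eq_zero (by norm_num) hx, zero_mul],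
    ← hf (rot (1 / 2)), zero_add]
  refine hloc ((rot (1 / 2)).pullback ((1 - χ) * η)) fun x hx => ?_
  rw [pullback_apply, rot_apply, mul_val, sub_val, one_val, cut_eq_one (by norm_num), sub_self,
    zero_mul]
  rw [show 2 * Real.pi * (x + 1 / 2) = 2 * Real.pi * x + Real.pi by ring, Real.cos_add_pi]
  linarith

/-- The invariant functionals on densities of weight one are the multiples of the integral. -/
theorem eq_mean_of_invariant_one
    (h : ∀ (f : CircleDiffeo) b, γ (f.densityPullback 1 b) = γ b) (b : CircleFun 𝕜) :
    γ b = γ 1 * mean b := by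
  -- The pullback of the density dx under x + s η is (1 + s η') dx, so γ vanishes on derivatives and
  -- thus factors through the integral.
  have h1 : γ ∘ₗ ddx 𝕜 = 0 := by
    refine eq_zero_of_forall_ofReal fun η => ?_
    obtain ⟨ε, hε, hp⟩ := exists_perturb η
    obtain ⟨f, hfx⟩ := hp (ε / 2) (by rw [abs_of_pos (by positivity)]; linarith)
    have hd : ∀ x, deriv f.toEquiv x = 1 + ε / 2 * (ddx ℝ η).1 x := fun x => by
      rw [show (f.toEquiv : ℝ → ℝ) = fun x => x + ε / 2 * η.1 x from funext hfx]
      exact ((hasDerivAt_id x).add ((CircleFun.hasDerivAt η x).const_mul _)).deriv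
    have h2 : f.densityPullback 1 (1 : CircleFun 𝕜)
        = 1 + ((ε / 2 : ℝ) : 𝕜) • ddx 𝕜 (ofReal η) := by
      ext x
      change (f.densityPullback 1 (1 : CircleFun 𝕜)).1 x
        = (1 + ((ε / 2 : ℝ) : 𝕜) • ddx 𝕜 (ofReal η)).1 x
      rw [densityPullback_apply, derivPow_one, hd, ddx_ofReal, add_val, smul_val, ofReal_apply,
        one_val, one_val]
      push_cast
      ring
    have h3 := h f 1
    rw [h2, map_add, map_smul, smul_eq_mul] at h3
    have h4 : ((ε / 2 : ℝ) : 𝕜) * γ (ddx 𝕜 (ofReal η)) = 0 := by linear_combination h3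
    refine (mul_eq_zero.1 h4).resolve_left ?_
    have : ε / 2 ≠ 0 := by positivity
    exact_mod_cast this
  have h2 : mean (b - mean b • 1) = 0 := by
    rw [map_sub, map_smul, mean_one, smul_eq_mul, mul_one, sub_self]
  obtain ⟨ψ, hψ⟩ := exists_ddx_eq h2
  have h3 := LinearMap.congr_fun h1 ψ
  rw [LinearMap.comp_apply, hψ, map_sub, map_smul, smul_eq_mul, LinearMap.zero_apply] at h3
  linear_combination h3

/-- Any positive u is, up to a constant, a pullback of 1: for v = u^(-1/n) and f' = v / mean v one
has (f')^(-n) = (mean v)^n u. This gives an explicit formula for γ on positive functions. -/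
theorem invariant_neg_apply {n : ℕ}
    (h : ∀ (f : CircleDiffeo) b, γ (f.densityPullback (-n : 𝕜) b) = γ b) {u v : CircleFun ℝ}
    (hv : ∀ x, 0 < v.1 x) (huv : ∀ x, u.1 x * v.1 x ^ n = 1) :
    ((mean v ^ n : ℝ) : 𝕜) * γ (ofReal u) = γ 1 := by
  obtain ⟨f, hf⟩ := exists_deriv_eq hv
  rw [← h f 1, ← smul_eq_mul, ← map_smul]
  congr 1
  ext x
  have h1 : (f.derivPow (-n : 𝕜)).1 x * ((deriv f.toEquiv x : ℝ) : 𝕜) ^ n = 1 := by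
    rw [← derivPow_nat, ← mul_val, ← derivPow_add, neg_add_cancel, derivPow_zero, one_val]
  have hm := (mean_pos hv).ne'
  have h2 : mean v ^ n * u.1 x * (deriv f.toEquiv x) ^ n = 1 := by
    rw [hf, div_pow]
    have := huv x
    field_simp
    linear_combination this
  have h3 : (((mean v ^ n * u.1 x : ℝ)) : 𝕜) * ((deriv f.toEquiv x : ℝ) : 𝕜) ^ n = 1 := by
    exact_mod_cast congrArg (fun y : ℝ => (y : 𝕜)) h2
  rw [densityPullback_apply, one_val, mul_one, smul_val, ofReal_apply]
  have h4 : ((deriv f.toEquiv x : ℝ) : 𝕜) ^ n ≠ 0 := right_ne_zero_of_mul_eq_one h1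
  refine mul_right_cancel₀ h4 ?_
  rw [h1, ← h3]
  push_cast
  ring

/-- There are no invariant functionals on densities of negative integral weight. -/
theorem eq_zero_of_invariant_neg {n : ℕ} (hn : n ≠ 0)
    (h : ∀ (f : CircleDiffeo) b, γ (f.densityPullback (-n : 𝕜) b) = γ b) : γ = 0 := by
  have h1 : γ 1 = 0 := by
    -- two functions whose sum does not fit with the scaling
    set s : CircleFun ℝ := ⟨fun x => Real.cos (2 * Real.pi * x),
      Real.contDiff_cos.comp (contDiff_const.mul contDiff_id), cos_periodic⟩ with hs
    have hs1 : ∀ x, |s.1 x| ≤ 1 := fun x => Real.abs_cos_le_one _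
    have hsm : mean s = 0 := by
      have : s = ddx ℝ ⟨fun x => Real.sin (2 * Real.pi * x) / (2 * Real.pi),
          (Real.contDiff_sin.comp (contDiff_const.mul contDiff_id)).div_const _, fun x => by
            simp only [mul_add, mul_one, Real.sin_add_two_pi]⟩ := by
        ext x
        refine (HasDerivAt.deriv ?_).symm
        have h2 := (((hasDerivAt_id x).const_mul (2 * Real.pi)).sin).div_const (2 * Real.pi)
        rw [mul_one, mul_div_assoc, div_self Real.two_pi_pos.ne', mul_one] at h2
        exact h2
      rw [this, mean_ddx]
    have hmean : ∀ c : ℝ, mean (1 + c • s) = 1 := fun c => by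
      rw [map_add, map_smul, hsm, mean_one, smul_zero, add_zero]
    have hpos : ∀ c : ℝ, |c| ≤ 1 / 2 → ∀ x, 0 < (1 + c • s).1 x := fun c hc x => by
      rw [add_val, smul_val, one_val]
      have : |c * s.1 x| ≤ 1 / 2 := by
        rw [abs_mul]
        nlinarith [hs1 x, abs_nonneg c]
      linarith [(abs_le.1 this).1]
    -- Both means are 1, so γ takes the value γ 1 on u₁ and on u₂. The contradiction with
    -- additivity, unless γ 1 = 0, comes from the value of γ on u₁ + u₂.
    set v₁ : CircleFun ℝ := 1 + (1 / 2 : ℝ) • s with hv₁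
    set v₂ : CircleFun ℝ := 1 + (-(1 / 2) : ℝ) • s with hv₂
    have hp₁ : ∀ x, 0 < v₁.1 x := hpos _ (by norm_num)
    have hp₂ : ∀ x, 0 < v₂.1 x := hpos _ (by norm_num [abs_neg])
    set u₁ := inv (v₁ ^ n) (fun x => (pow_pos (hp₁ x) n).ne')
    set u₂ := inv (v₂ ^ n) (fun x => (pow_pos (hp₂ x) n).ne')
    have hu₁ : ∀ x, u₁.1 x * v₁.1 x ^ n = 1 := fun x => inv_mul_cancel₀ (pow_pos (hp₁ x) n).ne'
    have hu₂ : ∀ x, u₂.1 x * v₂.1 x ^ n = 1 := fun x => inv_mul_cancel₀ (pow_pos (hp₂ x) n).ne'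
    have hup₁ : ∀ x, 0 < u₁.1 x := fun x => inv_pos.2 (pow_pos (hp₁ x) n)
    have hup₂ : ∀ x, 0 < u₂.1 x := fun x => inv_pos.2 (pow_pos (hp₂ x) n)
    have e1 := invariant_neg_apply h hp₁ hu₁
    have e2 := invariant_neg_apply h hp₂ hu₂
    rw [hmean, one_pow] at e1 e2
    have hup : ∀ x, 0 < (u₁ + u₂).1 x := fun x => add_pos (hup₁ x) (hup₂ x)
    obtain ⟨v, hv, huv⟩ := exists_pow_mul_eq_one hup hn
    have e3 := invariant_neg_apply h hv huv
    have e4 : (ofReal (u₁ + u₂) : CircleFun 𝕜) = ofReal u₁ + ofReal u₂ := by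
      ext x
      exact RCLike.ofReal_add _ _
    rw [e4, map_add] at e3
    -- comparison of the means
    have hprod : ∀ x, u₁.1 x * u₂.1 x * (1 - (s.1 x / 2) ^ 2) ^ n = 1 := fun x => by
      have : (1 - (s.1 x / 2) ^ 2) = v₁.1 x * v₂.1 x := by
        rw [hv₁, hv₂, add_val, smul_val, one_val, add_val, smul_val, one_val]
        ring
      rw [this, mul_pow]
      calc _ = (u₁.1 x * v₁.1 x ^ n) * (u₂.1 x * v₂.1 x ^ n) := by ring
        _ = 1 := by rw [hu₁, hu₂, one_mul]
    have hy : ∀ x, 0 < 1 - (s.1 x / 2) ^ 2 := fun x => by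
      have := abs_le.1 (hs1 x)
      nlinarith
    -- Arithmetic and geometric mean: u₁ u₂ = (1 - s²/4)^(-n) ≥ 1, with strict inequality at 0.
    have hge : ∀ x, 2 ≤ (u₁ + u₂).1 x := fun x => by
      have h2 : (1 - (s.1 x / 2) ^ 2) ^ n ≤ 1 :=
        pow_le_one₀ (hy x).le (by nlinarith [sq_nonneg (s.1 x)])
      have h3 : 1 ≤ u₁.1 x * u₂.1 x := by
        have := mul_pos (hup₁ x) (hup₂ x)
        nlinarith [hprod x]
      rw [add_val]
      nlinarith [sq_nonneg (u₁.1 x - u₂.1 x), hup₁ x, hup₂ x]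
    have hgt : 2 < (u₁ + u₂).1 0 := by
      have hs0 : s.1 0 = 1 := by simp [hs]
      have h2 : (1 - (s.1 0 / 2) ^ 2) ^ n < 1 := pow_lt_one₀ (hy 0).le (by rw [hs0]; norm_num) hn
      have h3 : 1 < u₁.1 0 * u₂.1 0 := by
        have := mul_pos (hup₁ 0) (hup₂ 0)
        nlinarith [hprod 0]
      rw [add_val]
      nlinarith [sq_nonneg (u₁.1 0 - u₂.1 0), hup₁ 0, hup₂ 0]
    -- From v^n = 1/(u₁ + u₂) ≤ 1/2, strictly at 0, follow v ≤ ρ with ρ^n = 1/2 and mean v < ρ. On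
    -- the other hand additivity demands 2 (mean v)^n γ 1 = γ 1.
    set ρ : ℝ := (1 / 2) ^ ((n : ℝ)⁻¹) with hρ
    have hρ0 : 0 ≤ ρ := by positivity
    have hρn : ρ ^ n = 1 / 2 := Real.rpow_inv_natCast_pow (by norm_num) hn
    have hvle : ∀ x, v.1 x ≤ ρ := fun x => by
      refine (pow_le_pow_iff_left₀ (hv x).le hρ0 hn).1 ?_
      rw [hρn]
      have := pow_pos (hv x) n
      nlinarith [huv x, hge x]
    have hvlt : v.1 0 < ρ := by
      refine (pow_lt_pow_iff_left₀ (hv 0).le hρ0 hn).1 ?_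
      rw [hρn]
      have := pow_pos (hv 0) n
      nlinarith [huv 0]
    have hm : mean v < ρ := by
      have h2 := intervalIntegral.integral_lt_integral_of_continuousOn_of_le_of_exists_lt
        (f := v.1) (g := fun _ => ρ) one_pos (CircleFun.continuous v).continuousOn
        continuousOn_const (fun x _ => hvle x) ⟨0, by simp, hvlt⟩
      rw [mean_apply]
      simpa using h2
    have hmn : mean v ^ n < 1 / 2 := by
      rw [← hρn]
      exact pow_lt_pow_left₀ hm (mean_pos hv).le hn
    have e5 : ((1 - 2 * mean v ^ n : ℝ) : 𝕜) * γ 1 = 0 := by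
      push_cast at e1 e2 e3 ⊢
      linear_combination (-1 : 𝕜) * e3 + ((mean v : ℝ) : 𝕜) ^ n * (e1 + e2)
    refine (mul_eq_zero.1 e5).resolve_left ?_
    have : 1 - 2 * mean v ^ n ≠ 0 := by linarith
    exact_mod_cast this
  have hpos : ∀ u : CircleFun ℝ, (∀ x, 0 < u.1 x) → γ (ofReal u) = 0 := by
    intro u hu
    obtain ⟨v, hv, huv⟩ := exists_pow_mul_eq_one hu hn
    have e := invariant_neg_apply h hv huv
    rw [h1] at e
    refine (mul_eq_zero.1 e).resolve_left ?_
    have : mean v ^ n ≠ 0 := (pow_pos (mean_pos hv) n).ne'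
    exact_mod_cast this
  refine eq_zero_of_forall_ofReal fun η => ?_
  obtain ⟨C, hC, hCη⟩ := CircleFun.exists_bound η
  -- A constant makes η positive, and γ already vanishes on constants.
  have h2 := hpos (η + (C + 1) • 1) fun x => by
    have h3 := hCη x
    rw [Real.norm_eq_abs] at h3
    rw [add_val, smul_val, one_val]
    linarith [(abs_le.1 h3).1]
  have h3 : (ofReal (η + (C + 1) • 1) : CircleFun 𝕜) = ofReal η + ((C + 1 : ℝ) : 𝕜) • 1 := by
    ext x
    change ((η.1 x + (C + 1) * 1 : ℝ) : 𝕜) = ((η.1 x : ℝ) : 𝕜) + ((C + 1 : ℝ) : 𝕜) * 1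
    push_cast
    ring
  rwa [h3, map_add, map_smul, h1, smul_zero, add_zero] at h2

end Invariant

end

noncomputable section

open Filter Topology CircleFun CircleDiffeo

variable {𝕜 : Type*} [RCLike 𝕜]

/-! ### The action on principal symbols -/

section Symbol

variable (f : CircleDiffeo)

theorem CircleDiffeo.ddx_pullback_eq (φ : CircleFun 𝕜) :
    ddx 𝕜 (f.pullback φ) = f.derivPow 1 * f.pullback (ddx 𝕜 φ) := by
  ext x
  have h := ((CircleFun.hasDerivAt φ (f.toEquiv x)).scomp x (f.differentiable x).hasDerivAt).deriv
  refine h.trans ?_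
  change _ = (f.derivPow (1 : 𝕜)).1 x * _
  rw [RCLike.real_smul_eq_coe_mul, derivPow_one]
  rfl

theorem CircleDiffeo.ddx_iterate_densityPullback (lam : 𝕜) (i : ℕ) :
    ∃ c : ℕ → CircleFun 𝕜, ∀ φ : CircleFun 𝕜, (ddx 𝕜)^[i] (f.densityPullback lam φ)
      = f.derivPow (lam + i) * f.pullback ((ddx 𝕜)^[i] φ)
        + ∑ j ∈ Finset.range i, c j * f.pullback ((ddx 𝕜)^[j] φ) := by
  induction i with
  | zero => exact ⟨0, fun φ => by simp [densityPullback_eq]⟩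
  | succ i ih =>
    obtain ⟨c, hc⟩ := ih
    refine ⟨fun j => (if j = i then ddx 𝕜 (f.derivPow (lam + i)) else ddx 𝕜 (c j))
      + (if j = 0 then 0 else c (j - 1) * f.derivPow 1), fun φ => ?_⟩
    rw [Function.iterate_succ_apply', hc, map_add, map_sum]
    simp only [ddx_mul, ddx_pullback_eq, add_mul, Finset.sum_add_distrib]
    rw [Finset.sum_range_succ, if_pos rfl, Finset.sum_range_succ']
    simp only [Nat.add_sub_cancel, Nat.succ_ne_zero, if_false, if_true, zero_mul, add_zero,
      ← Function.iterate_succ_apply' (ddx 𝕜)]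
    have hs : ∑ j ∈ Finset.range i, (if j = i then ddx 𝕜 (f.derivPow (lam + i)) else ddx 𝕜 (c j))
        * f.pullback ((ddx 𝕜)^[j] φ)
        = ∑ j ∈ Finset.range i, ddx 𝕜 (c j) * f.pullback ((ddx 𝕜)^[j] φ) :=
      Finset.sum_congr rfl fun j hj => by rw [if_neg (Finset.mem_range.1 hj).ne]
    rw [hs, Nat.cast_succ, ← add_assoc lam, derivPow_add _ (lam + i)]
    simp only [mul_assoc, Nat.succ_eq_add_one]
    abel

theorem CircleDiffeo.densityPullback_mul (lam mu : 𝕜) (φ ψ : CircleFun 𝕜) :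
    f.densityPullback (lam + mu) (φ * ψ) = f.densityPullback lam φ * f.densityPullback mu ψ := by
  simp only [densityPullback_eq, derivPow_add, map_mul]
  ring

/-- The principal symbol of an operator of order i is a density of weight mu - lam - i; all other
effects of the action are of lower order. -/
theorem diffOpAct_mon {k : ℕ} {lam mu : 𝕜} {i : ℕ} (hi : i ≤ k) (b : CircleFun 𝕜) :
    ∃ b' : ℕ → CircleFun 𝕜,
      diffOpAct k lam mu f (mon k lam mu i (f.densityPullback (mu - lam - i) b))
      = mon k lam mu i b + ∑ j ∈ Finset.range i, mon k lam mu j (b' j) := by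
  obtain ⟨c, hc⟩ := f.ddx_iterate_densityPullback lam i
  set a := f.densityPullback (mu - lam - i) b with ha
  refine ⟨fun j => f.symm.densityPullback mu (a * c j), diffOpAct_eq_of_intertwine f fun φ => ?_⟩
  have h1 : (mon k lam mu i b
      + ∑ j ∈ Finset.range i, mon k lam mu j (f.symm.densityPullback mu (a * c j))).1 φ
      = b * (ddx 𝕜)^[i] φ
        + ∑ j ∈ Finset.range i, f.symm.densityPullback mu (a * c j) * (ddx 𝕜)^[j] φ := by
    rw [Submodule.coe_add, LinearMap.add_apply, mon_apply hi, AddSubmonoidClass.coe_finsetSum,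
      LinearMap.sum_apply]
    congr 1
    refine Finset.sum_congr rfl fun j hj => mon_apply ?_ _ _
    have := Finset.mem_range.1 hj
    omega
  have h2 : ∀ ψ φ : CircleFun 𝕜, f.densityPullback mu (ψ * φ)
      = f.densityPullback mu ψ * f.pullback φ := fun ψ φ => by
    simp only [densityPullback_eq, map_mul, mul_assoc]
  rw [h1, mon_apply hi, hc, map_add, map_sum, mul_add, Finset.mul_sum]
  congr 1
  · rw [ha, densityPullback_eq, densityPullback_eq, map_mul,
      show mu = (mu - lam - i) + (lam + i) by ring, derivPow_add]
    simp only [sub_sub, sub_add_cancel]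
    ring
  · refine Finset.sum_congr rfl fun j _ => ?_
    rw [h2, ← mul_assoc]
    congr 1
    exact f.densityPullback_symm mu _

end Symbol

/-! ### Invariant functionals on differential operators -/

section InvariantFunctional

variable {k : ℕ} {lam mu : 𝕜} {c : DiffOp k lam mu →ₗ[𝕜] 𝕜}

/-- When c kills the lower orders, its restriction to order i depends on the principal symbol only,
and is therefore an invariant functional on densities. This allows induction on the order. -/
theorem functional_mon_densityPullback (hc : ∀ f A, c (diffOpAct k lam mu f A) = c A) {i : ℕ}
    (hi : i ≤ k) (hlow : ∀ j < i, ∀ a, c (mon k lam mu j a) = 0) (f : CircleDiffeo)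
    (b : CircleFun 𝕜) :
    c (mon k lam mu i (f.densityPullback (mu - lam - i) b)) = c (mon k lam mu i b) := by
  obtain ⟨b', hb'⟩ := diffOpAct_mon f (k := k) (lam := lam) (mu := mu) hi b
  rw [← hc f, hb', map_add, map_sum, Finset.sum_eq_zero, add_zero]
  exact fun j hj => hlow j (Finset.mem_range.1 hj) _

theorem functional_mon_eq_zero (hc : ∀ f A, c (diffOpAct k lam mu f A) = c A) {i n : ℕ}
    (hi : i ≤ k) (hn : mu - lam - i = -(n : 𝕜))
    (hlow : ∀ j < i, ∀ a, c (mon k lam mu j a) = 0) (a : CircleFun 𝕜) :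
    c (mon k lam mu i a) = 0 := by
  have h := functional_mon_densityPullback hc hi hlow
  rw [hn] at h
  refine LinearMap.congr_fun (?_ : c ∘ₗ mon k lam mu i = 0) a
  rcases Nat.eq_zero_or_pos n with rfl | hpos
  · rw [Nat.cast_zero, neg_zero] at h
    exact eq_zero_of_invariant_zero h
  · exact eq_zero_of_invariant_neg hpos.ne' h

theorem functional_eq_zero (hc : ∀ f A, c (diffOpAct k lam mu f A) = c A) (h : mu = lam) :
    c = 0 := by
  have h' : ∀ i ≤ k, ∀ a, c (mon k lam mu i a) = 0 := by
    intro i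
    induction i using Nat.strong_induction_on with
    | _ i ih =>
    exact fun hi => functional_mon_eq_zero hc hi (n := i) (by rw [h]; ring)
      fun j hj => ih j hj (by omega)
  exact ext_mon h'

variable (k lam mu) in
/-- The functional `A ↦ ∫ A(1)`. -/
def meanOne : DiffOp k lam mu →ₗ[𝕜] 𝕜 where
  toFun A := mean (A.1 1)
  map_add' A B := map_add (mean (𝕜 := 𝕜)) (A.1 1) (B.1 1)
  map_smul' s A := map_smul (mean (𝕜 := 𝕜)) s (A.1 1)

theorem meanOne_apply (A : DiffOp k lam mu) :
    meanOne k lam mu A = mean (A.1 (1 : CircleFun 𝕜)) := rfl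

theorem meanOne_diffOpAct (f : CircleDiffeo) (A : DiffOp k (0 : 𝕜) 1) :
    meanOne k 0 1 (diffOpAct k 0 1 f A) = meanOne k 0 1 A := by
  rw [meanOne_apply, meanOne_apply, ← mean_densityPullback_one f, diffOpAct_coe,
    densityPullback_opAct]
  congr 2
  rw [densityPullback_eq, derivPow_zero, map_one, mul_one]

theorem meanOne_mon {i : ℕ} (hi : i ≤ k) (a : CircleFun 𝕜) :
    meanOne k lam mu (mon k lam mu i a) = if i = 0 then mean a else 0 := by
  rw [meanOne_apply, mon_apply hi]
  split_ifs with h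
  · rw [h, Function.iterate_zero, id, mul_one]
  · rw [ddx_iterate_one h, mul_zero, map_zero]

/-- The symbols have weights 1, 0, -1, ...: order zero admits only the integral, and after
subtracting it nothing is left in the higher orders. -/
theorem functional_eq_meanOne {c : DiffOp k (0 : 𝕜) 1 →ₗ[𝕜] 𝕜}
    (hc : ∀ f A, c (diffOpAct k 0 1 f A) = c A) : c = c (mon k 0 1 0 1) • meanOne k 0 1 := by
  have h0 : ∀ a, c (mon k 0 1 0 a) = c (mon k 0 1 0 1) * mean a := by
    refine eq_mean_of_invariant_one (γ := c ∘ₗ mon k 0 1 0) fun f b => ?_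
    have := functional_mon_densityPullback hc (Nat.zero_le k) (by simp) f b
    rwa [sub_zero, Nat.cast_zero, sub_zero] at this
  set c' := c - c (mon k 0 1 0 1) • meanOne k 0 1 with hc'
  have hinv : ∀ f A, c' (diffOpAct k 0 1 f A) = c' A := fun f A => by
    simp only [hc', LinearMap.sub_apply, LinearMap.smul_apply, hc, meanOne_diffOpAct]
  have h' : ∀ i ≤ k, ∀ a, c' (mon k 0 1 i a) = 0 := by
    intro i
    induction i using Nat.strong_induction_on with
    | _ i ih =>
    intro hi
    rcases Nat.eq_zero_or_pos i with rfl | hpos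
    · intro a
      rw [hc', LinearMap.sub_apply, LinearMap.smul_apply, meanOne_mon (Nat.zero_le k), if_pos rfl,
        h0, smul_eq_mul, sub_self]
    · refine functional_mon_eq_zero hinv hi (n := i - 1) ?_ fun j hj => ih j hj (by omega)
      push_cast [hpos]
      ring
  rw [← sub_eq_zero, ← hc']
  exact ext_mon h'

theorem vanishNear_op_mul {χ : CircleFun 𝕜} {x : ℝ} (h : χ.1 =ᶠ[𝓝 x] 0) (a : ℕ → CircleFun 𝕜) :
    VanishNear (op k lam mu fun i => χ * a i) x := by
  filter_upwards [h] with y hy φ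
  rw [op_apply_pt]
  refine Finset.sum_eq_zero fun i _ => ?_
  rw [mul_val, hy, Pi.zero_apply, zero_mul, zero_mul]

theorem exists_eq_add_vanishNear (A : DiffOp k lam mu) :
    ∃ B C x y, A = B + C ∧ VanishNear B x ∧ VanishNear C y := by
  obtain ⟨a, rfl⟩ := op_surjective A
  set χ : CircleFun ℝ := cut (-1 / 4) (1 / 4)
  have hcont : Continuous fun x : ℝ => Real.cos (2 * Real.pi * x) := by fun_prop
  refine ⟨op k lam mu fun i => ofReal χ * a i, op k lam mu fun i => (1 - ofReal χ) * a i, 1 / 2, 0,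
    ?_, vanishNear_op_mul ?_ a, vanishNear_op_mul ?_ a⟩
  · rw [← map_add]
    congr 1
    funext i
    rw [Pi.add_apply]
    ring
  · have h : ∀ᶠ x in 𝓝 (1 / 2 : ℝ), Real.cos (2 * Real.pi * x) < -1 / 4 :=
      hcont.continuousAt.eventually (gt_mem_nhds (by
        beta_reduce
        rw [show 2 * Real.pi * (1 / 2) = Real.pi by ring, Real.cos_pi]
        norm_num))
    filter_upwards [h] with x hx
    rw [ofReal_apply, cut_eq_zero (by norm_num) hx.le, RCLike.ofReal_zero, Pi.zero_apply]
  · have h : ∀ᶠ x in 𝓝 (0 : ℝ), 1 / 4 < Real.cos (2 * Real.pi * x) :=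
      hcont.continuousAt.eventually (lt_mem_nhds (by
        beta_reduce
        rw [mul_zero, Real.cos_zero]
        norm_num))
    filter_upwards [h] with x hx
    rw [sub_val, one_val, ofReal_apply, cut_eq_one (by norm_num) hx.le, RCLike.ofReal_one, sub_self,
      Pi.zero_apply]

theorem VanishNear.locOp {A : DiffOp k lam mu} {x : ℝ} (hA : VanishNear A x) (t : ℕ → ℕ → 𝕜) :
    VanishNear (locOp k lam mu t A) x := by
  have h1 : ∀ i j, ∀ᶠ y in 𝓝 x, ((ddx 𝕜)^[j] (coefFun k lam mu i A)).1 y = 0 := by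
    intro i j
    have h2 : (coefFun k lam mu i A).1 =ᶠ[𝓝 x] (0 : CircleFun 𝕜).1 := by
      filter_upwards [hA] with y hy
      rw [coefFun_apply, coefAt_apply, hy]
      rfl
    filter_upwards [ddx_iterate_congr h2 j] with y hy
    rw [hy, iterate_map_zero]
    rfl
  have h2 := (Finset.eventually_all (Finset.range (k + 1))).2 fun i _ =>
    (Finset.eventually_all (Finset.range (k + 1))).2 fun j _ => h1 i j
  filter_upwards [h2] with y hy φ
  have h3 : ((_root_.locOp k lam mu t A).1 φ).1 y = ∑ i ∈ Finset.range (k + 1),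
      ∑ j ∈ Finset.range (i + 1),
        (t i j * ((ddx 𝕜)^[j] (coefFun k lam mu i A)).1 y * ((ddx 𝕜)^[i - j] φ).1 y) := by
    have h4 : _root_.locOp k lam mu t A = ∑ i ∈ Finset.range (k + 1), ∑ j ∈ Finset.range (i + 1),
        t i j • mon k lam mu (i - j) ((ddx 𝕜)^[j] (coefFun k lam mu i A)) := by
      simp [_root_.locOp, LinearMap.sum_apply, Module.End.pow_apply]
    rw [h4, AddSubmonoidClass.coe_finsetSum, LinearMap.sum_apply, sum_val]
    refine Finset.sum_congr rfl fun i hi => ?_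
    rw [AddSubmonoidClass.coe_finsetSum, LinearMap.sum_apply, sum_val]
    refine Finset.sum_congr rfl fun j _ => ?_
    rw [Submodule.coe_smul, LinearMap.smul_apply, mon_apply]
    · rw [smul_val, mul_val, mul_assoc]
    · have := Finset.mem_range.1 hi
      omega
  rw [h3]
  refine Finset.sum_eq_zero fun i hi => Finset.sum_eq_zero fun j hj => ?_
  have hi' := Finset.mem_range.1 hi
  have hj' := Finset.mem_range.1 hj
  rw [hy i hi j (Finset.mem_range.2 (by omega)), mul_zero, zero_mul]

theorem VanishNear.diffOpAct {A : DiffOp k lam mu} {x : ℝ} (hA : VanishNear A x)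
    (f : CircleDiffeo) : VanishNear (diffOpAct k lam mu f A) (f.toEquiv x) := by
  have h1 : Tendsto f.symm.toEquiv (𝓝 (f.toEquiv x)) (𝓝 x) := by
    have := f.symm.continuous.tendsto (f.toEquiv x)
    rwa [symm_toEquiv_apply] at this
  filter_upwards [h1.eventually hA] with y hy φ
  have h2 := f.opAct_apply_map lam mu A.1 φ (f.symm.toEquiv y)
  rw [hy, toEquiv_symm_apply] at h2
  exact (mul_eq_zero.1 h2).resolve_left (f.derivPow_ne_zero mu _)

/-- If a local map becomes equivariant after adding a functional times an invariant operator,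
then the functional is invariant. -/
theorem functional_invariant {t : ℕ → ℕ → 𝕜} {l : ℕ} (hl : l ≤ k)
    (hE : ∀ f, diffOpAct k lam mu f (mon k lam mu l 1) = mon k lam mu l 1)
    (hT : locOp k lam mu t + c.smulRight (mon k lam mu l 1) ∈ SymmAlg k lam mu) (f : CircleDiffeo)
    (A : DiffOp k lam mu) : c (diffOpAct k lam mu f A) = c A := by
  -- At the point f x the local part contributes nothing to either side of the equivariance, so the
  -- coefficient of order l there compares the two values of c. A general operator is a sum of two
  -- operators, each vanishing near some point.
  have h1 : ∀ A x, VanishNear A x → c (diffOpAct k lam mu f A) = c A := by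
    intro A x hA
    have h2 := mem_symmAlg_iff.1 hT f A
    simp only [LinearMap.add_apply, LinearMap.smulRight_apply, map_add, map_smul, hE] at h2
    have h3 := congrArg (fun B => coefAt k lam mu l (f.toEquiv x) B) h2
    simp only [map_add, map_smul, coefAt_mon hl, if_true, one_val, smul_eq_mul, mul_one] at h3
    have h4 := ((hA.diffOpAct f).locOp t).self_of_nhds
    have h5 := ((hA.locOp t).diffOpAct f).self_of_nhds
    rwa [coefAt_apply, coefAt_apply, h4, h5, zero_add, zero_add] at h3
  obtain ⟨B, C, x, y, rfl, hB, hC⟩ := exists_eq_add_vanishNear A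
  rw [map_add, map_add, map_add, h1 B x hB, h1 C y hC]

end InvariantFunctional

/-! ### The non-local part of a symmetry -/

section Classification

variable {k : ℕ} {lam mu : 𝕜} {T : Module.End 𝕜 (DiffOp k lam mu)}

theorem diffOpAct_mon_zero_one (f : CircleDiffeo) (h : mu = lam) :
    diffOpAct k lam mu f (mon k lam mu 0 1) = mon k lam mu 0 1 := by
  subst h
  refine diffOpAct_eq_of_intertwine f fun φ => ?_
  rw [mon_apply (Nat.zero_le k), mon_apply (Nat.zero_le k), one_mul, one_mul]
  rfl

/-- Naturality of the exterior derivative from functions to densities of weight one. -/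
theorem diffOpAct_mon_one_one (hk : 1 ≤ k) (f : CircleDiffeo) :
    diffOpAct k (0 : 𝕜) 1 f (mon k 0 1 1 1) = mon k 0 1 1 1 := by
  refine diffOpAct_eq_of_intertwine f fun φ => ?_
  rw [mon_apply hk, mon_apply hk, one_mul, one_mul, densityPullback_eq, densityPullback_eq,
    derivPow_zero, one_mul]
  exact (f.ddx_pullback_eq φ).symm

/-- Away from (0, 1) locality can fail only for mu = lam, and there the functional in question is
invariant, hence zero. -/
theorem exists_eq_locOp_of_mem (hT : T ∈ SymmAlg k lam mu) (h : ¬(lam = 0 ∧ mu = 1)) :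
    ∃ t, T = locOp k lam mu t := by
  by_cases hmu : mu = lam
  · obtain ⟨t, c, rfl⟩ := exists_eq_locOp_add hT (l₀ := 0) (by rw [hmu]; simp)
    have hc := functional_eq_zero
      (functional_invariant (Nat.zero_le k) (fun f => diffOpAct_mon_zero_one f hmu) hT) hmu
    exact ⟨t, by rw [hc, LinearMap.zero_smulRight, add_zero]⟩
  · refine exists_eq_locOp hT fun l hl => ?_
    rcases hl.2 with rfl | ⟨rfl, h0⟩
    · exact hmu (sub_eq_zero.1 (by rw [← hl.1, Nat.cast_zero]))
    · exact h ⟨h0, by have := hl.1; rw [h0, sub_zero, Nat.cast_one] at this; exact this.symm⟩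

theorem meanOne_smulRight_mem (hk : 1 ≤ k) :
    (meanOne k (0 : 𝕜) 1).smulRight (mon k (0 : 𝕜) 1 1 1) ∈ SymmAlg k (0 : 𝕜) 1 := by
  refine mem_symmAlg_iff.2 fun f A => ?_
  rw [LinearMap.smulRight_apply, LinearMap.smulRight_apply, map_smul, meanOne_diffOpAct,
    diffOpAct_mon_one_one hk]

theorem exists_eq_locOp_add_meanOne (hk : 1 ≤ k) {T : Module.End 𝕜 (DiffOp k (0 : 𝕜) 1)}
    (hT : T ∈ SymmAlg k (0 : 𝕜) 1) :
    ∃ (t : ℕ → ℕ → 𝕜) (c : 𝕜), locOp k 0 1 t ∈ SymmAlg k (0 : 𝕜) 1 ∧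
      T = locOp k 0 1 t + c • (meanOne k (0 : 𝕜) 1).smulRight (mon k (0 : 𝕜) 1 1 1) := by
  obtain ⟨t, c, rfl⟩ := exists_eq_locOp_add hT (l₀ := 1) (by simp)
  have hc := functional_eq_meanOne
    (functional_invariant hk (fun f => diffOpAct_mon_one_one hk f) hT)
  have h1 : c.smulRight (mon k (0 : 𝕜) 1 1 1)
      = c (mon k 0 1 0 1) • (meanOne k (0 : 𝕜) 1).smulRight (mon k (0 : 𝕜) 1 1 1) := by
    refine LinearMap.ext fun A => ?_
    have := LinearMap.congr_fun hc A
    rw [LinearMap.smulRight_apply, this, LinearMap.smul_apply, LinearMap.smul_apply,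
      LinearMap.smulRight_apply, smul_assoc]
  refine ⟨t, c (mon k 0 1 0 1), ?_, by rw [h1]⟩
  rw [h1] at hT
  have h2 := Subalgebra.sub_mem _ hT
    (Subalgebra.smul_mem _ (meanOne_smulRight_mem (𝕜 := 𝕜) hk) (c (mon k 0 1 0 1)))
  rwa [add_sub_cancel_right] at h2

end Classification

end

noncomputable section

open Filter Topology CircleFun CircleDiffeo

variable {𝕜 : Type*} [RCLike 𝕜]

/-! ### Integration by parts -/

namespace CircleFun

theorem mean_mul_ddx_iterate (i : ℕ) (φ ψ : CircleFun 𝕜) :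
    mean (ψ * (ddx 𝕜)^[i] φ) = (-1) ^ i * mean (φ * (ddx 𝕜)^[i] ψ) := by
  induction i generalizing φ with
  | zero => simp [mul_comm]
  | succ i ih =>
    rw [Function.iterate_succ_apply, ih, Function.iterate_succ_apply']
    have h := mean_ddx (φ * (ddx 𝕜)^[i] ψ)
    rw [ddx_mul, map_add] at h
    rw [pow_succ]
    linear_combination (-1) ^ i * h

/-- Test against the complex conjugate of χ. -/
theorem eq_zero_of_forall_mean_mul {χ : CircleFun 𝕜} (h : ∀ φ, mean (φ * χ) = 0) : χ = 0 := by
  by_contra hχ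
  obtain ⟨x, hx⟩ : ∃ x, χ.1 x ≠ 0 := by
    by_contra! h0
    exact hχ (Subtype.ext (funext h0))
  obtain ⟨y, hy, hxy⟩ := χ.2.2.exists_mem_Ico₀ one_pos x
  rw [hxy] at hx
  have hcont : Continuous fun x => ‖χ.1 x‖ ^ 2 := (CircleFun.continuous χ).norm.pow 2
  have h1 : 0 < ∫ x in (0 : ℝ)..1, ‖χ.1 x‖ ^ 2 := by
    have h2 := intervalIntegral.integral_lt_integral_of_continuousOn_of_le_of_exists_lt
      (f := fun _ => (0 : ℝ)) (g := fun x => ‖χ.1 x‖ ^ 2) one_pos continuousOn_const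
      hcont.continuousOn (fun x _ => by positivity)
      ⟨y, ⟨hy.1, hy.2.le⟩, by have := norm_pos_iff.2 hx; positivity⟩
    simpa using h2
  have h2 := h ⟨fun x => starRingEnd 𝕜 (χ.1 x),
    (RCLike.conjCLE (K := 𝕜)).contDiff.comp χ.2.1, fun x => by simp only [χ.2.2 x]⟩
  have h3 : ∫ x in (0 : ℝ)..1, ((‖χ.1 x‖ ^ 2 : ℝ) : 𝕜) = 0 := by
    rw [← h2, mean_apply]
    refine intervalIntegral.integral_congr fun x _ => ?_
    rw [mul_val]
    push_cast
    exact (RCLike.conj_mul _).symm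
  rw [RCLike.intervalIntegral_ofReal] at h3
  exact h1.ne' (by exact_mod_cast h3)

end CircleFun

theorem ddx_iterate_comp_mulLeft_mem {k i : ℕ} (hi : i ≤ k) (lam mu : 𝕜) (a : CircleFun 𝕜) :
    (((ddx 𝕜) ^ i) ∘ₗ LinearMap.mulLeft 𝕜 a : CircleFun 𝕜 →ₗ[𝕜] CircleFun 𝕜) ∈ DiffOp k lam mu := by
  -- The identity diffeomorphism turns the expansion for pullbacks into the Leibniz expansion of (a
  -- φ)^(i).
  obtain ⟨c, hc0, hc⟩ := ddx_iterate_pullback (rot 0) a i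
  refine ⟨c, fun φ => ?_⟩
  have hrot : ∀ ψ : CircleFun 𝕜, (rot 0).pullback ψ = ψ := fun ψ => by
    ext x
    exact congrArg ψ.1 (add_zero x)
  have h := hc φ
  simp only [hrot] at h
  rw [LinearMap.comp_apply, LinearMap.mulLeft_apply, Module.End.pow_apply, h]
  refine Finset.sum_subset (fun j hj => ?_) fun j _ hj => ?_
  · rw [Finset.mem_range] at hj ⊢
    omega
  · rw [hc0 j (by simpa using hj), zero_mul]

/-! ### The formal adjoint -/

section Adjoint

variable {k : ℕ} {lam mu lam' mu' : 𝕜}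

variable (k lam mu lam' mu') in
/-- The formal adjoint of a differential operator. -/
def adj : DiffOp k lam mu →ₗ[𝕜] DiffOp k lam' mu' where
  toFun A := ∑ i : Fin (k + 1), (-1 : 𝕜) ^ (i : ℕ) • ⟨((ddx 𝕜) ^ (i : ℕ)) ∘ₗ
    LinearMap.mulLeft 𝕜 (coefFun k lam mu i A),
    ddx_iterate_comp_mulLeft_mem (Nat.lt_succ_iff.1 i.2) lam' mu' _⟩
  map_add' A B := by
    rw [← Finset.sum_add_distrib]
    refine Finset.sum_congr rfl fun i _ => ?_
    rw [← smul_add]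
    congr 1
    refine Subtype.ext (LinearMap.ext fun φ => ?_)
    change ((ddx 𝕜) ^ (i : ℕ)) (coefFun k lam mu i (A + B) * φ)
      = ((ddx 𝕜) ^ (i : ℕ)) (coefFun k lam mu i A * φ)
        + ((ddx 𝕜) ^ (i : ℕ)) (coefFun k lam mu i B * φ)
    rw [map_add, add_mul, map_add]
  map_smul' s A := by
    rw [RingHom.id_apply, Finset.smul_sum]
    refine Finset.sum_congr rfl fun i _ => ?_
    rw [smul_comm]
    congr 1
    refine Subtype.ext (LinearMap.ext fun φ => ?_)
    change ((ddx 𝕜) ^ (i : ℕ)) (coefFun k lam mu i (s • A) * φ)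
      = s • ((ddx 𝕜) ^ (i : ℕ)) (coefFun k lam mu i A * φ)
    rw [map_smul, smul_mul_assoc, map_smul]

theorem adj_apply (A : DiffOp k lam mu) (ψ : CircleFun 𝕜) :
    (adj k lam mu lam' mu' A).1 ψ = ∑ i ∈ Finset.range (k + 1),
      (-1 : 𝕜) ^ i • (ddx 𝕜)^[i] (coefFun k lam mu i A * ψ) := by
  rw [Finset.sum_range]
  have h : ∀ (s : Finset (Fin (k + 1))) (B : Fin (k + 1) → DiffOp k lam' mu'),
      (∑ i ∈ s, B i).1 ψ = ∑ i ∈ s, (B i).1 ψ := fun s B => by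
    rw [AddSubmonoidClass.coe_finsetSum, LinearMap.sum_apply]
  refine (h _ _).trans (Finset.sum_congr rfl fun i _ => ?_)
  rw [Submodule.coe_smul, LinearMap.smul_apply, ← Module.End.pow_apply]
  rfl

theorem mean_mul_apply_eq (A : DiffOp k lam mu) (φ ψ : CircleFun 𝕜) :
    mean (ψ * A.1 φ : CircleFun 𝕜) = mean (φ * (adj k lam mu lam' mu' A).1 ψ : CircleFun 𝕜) := by
  rw [apply_eq_sum_coefFun, adj_apply, Finset.mul_sum, Finset.mul_sum, map_sum, map_sum]
  refine Finset.sum_congr rfl fun i _ => ?_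
  rw [mul_smul_comm, map_smul, smul_eq_mul, ← mul_assoc, mul_comm ψ, mean_mul_ddx_iterate]

/-- The integral pairing is non-degenerate and so determines the adjoint. Its further properties
follow from the pairing without the explicit formula. -/
theorem adj_eq {A : DiffOp k lam mu} {B : DiffOp k lam' mu'}
    (h : ∀ φ ψ : CircleFun 𝕜, mean (ψ * A.1 φ : CircleFun 𝕜) = mean (φ * B.1 ψ : CircleFun 𝕜)) :
    adj k lam mu lam' mu' A = B := by
  refine Subtype.ext (LinearMap.ext fun ψ => ?_)
  have : (adj k lam mu lam' mu' A).1 ψ - B.1 ψ = 0 := by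
    refine eq_zero_of_forall_mean_mul fun φ => ?_
    rw [mul_sub, map_sub, ← mean_mul_apply_eq, h, sub_self]
  exact sub_eq_zero.1 this

theorem adj_adj (A : DiffOp k lam mu) : adj k lam' mu' lam mu (adj k lam mu lam' mu' A) = A :=
  adj_eq fun φ ψ => (mean_mul_apply_eq A ψ φ).symm

theorem adj_mon_one {i : ℕ} (hi : i ≤ k) :
    adj k lam mu lam' mu' (mon k lam mu i 1) = (-1 : 𝕜) ^ i • mon k lam' mu' i 1 := by
  refine adj_eq fun φ ψ => ?_
  rw [mon_apply hi, one_mul, mean_mul_ddx_iterate, Submodule.coe_smul, LinearMap.smul_apply,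
    mon_apply hi, one_mul, mul_smul_comm, map_smul, smul_eq_mul]

/-- The product of densities of weights w and 1 - w has weight one, so the integral pairing is
invariant, and the adjoint taken with respect to it is equivariant. -/
theorem adj_diffOpAct (hlam : lam' = 1 - mu) (hmu : mu' = 1 - lam) (f : CircleDiffeo)
    (A : DiffOp k lam mu) : adj k lam mu lam' mu' (diffOpAct k lam mu f A)
      = diffOpAct k lam' mu' f (adj k lam mu lam' mu' A) := by
  refine adj_eq fun φ ψ => ?_
  rw [diffOpAct_coe, diffOpAct_coe, ← mean_densityPullback_one f (ψ * _),
    ← mean_densityPullback_one f (φ * _)]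
  rw [show (1 : 𝕜) = lam' + mu by rw [hlam]; ring, f.densityPullback_mul, densityPullback_opAct,
    show lam' + mu = lam + mu' by rw [hlam, hmu]; ring, f.densityPullback_mul,
    densityPullback_opAct, ← mean_mul_apply_eq]

variable (k lam mu lam' mu') in
/-- The formal adjoint as a linear isomorphism. -/
def adjEquiv : DiffOp k lam mu ≃ₗ[𝕜] DiffOp k lam' mu' :=
  LinearEquiv.ofLinearMap (adj k lam mu lam' mu') (adj k lam' mu' lam mu)
    (LinearMap.ext adj_adj) (LinearMap.ext adj_adj)

theorem conj_adj_mem (hlam : lam' = 1 - mu) (hmu : mu' = 1 - lam)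
    {T : Module.End 𝕜 (DiffOp k lam mu)} (hT : T ∈ SymmAlg k lam mu) :
    adj k lam mu lam' mu' ∘ₗ T ∘ₗ adj k lam' mu' lam mu ∈ SymmAlg k lam' mu' := by
  refine mem_symmAlg_iff.2 fun f A => ?_
  simp only [LinearMap.comp_apply]
  rw [adj_diffOpAct (by rw [hmu]; ring) (by rw [hlam]; ring), mem_symmAlg_iff.1 hT,
    adj_diffOpAct hlam hmu]

/-- The formal adjoint induces an isomorphism of the algebras of symmetries. -/
theorem nonempty_symmAlg_adj_equiv (hlam : lam' = 1 - mu) (hmu : mu' = 1 - lam) :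
    Nonempty (SymmAlg k lam mu ≃ₐ[𝕜] SymmAlg k lam' mu') := by
  let e := (adjEquiv k lam mu lam' mu').conjAlgEquiv 𝕜
  have h : (SymmAlg k lam mu).map e.toAlgHom = SymmAlg k lam' mu' := by
    ext T
    rw [Subalgebra.mem_map]
    constructor
    · rintro ⟨S, hS, rfl⟩
      exact conj_adj_mem hlam hmu hS
    · intro hT
      refine ⟨_, conj_adj_mem (by rw [hmu]; ring) (by rw [hlam]; ring) hT, ?_⟩
      refine LinearMap.ext fun A => ?_
      change adj k lam mu lam' mu' (adj k lam' mu' lam mu (T (adj k lam mu lam' mu'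
        (adj k lam' mu' lam mu A)))) = T A
      rw [adj_adj, adj_adj]
  exact ⟨(e.subalgebraMap (SymmAlg k lam mu)).trans (Subalgebra.equivOfEq _ _ h)⟩

end Adjoint

/-! ### Splitting off the value on constants when lam = 0 -/

section Lift

variable {m : ℕ} {lam mu : 𝕜}

variable (m mu) in
/-- Composition with `d/dx` from the right. -/
def compDdx : DiffOp m (1 : 𝕜) mu →ₗ[𝕜] DiffOp (m + 1) (0 : 𝕜) mu where
  toFun B := ⟨B.1 ∘ₗ ddx 𝕜, by
    obtain ⟨b, hb⟩ := B.2
    refine ⟨fun i => if i = 0 then 0 else b (i - 1), fun φ => ?_⟩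
    rw [LinearMap.comp_apply, hb, Finset.sum_range_succ' _ (m + 1)]
    dsimp only
    rw [if_pos rfl, zero_mul, add_zero]
    refine Finset.sum_congr rfl fun i _ => ?_
    rw [if_neg i.succ_ne_zero, Nat.add_sub_cancel, Function.iterate_succ_apply]⟩
  map_add' _ _ := rfl
  map_smul' _ _ := rfl

theorem compDdx_apply (B : DiffOp m (1 : 𝕜) mu) (φ : CircleFun 𝕜) :
    (compDdx m mu B).1 φ = B.1 (ddx 𝕜 φ) := rfl

variable (m mu) in
/-- The operator `B` with `A φ = A(1) φ + B φ'`. -/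
def divDdx : DiffOp (m + 1) (0 : 𝕜) mu →ₗ[𝕜] DiffOp m (1 : 𝕜) mu :=
  op m 1 mu ∘ₗ LinearMap.pi fun i => coefFun (m + 1) 0 mu (i + 1)

theorem apply_eq_divDdx (A : DiffOp (m + 1) (0 : 𝕜) mu) (φ : CircleFun 𝕜) :
    A.1 φ = A.1 (1 : CircleFun 𝕜) * φ + (divDdx m mu A).1 (ddx 𝕜 φ) := by
  have h : A.1 (1 : CircleFun 𝕜) = coefFun (m + 1) 0 mu 0 A := by
    rw [apply_eq_sum_coefFun, Finset.sum_eq_single 0]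
    · simp
    · intro i _ hi
      rw [ddx_iterate_one hi, mul_zero]
    · simp
  rw [h, apply_eq_sum_coefFun A φ, Finset.sum_range_succ', add_comm, divDdx, LinearMap.comp_apply,
    op_apply]
  rfl

theorem coefAt_compDdx {i : ℕ} (hi : i ≤ m) (x : ℝ) (B : DiffOp m (1 : 𝕜) mu) :
    coefAt (m + 1) 0 mu (i + 1) x (compDdx m mu B) = coefAt m 1 mu i x B := by
  rw [coefAt_apply, compDdx_apply, apply_eq_sum_coefAt, Finset.sum_eq_single i]
  · rw [← Function.iterate_succ_apply, ddx_iterate_testFun, if_pos rfl, mul_one]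
  · intro j _ hj
    rw [← Function.iterate_succ_apply, ddx_iterate_testFun, if_neg (by omega), mul_zero]
  · intro h
    exact absurd (Finset.mem_range.2 (by omega)) h

theorem compDdx_injective : Function.Injective (compDdx m mu) := fun B C h =>
  DiffOp.ext_coefAt fun i hi x => by rw [← coefAt_compDdx hi, h, coefAt_compDdx hi]

theorem compDdx_mon_one {i : ℕ} (hi : i ≤ m) :
    compDdx m mu (mon m 1 mu i 1) = mon (m + 1) 0 mu (i + 1) 1 := by
  refine Subtype.ext (LinearMap.ext fun φ => ?_)
  rw [compDdx_apply, mon_apply hi, mon_apply (by omega), Function.iterate_succ_apply]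

theorem divDdx_mon_zero (a : CircleFun 𝕜) : divDdx m mu (mon (m + 1) 0 mu 0 a) = 0 := by
  refine compDdx_injective (Subtype.ext (LinearMap.ext fun φ => ?_))
  have h := apply_eq_divDdx (mon (m + 1) 0 mu 0 a) φ
  rw [mon_apply (Nat.zero_le _), mon_apply (Nat.zero_le _)] at h
  simp only [Function.iterate_zero, id, mul_one] at h
  rw [compDdx_apply, map_zero]
  exact (left_eq_add.1 h)

theorem divDdx_mon_succ {i : ℕ} (hi : i ≤ m) (a : CircleFun 𝕜) :
    divDdx m mu (mon (m + 1) 0 mu (i + 1) a) = mon m 1 mu i a := by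
  refine compDdx_injective (Subtype.ext (LinearMap.ext fun φ => ?_))
  have h := apply_eq_divDdx (mon (m + 1) 0 mu (i + 1) a) φ
  rw [mon_apply (by omega), mon_apply (by omega), ddx_iterate_one (by omega), mul_zero, zero_mul,
    zero_add] at h
  rw [compDdx_apply, ← h, compDdx_apply, mon_apply hi, Function.iterate_succ_apply]

theorem densityPullback_one_ddx (f : CircleDiffeo) (φ : CircleFun 𝕜) :
    f.densityPullback 1 (ddx 𝕜 φ) = ddx 𝕜 (f.densityPullback 0 φ) := by
  rw [densityPullback_eq, densityPullback_eq, derivPow_zero, one_mul, f.ddx_pullback_eq]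

theorem densityPullback_zero_one (f : CircleDiffeo) :
    f.densityPullback 0 (1 : CircleFun 𝕜) = 1 := by
  rw [densityPullback_eq, derivPow_zero, map_one, mul_one]

theorem compDdx_diffOpAct (f : CircleDiffeo) (B : DiffOp m (1 : 𝕜) mu) :
    compDdx m mu (diffOpAct m 1 mu f B) = diffOpAct (m + 1) 0 mu f (compDdx m mu B) := by
  refine (diffOpAct_eq_of_intertwine f fun φ => ?_).symm
  rw [compDdx_apply, compDdx_apply, diffOpAct_coe, densityPullback_opAct, densityPullback_one_ddx]

theorem divDdx_diffOpAct (f : CircleDiffeo) (A : DiffOp (m + 1) (0 : 𝕜) mu) :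
    divDdx m mu (diffOpAct (m + 1) 0 mu f A) = diffOpAct m 1 mu f (divDdx m mu A) := by
  refine compDdx_injective (Subtype.ext (LinearMap.ext fun φ => f.densityPullback_injective mu ?_))
  rw [compDdx_apply, compDdx_apply, diffOpAct_coe, densityPullback_opAct, densityPullback_one_ddx]
  have h1 := congrArg (f.densityPullback mu) (apply_eq_divDdx (diffOpAct (m + 1) 0 mu f A) φ)
  have h2 := apply_eq_divDdx A (f.densityPullback 0 φ)
  have h3 := f.densityPullback_mul mu 0 ((diffOpAct (m + 1) 0 mu f A).1 (1 : CircleFun 𝕜)) φ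
  rw [add_zero] at h3
  rw [map_add, h3, diffOpAct_coe, densityPullback_opAct, densityPullback_opAct,
    densityPullback_zero_one, h2] at h1
  exact (add_left_cancel h1).symm

/-- The constant function 1 and d/dx : F_0 → F_1 are invariant, so the decomposition A = A(1) + B ∘
d/dx is equivariant. A symmetry acting on B can therefore be extended by zero on the summand A(1).
-/
theorem comp_divDdx_mem {S : Module.End 𝕜 (DiffOp m (1 : 𝕜) mu)} (hS : S ∈ SymmAlg m 1 mu) :
    compDdx m mu ∘ₗ S ∘ₗ divDdx m mu ∈ SymmAlg (m + 1) 0 mu := by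
  refine mem_symmAlg_iff.2 fun f A => ?_
  simp only [LinearMap.comp_apply]
  rw [divDdx_diffOpAct, mem_symmAlg_iff.1 hS, compDdx_diffOpAct]

end Lift

/-! ### Explicit symmetries -/

section Elements

variable {k m : ℕ} {lam mu : 𝕜}

theorem diffOpAct_mon_zero_apply_one (f : CircleDiffeo) (A : DiffOp k (0 : 𝕜) mu) :
    diffOpAct k 0 mu f (mon k 0 mu 0 (A.1 (1 : CircleFun 𝕜)))
      = mon k 0 mu 0 ((diffOpAct k 0 mu f A).1 (1 : CircleFun 𝕜)) := by
  refine diffOpAct_eq_of_intertwine f fun φ => ?_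
  rw [mon_apply (Nat.zero_le k), mon_apply (Nat.zero_le k)]
  have h3 := f.densityPullback_mul mu 0 ((diffOpAct k 0 mu f A).1 (1 : CircleFun 𝕜)) φ
  rw [add_zero, diffOpAct_coe, densityPullback_opAct, densityPullback_zero_one] at h3
  exact h3

/-- The projection to the operators of order zero. -/
theorem exists_mem_symmAlg_proj (k : ℕ) (mu : 𝕜) : ∃ T ∈ SymmAlg k 0 mu,
    ∀ i ≤ k, ∀ a, T (mon k 0 mu i a) = (if i = 0 then (1 : 𝕜) else 0) • mon k 0 mu i a := by
  let T : Module.End 𝕜 (DiffOp k 0 mu) :=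
    { toFun := fun A => mon k 0 mu 0 (A.1 (1 : CircleFun 𝕜))
      map_add' := fun A B => map_add (mon k 0 mu 0) (A.1 (1 : CircleFun 𝕜)) (B.1 (1 : CircleFun 𝕜))
      map_smul' := fun s A => map_smul (mon k 0 mu 0) s (A.1 (1 : CircleFun 𝕜)) }
  refine ⟨T, mem_symmAlg_iff.2 fun f A => (diffOpAct_mon_zero_apply_one f A).symm,
    fun i hi a => ?_⟩
  change mon k 0 mu 0 ((mon k 0 mu i a).1 (1 : CircleFun 𝕜)) = _
  rw [mon_apply hi]
  split_ifs with h
  · rw [h, Function.iterate_zero, id, mul_one, one_smul]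
  · rw [ddx_iterate_one h, mul_zero, map_zero, zero_smul]

/-- The symmetry is the formal adjoint, which preserves both weights when lam + mu = 1. -/
theorem exists_mem_symmAlg_sign (k : ℕ) (h : lam + mu = 1) : ∃ T ∈ SymmAlg k lam mu,
    ∀ i ≤ k, T (mon k lam mu i 1) = (-1 : 𝕜) ^ i • mon k lam mu i 1 :=
  ⟨adj k lam mu lam mu, mem_symmAlg_iff.2 fun f A => adj_diffOpAct (by rw [← h]; ring)
    (by rw [← h]; ring) f A, fun _ hi => adj_mon_one hi⟩

theorem exists_mem_symmAlg_lift {S : Module.End 𝕜 (DiffOp m (1 : 𝕜) mu)}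
    (hS : S ∈ SymmAlg m 1 mu) : ∃ T ∈ SymmAlg (m + 1) 0 mu,
      (∀ a, T (mon (m + 1) 0 mu 0 a) = 0) ∧
      ∀ i ≤ m, ∀ s : 𝕜, S (mon m 1 mu i 1) = s • mon m 1 mu i 1 →
        T (mon (m + 1) 0 mu (i + 1) 1) = s • mon (m + 1) 0 mu (i + 1) 1 := by
  refine ⟨_, comp_divDdx_mem hS, fun a => ?_, fun i hi s h => ?_⟩
  · rw [LinearMap.comp_apply, LinearMap.comp_apply, divDdx_mon_zero, map_zero, map_zero]
  · rw [LinearMap.comp_apply, LinearMap.comp_apply, divDdx_mon_succ hi, h, map_smul,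
      compDdx_mon_one hi]

theorem exists_mem_symmAlg_conj {lam' mu' : 𝕜} (hlam : lam' = 1 - mu) (hmu : mu' = 1 - lam)
    {S : Module.End 𝕜 (DiffOp k lam mu)} (hS : S ∈ SymmAlg k lam mu) :
    ∃ T ∈ SymmAlg k lam' mu', ∀ i ≤ k, ∀ s : 𝕜, S (mon k lam mu i 1) = s • mon k lam mu i 1 →
      T (mon k lam' mu' i 1) = s • mon k lam' mu' i 1 := by
  refine ⟨_, conj_adj_mem hlam hmu hS, fun i hi s h => ?_⟩
  rw [LinearMap.comp_apply, LinearMap.comp_apply, adj_mon_one hi, map_smul, h, map_smul, map_smul,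
    adj_mon_one hi, smul_comm s, smul_smul, ← mul_pow, neg_one_mul, neg_neg, one_pow, one_smul]

/-- The operator `a d/dx ↦ a'`. -/
theorem exists_mem_symmAlg_deriv (m : ℕ) : ∃ T ∈ SymmAlg (m + 1) (0 : 𝕜) 1,
    (∀ i ≤ m + 1, T (mon (m + 1) 0 1 i 1) = 0) ∧
      ∀ a, T (mon (m + 1) 0 1 1 a) = mon (m + 1) 0 1 0 (ddx 𝕜 a) := by
  let ev : DiffOp m (0 : 𝕜) 0 →ₗ[𝕜] CircleFun 𝕜 :=
    { toFun := fun A => A.1 (1 : CircleFun 𝕜), map_add' := fun _ _ => rfl,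
      map_smul' := fun _ _ => rfl }
  -- Write A = A(1) + B ∘ d/dx with B of weights (1, 1). Its adjoint has weights (0, 0) and takes 1
  -- to a function, whose differential, of weight one, acts as multiplication from F_0 to F_1. Each
  -- step is equivariant.
  let T : Module.End 𝕜 (DiffOp (m + 1) (0 : 𝕜) 1) :=
    mon (m + 1) 0 1 0 ∘ₗ ddx 𝕜 ∘ₗ ev ∘ₗ adj m 1 1 0 0 ∘ₗ divDdx m 1
  have hT : ∀ A, T A = mon (m + 1) 0 1 0
      (ddx 𝕜 ((adj m 1 1 0 0 (divDdx m 1 A)).1 (1 : CircleFun 𝕜))) := fun _ => rfl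
  refine ⟨T, mem_symmAlg_iff.2 fun f A => ?_, fun i hi => ?_, fun a => ?_⟩
  · rw [hT, hT]
    refine (diffOpAct_eq_of_intertwine f fun φ => ?_).symm
    rw [mon_apply (Nat.zero_le _), mon_apply (Nat.zero_le _)]
    have h3 := f.densityPullback_mul 1 0 (ddx 𝕜 ((adj m (1 : 𝕜) 1 0 0 (divDdx m 1
      (diffOpAct (m + 1) 0 1 f A))).1 (1 : CircleFun 𝕜))) φ
    rw [add_zero, densityPullback_one_ddx, divDdx_diffOpAct,
      adj_diffOpAct (by ring) (by ring), diffOpAct_coe, densityPullback_opAct,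
      densityPullback_zero_one] at h3
    rw [divDdx_diffOpAct, adj_diffOpAct (by ring) (by ring), diffOpAct_coe]
    exact h3
  · rw [hT]
    rcases i with _ | i
    · rw [divDdx_mon_zero, map_zero]
      exact (congrArg (mon (m + 1) 0 1 0) (map_zero (ddx 𝕜))).trans (map_zero _)
    · rw [divDdx_mon_succ (by omega), adj_mon_one (by omega), Submodule.coe_smul,
        LinearMap.smul_apply, mon_apply (by omega), one_mul, map_smul,
        ← Function.iterate_succ_apply' (ddx 𝕜), ddx_iterate_one (Nat.succ_ne_zero i), smul_zero,
        map_zero]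
  · rw [hT, divDdx_mon_succ (Nat.zero_le m)]
    congr 2
    have : adj m 1 1 0 0 (mon m 1 1 0 a) = mon m (0 : 𝕜) 0 0 a := adj_eq fun φ ψ => by
      rw [mon_apply (Nat.zero_le m), mon_apply (Nat.zero_le m)]
      congr 1
      simp only [Function.iterate_zero, id]
      ring
    rw [this, mon_apply (Nat.zero_le m), Function.iterate_zero, id, mul_one]

end Elements

end

noncomputable section

open Filter Topology CircleFun CircleDiffeo

variable {𝕜 : Type*} [RCLike 𝕜]

/-! ### The cases in which the algebra is a power of 𝕜 -/

section Diagonal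

variable {k : ℕ} {lam mu : 𝕜}

theorem locOp_mon_one (t : ℕ → ℕ → 𝕜) {i : ℕ} (hi : i ≤ k) :
    locOp k lam mu t (mon k lam mu i 1) = t i 0 • mon k lam mu i 1 := by
  rw [locOp_mon t hi, Finset.sum_eq_single 0]
  · rfl
  · intro j _ hj
    rw [ddx_iterate_one hj, map_zero, smul_zero]
  · simp

theorem symmAlg_injective_of_forall_eq_zero {V : Type*} [AddCommGroup V] [Module 𝕜 V]
    {Φ : SymmAlg k lam mu →ₗ[𝕜] V} (h : ∀ T, Φ T = 0 → T = 0) : Function.Injective Φ :=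
  fun S T hST => by
    have h1 : Φ T = Φ (S - T) + Φ T :=
      hST.symm.trans ((congrArg Φ (sub_add_cancel S T).symm).trans (Φ.map_add (S - T) T))
    exact sub_eq_zero.1 (h _ (right_eq_add.1 h1))

/-- If a symmetry is determined by its eigenvalues on the first `n` powers of `d/dx`, and these
eigenvalues are arbitrary, then the algebra of symmetries is isomorphic to `𝕜ⁿ`. -/
theorem nonempty_symmAlg_equiv_pi {n : ℕ} (hn : n ≤ k + 1) (hloc : ¬(lam = 0 ∧ mu = 1))
    (hinj : ∀ t, LocRel k lam (mu - lam) t → (∀ i < n, t i 0 = 0) → ∀ i ≤ k, ∀ j ≤ i, t i j = 0)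
    (hel : ∀ s : ℕ → 𝕜, ∃ T ∈ SymmAlg k lam mu, ∀ i < n,
      T (mon k lam mu i 1) = s i • mon k lam mu i 1) :
    Nonempty (SymmAlg k lam mu ≃ₐ[𝕜] (Fin n → 𝕜)) := by
  have hval : ∀ (i : Fin n) (s : 𝕜), coefAt k lam mu i 0 (s • mon k lam mu i 1) = s := fun i s => by
    rw [map_smul, coefAt_mon (by omega), if_pos rfl, smul_eq_mul]
    exact mul_one s
  -- Every symmetry here is local, so the operators d^i with constant coefficients are eigenvectors.
  -- Recording the eigenvalues is multiplicative.
  let Φ : SymmAlg k lam mu →ₗ[𝕜] (Fin n → 𝕜) := LinearMap.pi fun i =>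
    (coefAt k lam mu i 0) ∘ₗ LinearMap.applyₗ (mon k lam mu i (1 : CircleFun 𝕜)) ∘ₗ
      (SymmAlg k lam mu).val.toLinearMap
  have hΦ : ∀ T i, Φ T i = coefAt k lam mu i 0 (T.1 (mon k lam mu i 1)) := fun _ _ => rfl
  have hT : ∀ (T : SymmAlg k lam mu) (i : Fin n),
      T.1 (mon k lam mu i 1) = Φ T i • mon k lam mu i 1 := fun T i => by
    obtain ⟨t, ht⟩ := exists_eq_locOp_of_mem T.2 hloc
    rw [hΦ, ht, locOp_mon_one t (by omega), hval]
  have hmul : ∀ S T, Φ (S * T) = Φ S * Φ T := fun S T => funext fun i => by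
    have h : S.1 (T.1 (mon k lam mu i 1)) = Φ T i • Φ S i • mon k lam mu i 1 :=
      (congrArg S.1 (hT T i)).trans ((S.1.map_smul _ _).trans (congrArg _ (hT S i)))
    have h' : coefAt k lam mu i 0 (Φ T i • Φ S i • mon k lam mu i 1) = Φ T i * Φ S i :=
      ((coefAt k lam mu i 0).map_smul _ _).trans (congrArg (Φ T i * ·) (hval i _))
    exact (congrArg (coefAt k lam mu i 0) h).trans (h'.trans (mul_comm _ _))
  have hone : Φ 1 = 1 := funext fun i => by
    have := hval i 1
    rwa [one_smul] at this
  have hker : ∀ T, Φ T = 0 → T = 0 := fun T hT0 => by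
    obtain ⟨t, ht⟩ := exists_eq_locOp_of_mem T.2 hloc
    have h0 : ∀ i < n, t i 0 = 0 := fun i hi => by
      have h1 : Φ T ⟨i, hi⟩ = 0 := by rw [hT0, Pi.zero_apply]
      rw [hΦ, ht, locOp_mon_one t (by simp only; omega)] at h1
      exact (hval ⟨i, hi⟩ (t i 0)).symm.trans h1
    have hmem : locOp k lam mu t ∈ SymmAlg k lam mu := ht ▸ T.2
    exact Subtype.ext (ht.trans (locOp_eq_zero (hinj t (locRel_of_mem hmem) h0)))
  have h1 : Function.Injective Φ := symmAlg_injective_of_forall_eq_zero hker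
  have h2 : Function.Surjective Φ := fun s => by
    obtain ⟨T, hT1, hT2⟩ := hel fun i => if h : i < n then s ⟨i, h⟩ else 0
    refine ⟨⟨T, hT1⟩, funext fun i => ?_⟩
    rw [hΦ, hT2 i i.2, hval, dif_pos i.2]
  exact ⟨AlgEquiv.ofBijective (AlgHom.ofLinearMap Φ hone hmul) ⟨h1, h2⟩⟩

theorem nonempty_symmAlg_equiv_of_generic (hk : 5 ≤ k) (hadd : lam + mu ≠ 1) (hl : lam ≠ 0)
    (hm : mu ≠ 1) : Nonempty (SymmAlg k lam mu ≃ₐ[𝕜] (Fin 1 → 𝕜)) := by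
  refine nonempty_symmAlg_equiv_pi (by omega) (fun h => hl h.1)
    (fun t h h0 i hi j hij => LocRel.eq_zero_of_generic hl ?_ ?_ h hk (h0 0 (by omega)) i hi j hij)
    fun s => ⟨s 0 • 1, Subalgebra.smul_mem _ (Subalgebra.one_mem _) _, fun i hi => ?_⟩
  · rwa [add_sub_cancel, sub_ne_zero]
  · rwa [show 2 * lam + (mu - lam) - 1 = lam + mu - 1 by ring, sub_ne_zero]
  · obtain rfl : i = 0 := by omega
    rfl

theorem symmAlg_eq_bot (hk : 5 ≤ k) (hadd : lam + mu ≠ 1) (hl : lam ≠ 0) (hm : mu ≠ 1) :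
    SymmAlg k lam mu = ⊥ := by
  obtain ⟨e⟩ := nonempty_symmAlg_equiv_of_generic hk hadd hl hm
  refine eq_bot_iff.2 fun T hT => Algebra.mem_bot.2 ⟨e ⟨T, hT⟩ 0, ?_⟩
  have h : algebraMap 𝕜 (SymmAlg k lam mu) (e ⟨T, hT⟩ 0) = ⟨T, hT⟩ := e.injective <| by
    rw [e.commutes]
    exact funext fun i => by rw [Subsingleton.elim i 0]; rfl
  exact congrArg Subtype.val h

theorem nonempty_symmAlg_equiv_of_add_eq_one (hk : 5 ≤ k) (hadd : lam + mu = 1) (hl : lam ≠ 0) :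
    Nonempty (SymmAlg k lam mu ≃ₐ[𝕜] (Fin 2 → 𝕜)) := by
  -- On 1 and d/dx the identity has eigenvalues (1, 1) and the adjoint (1, -1), so together they
  -- realise every pair.
  obtain ⟨C, hC, hCm⟩ := exists_mem_symmAlg_sign k hadd
  refine nonempty_symmAlg_equiv_pi (by omega) (fun h => hl h.1)
    (fun t h h0 => LocRel.eq_zero_of_adjoint hl ?_ hk (h0 0 (by omega)) (h0 1 (by omega)))
    fun s => ⟨((s 0 + s 1) / 2) • 1 + ((s 0 - s 1) / 2) • C, Subalgebra.add_mem _
      (Subalgebra.smul_mem _ (Subalgebra.one_mem _) _) (Subalgebra.smul_mem _ hC _), fun i hi => ?_⟩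
  · rwa [show 1 - 2 * lam = mu - lam by linear_combination -hadd]
  · rw [LinearMap.add_apply, LinearMap.smul_apply, LinearMap.smul_apply, hCm i (by omega),
      Module.End.one_apply, smul_smul, ← add_smul]
    congr 1
    interval_cases i <;> ring

theorem nonempty_symmAlg_zero_equiv (hk : 5 ≤ k) (hm0 : mu ≠ 0) (hm1 : mu ≠ 1) :
    Nonempty (SymmAlg k 0 mu ≃ₐ[𝕜] (Fin 2 → 𝕜)) := by
  obtain ⟨E, hE, hEm⟩ := exists_mem_symmAlg_proj k mu
  refine nonempty_symmAlg_equiv_pi (by omega) (fun h => hm1 h.2)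
    (fun t h h0 => LocRel.eq_zero_of_lam_zero (by rwa [sub_zero]) (by rwa [sub_zero]) h hk
      (h0 0 (by omega)) (h0 1 (by omega)))
    fun s => ⟨s 1 • 1 + (s 0 - s 1) • E, Subalgebra.add_mem _
      (Subalgebra.smul_mem _ (Subalgebra.one_mem _) _) (Subalgebra.smul_mem _ hE _), fun i hi => ?_⟩
  rw [LinearMap.add_apply, LinearMap.smul_apply, LinearMap.smul_apply, hEm i (by omega),
    Module.End.one_apply, smul_smul, ← add_smul]
  congr 1
  interval_cases i
  · simp
  · simp

/-- The adjoint exchanges (lam, 1) with (0, 1 - lam), which reduces to the previous case. -/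
theorem nonempty_symmAlg_equiv_one (hk : 5 ≤ k) (hl0 : lam ≠ 0) (hl1 : lam ≠ 1) :
    Nonempty (SymmAlg k lam 1 ≃ₐ[𝕜] (Fin 2 → 𝕜)) := by
  obtain ⟨e⟩ := nonempty_symmAlg_zero_equiv (𝕜 := 𝕜) hk (sub_ne_zero.2 hl1.symm)
    (fun h => hl0 (by linear_combination -h))
  obtain ⟨e'⟩ := nonempty_symmAlg_adj_equiv (𝕜 := 𝕜) (k := k) (lam := lam) (mu := 1) (lam' := 0)
    (mu' := 1 - lam) (by ring) rfl
  exact ⟨e'.trans e⟩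

theorem nonempty_symmAlg_zero_zero_equiv (hk : 5 ≤ k) :
    Nonempty (SymmAlg k (0 : 𝕜) 0 ≃ₐ[𝕜] (Fin 3 → 𝕜)) := by
  obtain ⟨m, rfl⟩ : ∃ m, k = m + 1 := ⟨k - 1, by omega⟩
  obtain ⟨E, hE, hEm⟩ := exists_mem_symmAlg_proj (𝕜 := 𝕜) (m + 1) 0
  -- The weights (1, 0) add up to 1, so the adjoint is a symmetry of the factor B. Lifted, it has
  -- eigenvalues (0, 1, -1) on 1, d, d², and with the identity and the projection this spans all
  -- triples.
  obtain ⟨C₀, hC₀, hCm₀⟩ := exists_mem_symmAlg_sign (𝕜 := 𝕜) (lam := 1) (mu := 0) m (by ring)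
  obtain ⟨C, hC, hCz, hCm⟩ := exists_mem_symmAlg_lift hC₀
  have hCm' : ∀ i < 3, C (mon (m + 1) 0 0 i 1)
      = (if i = 0 then (0 : 𝕜) else (-1) ^ (i - 1)) • mon (m + 1) 0 0 i 1 := by
    rintro (_ | i) hi
    · rw [hCz, if_pos rfl, zero_smul]
    · exact hCm i (by omega) _ (hCm₀ i (by omega))
  refine nonempty_symmAlg_equiv_pi (by omega) (fun h => zero_ne_one h.2)
    (fun t h h0 => LocRel.eq_zero_of_zero_zero (by rwa [sub_zero] at h) hk
      (h0 0 (by omega)) (h0 1 (by omega)) (h0 2 (by omega)))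
    fun s => ⟨((s 1 + s 2) / 2) • 1 + (s 0 - (s 1 + s 2) / 2) • E + ((s 1 - s 2) / 2) • C,
      Subalgebra.add_mem _ (Subalgebra.add_mem _
      (Subalgebra.smul_mem _ (Subalgebra.one_mem _) _) (Subalgebra.smul_mem _ hE _))
      (Subalgebra.smul_mem _ hC _), fun i hi => ?_⟩
  rw [LinearMap.add_apply, LinearMap.add_apply, LinearMap.smul_apply, LinearMap.smul_apply,
    LinearMap.smul_apply, hEm i (by omega), hCm' i hi, Module.End.one_apply, smul_smul, smul_smul,
    ← add_smul, ← add_smul]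
  congr 1
  interval_cases i
  · simp
  · norm_num
    ring
  · norm_num
    ring

theorem nonempty_symmAlg_one_one_equiv (hk : 5 ≤ k) :
    Nonempty (SymmAlg k (1 : 𝕜) 1 ≃ₐ[𝕜] (Fin 3 → 𝕜)) := by
  obtain ⟨e⟩ := nonempty_symmAlg_zero_zero_equiv (𝕜 := 𝕜) hk
  obtain ⟨e'⟩ := nonempty_symmAlg_adj_equiv (𝕜 := 𝕜) (k := k) (lam := 1) (mu := 1) (lam' := 0)
    (mu' := 0) (by ring) (by ring)
  exact ⟨e'.trans e⟩

end Diagonal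

end

/-! ### The algebra of symmetries for (lam, mu) = (0, 1) -/

noncomputable section

open Filter Topology CircleFun CircleDiffeo

variable {𝕜 : Type*} [RCLike 𝕜]

/-- The element of `𝔟` with given entries. -/
def AlgB.mk (a b c d : 𝕜) : AlgB 𝕜 :=
  ⟨!![a, 0, 0, d; 0, a, 0, 0; 0, c, b, 0; 0, 0, 0, b], a, b, c, d, rfl⟩

theorem AlgB.mk_add (a b c d a' b' c' d' : 𝕜) :
    AlgB.mk (a + a') (b + b') (c + c') (d + d') = AlgB.mk a b c d + AlgB.mk a' b' c' d' := by
  refine Subtype.ext (Matrix.ext fun i j => ?_)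
  fin_cases i <;> fin_cases j <;> simp [AlgB.mk]

theorem AlgB.mk_smul (r a b c d : 𝕜) :
    AlgB.mk (r * a) (r * b) (r * c) (r * d) = r • AlgB.mk a b c d := by
  refine Subtype.ext (Matrix.ext fun i j => ?_)
  fin_cases i <;> fin_cases j <;> simp [AlgB.mk]

theorem AlgB.mk_mul (a b c d a' b' c' d' : 𝕜) :
    AlgB.mk (a * a') (b * b') (c * a' + b * c') (a * d' + d * b')
      = AlgB.mk a b c d * AlgB.mk a' b' c' d' := by
  refine Subtype.ext (Matrix.ext fun i j => ?_)
  fin_cases i <;> fin_cases j <;> simp [AlgB.mk, Matrix.mul_apply, Fin.sum_univ_four]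

theorem AlgB.mk_one : AlgB.mk (1 : 𝕜) 1 0 0 = 1 := by
  refine Subtype.ext (Matrix.ext fun i j => ?_)
  fin_cases i <;> fin_cases j <;> simp [AlgB.mk]

theorem AlgB.mk_eq_zero {a b c d : 𝕜} (h : AlgB.mk a b c d = 0) :
    a = 0 ∧ b = 0 ∧ c = 0 ∧ d = 0 := by
  have h' : ∀ i j, (AlgB.mk a b c d).1 i j = 0 := fun i j => by rw [h]; rfl
  exact ⟨h' 0 0, h' 2 2, h' 2 1, h' 0 3⟩

/-- The element of `𝔟 ⊕ 𝕜²` with given entries. -/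
def algBProdMk : (Fin 6 → 𝕜) →ₗ[𝕜] AlgB 𝕜 × (Fin 2 → 𝕜) where
  toFun v := (AlgB.mk (v 0) (v 1) (v 2) (v 3), ![v 4, v 5])
  map_add' v w := Prod.ext (AlgB.mk_add _ _ _ _ _ _ _ _) (by simp)
  map_smul' r v := Prod.ext (AlgB.mk_smul _ _ _ _ _) (by simp)

theorem algBProdMk_mul (a b c d s₂ s₃ a' b' c' d' s₂' s₃' : 𝕜) :
    algBProdMk ![a * a', b * b', c * a' + b * c', a * d' + d * b', s₂ * s₂', s₃ * s₃']
      = algBProdMk ![a, b, c, d, s₂, s₃] * algBProdMk ![a', b', c', d', s₂', s₃'] := by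
  refine Prod.ext (AlgB.mk_mul a b c d a' b' c' d') (funext fun i => ?_)
  fin_cases i <;> rfl

theorem algBProdMk_one : algBProdMk ![(1 : 𝕜), 1, 0, 0, 1, 1] = 1 := by
  refine Prod.ext AlgB.mk_one (funext fun i => ?_)
  fin_cases i <;> rfl

theorem algBProdMk_eq_zero {v : Fin 6 → 𝕜} (h : algBProdMk v = 0) (i : Fin 6) : v i = 0 := by
  obtain ⟨h0, h1, h2, h3⟩ := AlgB.mk_eq_zero (congrArg Prod.fst h)
  have h4 : ∀ i, ![v 4, v 5] i = (0 : Fin 2 → 𝕜) i := congrFun (congrArg Prod.snd h)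
  fin_cases i
  exacts [h0, h1, h2, h3, h4 0, h4 1]

theorem algBProdMk_surjective : Function.Surjective (algBProdMk (𝕜 := 𝕜)) := by
  rintro ⟨⟨_, a, b, c, d, rfl⟩, s⟩
  refine ⟨![a, b, c, d, s 0, s 1], Prod.ext rfl (funext fun i => ?_)⟩
  fin_cases i <;> rfl

section ZeroOne

variable {k : ℕ}

/-- A symmetry of `D^k_{0,1}` on operators of low order. -/
structure ZeroOneForm (k : ℕ) (T : Module.End 𝕜 (DiffOp k (0 : 𝕜) 1)) (a b c d s₂ s₃ : 𝕜) :
    Prop where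
  zero : ∀ φ, T (mon k 0 1 0 φ) = a • mon k 0 1 0 φ + (c * mean φ) • mon k 0 1 1 1
  one : ∀ φ, T (mon k 0 1 1 φ) = b • mon k 0 1 1 φ + d • mon k 0 1 0 (ddx 𝕜 φ)
  two : T (mon k 0 1 2 1) = s₂ • mon k 0 1 2 1
  three : T (mon k 0 1 3 1) = s₃ • mon k 0 1 3 1

theorem zeroOneForm_locOp_add (hk : 3 ≤ k) (t : ℕ → ℕ → 𝕜) (c : 𝕜) :
    ZeroOneForm k (locOp k 0 1 t + c • (meanOne k 0 1).smulRight (mon k 0 1 1 1))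
      (t 0 0) (t 1 0) c (t 1 1) (t 2 0) (t 3 0) where
  zero φ := by
    rw [LinearMap.add_apply, LinearMap.smul_apply, LinearMap.smulRight_apply,
      meanOne_mon (Nat.zero_le k), if_pos rfl, locOp_mon t (Nat.zero_le k), smul_smul]
    simp
  one φ := by
    rw [LinearMap.add_apply, LinearMap.smul_apply, LinearMap.smulRight_apply,
      meanOne_mon (by omega), if_neg one_ne_zero, locOp_mon t (by omega)]
    simp [Finset.sum_range_succ]
  two := by
    rw [LinearMap.add_apply, LinearMap.smul_apply, LinearMap.smulRight_apply,
      meanOne_mon (by omega), if_neg two_ne_zero, locOp_mon_one t (by omega), zero_smul, smul_zero,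
      add_zero]
  three := by
    rw [LinearMap.add_apply, LinearMap.smul_apply, LinearMap.smulRight_apply,
      meanOne_mon (by omega), if_neg three_ne_zero, locOp_mon_one t (by omega), zero_smul,
      smul_zero, add_zero]

variable (k) in
/-- The entries of a symmetry of `D^k_{0,1}`. -/
def zeroOneCoord (i : Fin 6) : Module.End 𝕜 (DiffOp k (0 : 𝕜) 1) →ₗ[𝕜] 𝕜 :=
  -- The fourth entry is read off from z d/dx instead of d/dx: constant coefficients do not detect a
  -- d/dx ↦ a'.
  coefAt k 0 1 (![0, 1, 1, 0, 2, 3] i) 0 ∘ₗ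
    LinearMap.applyₗ (mon k 0 1 (![0, 1, 0, 1, 2, 3] i) (![1, 1, 1, zc 𝕜, 1, 1] i))

theorem zeroOneCoord_apply (i : Fin 6) (T : Module.End 𝕜 (DiffOp k (0 : 𝕜) 1)) :
    zeroOneCoord k i T = coefAt k 0 1 (![0, 1, 1, 0, 2, 3] i) 0
      (T (mon k 0 1 (![0, 1, 0, 1, 2, 3] i) (![1, 1, 1, zc 𝕜, 1, 1] i))) := rfl

theorem ddx_zc_zero : (ddx 𝕜 (zc 𝕜)).1 0 = 1 := ddx_zc_eventuallyEq.eq_of_nhds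

theorem ZeroOneForm.coord {T : Module.End 𝕜 (DiffOp k (0 : 𝕜) 1)} {a b c d s₂ s₃ : 𝕜}
    (h : ZeroOneForm k T a b c d s₂ s₃) (hk : 3 ≤ k) (i : Fin 6) :
    zeroOneCoord k i T = ![a, b, c, d, s₂, s₃] i := by
  rw [zeroOneCoord_apply]
  fin_cases i
  · change coefAt k 0 1 0 0 (T (mon k 0 1 0 1)) = a
    rw [h.zero, map_add, map_smul, map_smul, coefAt_mon (by omega), coefAt_mon (by omega)]
    simp
  · change coefAt k 0 1 1 0 (T (mon k 0 1 1 1)) = b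
    rw [h.one, map_add, map_smul, map_smul, coefAt_mon (by omega), coefAt_mon (by omega)]
    simp
  · change coefAt k 0 1 1 0 (T (mon k 0 1 0 1)) = c
    rw [h.zero, map_add, map_smul, map_smul, coefAt_mon (by omega), coefAt_mon (by omega),
      mean_one]
    simp
  · change coefAt k 0 1 0 0 (T (mon k 0 1 1 (zc 𝕜))) = d
    rw [h.one, map_add, map_smul, map_smul, coefAt_mon (by omega), coefAt_mon (by omega)]
    simp [ddx_zc_zero]
  · change coefAt k 0 1 2 0 (T (mon k 0 1 2 1)) = s₂
    rw [h.two, map_smul, coefAt_mon (by omega)]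
    simp
  · change coefAt k 0 1 3 0 (T (mon k 0 1 3 1)) = s₃
    rw [h.three, map_smul, coefAt_mon (by omega)]
    simp

/-- No product of an entry c with an entry d appears, because the integral of a derivative and the
derivative of a constant both vanish. What remains is the multiplication of `AlgB`. -/
theorem ZeroOneForm.mul {S T : Module.End 𝕜 (DiffOp k (0 : 𝕜) 1)}
    {a b c d s₂ s₃ a' b' c' d' s₂' s₃' : 𝕜} (hS : ZeroOneForm k S a b c d s₂ s₃)
    (hT : ZeroOneForm k T a' b' c' d' s₂' s₃') :
    ZeroOneForm k (S * T) (a * a') (b * b') (c * a' + b * c') (a * d' + d * b') (s₂ * s₂')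
      (s₃ * s₃') where
  zero φ := by
    rw [Module.End.mul_apply, hT.zero, map_add, map_smul, map_smul, hS.zero, hS.one, ddx_one,
      map_zero, smul_zero, add_zero]
    module
  one φ := by
    rw [Module.End.mul_apply, hT.one, map_add, map_smul, map_smul, hS.zero, hS.one, mean_ddx]
    module
  two := by rw [Module.End.mul_apply, hT.two, map_smul, hS.two, smul_smul, mul_comm]
  three := by rw [Module.End.mul_apply, hT.three, map_smul, hS.three, smul_smul, mul_comm]

theorem exists_zeroOneForm (hk : 3 ≤ k) {T : Module.End 𝕜 (DiffOp k (0 : 𝕜) 1)}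
    (hT : T ∈ SymmAlg k (0 : 𝕜) 1) : ∃ a b c d s₂ s₃, ZeroOneForm k T a b c d s₂ s₃ := by
  obtain ⟨t, c, -, rfl⟩ := exists_eq_locOp_add_meanOne (by omega) hT
  exact ⟨_, _, _, _, _, _, zeroOneForm_locOp_add hk t c⟩

theorem eq_zero_of_zeroOneCoord (hk : 5 ≤ k) {T : Module.End 𝕜 (DiffOp k (0 : 𝕜) 1)}
    (hT : T ∈ SymmAlg k (0 : 𝕜) 1) (h : ∀ i, zeroOneCoord k i T = 0) : T = 0 := by
  obtain ⟨t, c, ht, rfl⟩ := exists_eq_locOp_add_meanOne (by omega) hT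
  have h' := fun i => ((zeroOneForm_locOp_add (by omega) t c).coord (by omega) i).symm.trans (h i)
  have hc : c = 0 := h' 2
  have hr := locRel_of_mem ht
  rw [sub_zero] at hr
  rw [locOp_eq_zero (LocRel.eq_zero_of_zero_one hr hk (h' 0) (h' 1) (h' 4) (h' 5) (h' 3)), hc,
    zero_smul, add_zero]

theorem zeroOneCoord_of_eigen (hk : 3 ≤ k) {T : Module.End 𝕜 (DiffOp k (0 : 𝕜) 1)} {s : ℕ → 𝕜}
    (h : ∀ i ≤ 3, T (mon k 0 1 i 1) = s i • mon k 0 1 i 1) {i : Fin 6} (hi : i ≠ 3) :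
    zeroOneCoord k i T = ![s 0, s 1, 0, 0, s 2, s 3] i := by
  have h' : ∀ i ≤ 3, ∀ l ≤ 3, coefAt k 0 1 l 0 (T (mon k 0 1 i 1)) = if l = i then s i else 0 :=
    fun i hi l hl => by
      rw [h i hi, map_smul, coefAt_mon (by omega), one_val]
      simp
  rw [zeroOneCoord_apply]
  fin_cases i
  · exact h' 0 (by omega) 0 (by omega)
  · exact h' 1 (by omega) 1 (by omega)
  · exact h' 0 (by omega) 1 (by omega)
  · exact absurd rfl hi
  · exact h' 2 (by omega) 2 (by omega)
  · exact h' 3 (by omega) 3 (by omega)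

theorem zeroOneForm_meanOne (hk : 3 ≤ k) :
    ZeroOneForm k ((meanOne k (0 : 𝕜) 1).smulRight (mon k (0 : 𝕜) 1 1 1)) 0 0 1 0 0 0 where
  zero φ := by
    rw [LinearMap.smulRight_apply, meanOne_mon (Nat.zero_le k), if_pos rfl, zero_smul, zero_add,
      one_mul]
  one φ := by
    rw [LinearMap.smulRight_apply, meanOne_mon (by omega), if_neg one_ne_zero, zero_smul, zero_smul,
      zero_smul, add_zero]
  two := by
    rw [LinearMap.smulRight_apply, meanOne_mon (by omega), if_neg two_ne_zero, zero_smul, zero_smul]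
  three := by
    rw [LinearMap.smulRight_apply, meanOne_mon (by omega), if_neg three_ne_zero, zero_smul,
      zero_smul]

/-- The projection to order zero for (0, 0) is transported by the adjoint to (1, 1) and then lifted
to (0, 1), which raises the order by one. The fourth entry is left undetermined; it can be corrected
afterwards. -/
theorem exists_mem_zeroOneCoord_first (hk : 3 ≤ k) : ∃ T ∈ SymmAlg k (0 : 𝕜) 1,
    ∀ i ≠ 3, zeroOneCoord k i T = ![0, 1, 0, 0, 0, 0] i := by
  obtain ⟨m, rfl⟩ : ∃ m, k = m + 1 := ⟨k - 1, by omega⟩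
  obtain ⟨P, hP, hPm⟩ := exists_mem_symmAlg_proj (𝕜 := 𝕜) m 0
  obtain ⟨P', hP', hPm'⟩ := exists_mem_symmAlg_conj (lam' := 1) (mu' := 1) (by ring) (by ring) hP
  obtain ⟨F, hF, hFz, hFm⟩ := exists_mem_symmAlg_lift hP'
  refine ⟨F, hF, fun i hi => zeroOneCoord_of_eigen hk (s := fun i : ℕ => if i = 1 then 1 else 0)
    (fun i hi => ?_) hi⟩
  rcases i with _ | i
  · rw [hFz, if_neg zero_ne_one, zero_smul]
  · rw [hFm i (by omega) _ (hPm' i (by omega) _ (hPm i (by omega) 1))]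
    simp

/-- The adjoint for (1, 0) is lifted to (0, 0), transported to (1, 1) and lifted to (0, 1). Each
lift raises the order by one, so the signs start at order 2. -/
theorem exists_mem_zeroOneCoord_sign (hk : 3 ≤ k) : ∃ T ∈ SymmAlg k (0 : 𝕜) 1,
    ∀ i ≠ 3, zeroOneCoord k i T = ![0, 0, 0, 0, 1, -1] i := by
  obtain ⟨m, rfl⟩ : ∃ m, k = m + 1 + 1 := ⟨k - 2, by omega⟩
  obtain ⟨C₀, hC₀, hCm₀⟩ := exists_mem_symmAlg_sign (𝕜 := 𝕜) (lam := 1) (mu := 0) m (by ring)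
  obtain ⟨C₁, hC₁, hCz₁, hCm₁⟩ := exists_mem_symmAlg_lift hC₀
  obtain ⟨C₂, hC₂, hCm₂⟩ :=
    exists_mem_symmAlg_conj (lam' := 1) (mu' := 1) (by ring) (by ring) hC₁
  obtain ⟨C, hC, hCz, hCm⟩ := exists_mem_symmAlg_lift hC₂
  refine ⟨C, hC, fun i hi => (zeroOneCoord_of_eigen hk
    (s := fun i : ℕ => if i ≤ 1 then 0 else (-1) ^ i) (fun i hi => ?_) hi).trans ?_⟩
  · rcases i with _ | _ | i
    · rw [hCz, if_pos zero_le_one, zero_smul]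
    · rw [hCm 0 (by omega) 0 (hCm₂ 0 (by omega) 0 (by rw [hCz₁, zero_smul])), if_pos le_rfl]
    · rw [hCm (i + 1) (by omega) _ (hCm₂ (i + 1) (by omega) _ (hCm₁ i (by omega) _
        (hCm₀ i (by omega)))), if_neg (by omega), pow_succ, pow_succ, mul_neg_one, mul_neg_one,
        neg_neg]
  · have h : (-1 : 𝕜) ^ 3 = -1 := by norm_num
    simp [h]

theorem exists_mem_zeroOneCoord_deriv (hk : 3 ≤ k) : ∃ T ∈ SymmAlg k (0 : 𝕜) 1,
    ∀ i, zeroOneCoord k i T = ![0, 0, 0, 1, 0, 0] i := by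
  obtain ⟨m, rfl⟩ : ∃ m, k = m + 1 := ⟨k - 1, by omega⟩
  obtain ⟨N, hN, hNm, hNd⟩ := exists_mem_symmAlg_deriv (𝕜 := 𝕜) m
  refine ⟨N, hN, fun i => ?_⟩
  by_cases hi : i = 3
  · subst hi
    change coefAt (m + 1) 0 1 0 0 (N (mon (m + 1) 0 1 1 (zc 𝕜))) = 1
    rw [hNd, coefAt_mon (Nat.zero_le _), if_pos rfl, ddx_zc_zero]
  · rw [zeroOneCoord_of_eigen hk (s := fun _ => 0)
      (fun i hi => by rw [hNm i (by omega), zero_smul]) hi]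
    fin_cases i <;> first | rfl | exact absurd rfl hi

/-- Symmetries of `D^k_{0,1}` with arbitrary entries exist. -/
theorem exists_mem_zeroOneCoord_eq (hk : 3 ≤ k) (v : Fin 6 → 𝕜) :
    ∃ T ∈ SymmAlg k (0 : 𝕜) 1, ∀ i, zeroOneCoord k i T = v i := by
  obtain ⟨E, hE, hEm⟩ := exists_mem_symmAlg_proj (𝕜 := 𝕜) k 1
  obtain ⟨F, hF, hFi⟩ := exists_mem_zeroOneCoord_first (𝕜 := 𝕜) hk
  obtain ⟨C, hC, hCi⟩ := exists_mem_zeroOneCoord_sign (𝕜 := 𝕜) hk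
  obtain ⟨N, hN, hNi⟩ := exists_mem_zeroOneCoord_deriv (𝕜 := 𝕜) hk
  have hJ := meanOne_smulRight_mem (𝕜 := 𝕜) (k := k) (by omega)
  have hJi := (zeroOneForm_meanOne (𝕜 := 𝕜) hk).coord hk
  generalize (meanOne k (0 : 𝕜) 1).smulRight (mon k (0 : 𝕜) 1 1 1) = J at hJ hJi
  have hEi : ∀ i ≠ 3, zeroOneCoord k i E = ![1, 0, 0, 0, 0, 0] i := fun i hi =>
    zeroOneCoord_of_eigen hk (s := fun i => if i = 0 then 1 else 0)
      (fun i hi => hEm i (by omega) 1) hi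
  have hIi : ∀ i ≠ 3, zeroOneCoord k i (1 : Module.End 𝕜 (DiffOp k (0 : 𝕜) 1))
      = ![1, 1, 0, 0, 1, 1] i := fun i hi => zeroOneCoord_of_eigen hk (s := fun _ => 1)
        (fun i hi => by rw [Module.End.one_apply, one_smul]) hi
  obtain ⟨R, hR, hRi⟩ : ∃ R ∈ SymmAlg k (0 : 𝕜) 1, ∀ i ≠ 3, zeroOneCoord k i R = v i := by
    refine ⟨(v 0 - (v 4 + v 5) / 2) • E + (v 1 - (v 4 + v 5) / 2) • F + ((v 4 + v 5) / 2) • 1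
      + ((v 4 - v 5) / 2) • C + v 2 • J, Subalgebra.add_mem _ (Subalgebra.add_mem _
      (Subalgebra.add_mem _ (Subalgebra.add_mem _ (Subalgebra.smul_mem _ hE _)
      (Subalgebra.smul_mem _ hF _)) (Subalgebra.smul_mem _ (Subalgebra.one_mem _) _))
      (Subalgebra.smul_mem _ hC _)) (Subalgebra.smul_mem _ hJ _), fun i hi => ?_⟩
    simp only [map_add, map_smul, hEi i hi, hFi i hi, hCi i hi, hJi, hIi i hi, smul_eq_mul]
    clear * - hi
    fin_cases i
    · simp
    · simp
    · simp
    · exact absurd rfl hi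
    · change _ = v 4
      norm_num
      ring
    · change _ = v 5
      norm_num
      ring
  -- N changes the fourth entry only, so it supplies the missing correction.
  refine ⟨R + (v 3 - zeroOneCoord k 3 R) • N,
    Subalgebra.add_mem _ hR (Subalgebra.smul_mem _ hN _), fun i => ?_⟩
  rw [map_add, map_smul, smul_eq_mul, hNi]
  by_cases hi : i = 3
  · subst hi
    simp
  · rw [hRi i hi]
    clear * - hi
    fin_cases i
    · simp
    · simp
    · simp
    · exact absurd rfl hi
    · simp
    · simp

variable (k) in
/-- The entries of a symmetry of `D^k_{0,1}`, as an element of `𝔟 ⊕ 𝕜²`. -/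
def zeroOneMap : SymmAlg k (0 : 𝕜) 1 →ₗ[𝕜] (AlgB 𝕜 × (Fin 2 → 𝕜)) :=
  algBProdMk ∘ₗ LinearMap.pi (zeroOneCoord k) ∘ₗ (SymmAlg k (0 : 𝕜) 1).val.toLinearMap

theorem zeroOneMap_apply_eq {T : SymmAlg k (0 : 𝕜) 1} {v : Fin 6 → 𝕜}
    (h : ∀ i, zeroOneCoord k i T.1 = v i) : zeroOneMap k T = algBProdMk v :=
  congrArg algBProdMk (funext h)

theorem zeroOneForm_one : ZeroOneForm k (1 : Module.End 𝕜 (DiffOp k (0 : 𝕜) 1)) 1 1 0 0 1 1 where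
  zero φ := by rw [zero_mul, zero_smul, one_smul, add_zero, Module.End.one_apply]
  one φ := by rw [zero_smul, one_smul, add_zero, Module.End.one_apply]
  two := by rw [one_smul, Module.End.one_apply]
  three := by rw [one_smul, Module.End.one_apply]

theorem zeroOneMap_one (hk : 3 ≤ k) : zeroOneMap k (1 : SymmAlg k (0 : 𝕜) 1) = 1 :=
  (zeroOneMap_apply_eq (T := 1) (zeroOneForm_one.coord hk)).trans algBProdMk_one

theorem zeroOneMap_mul (hk : 3 ≤ k) (S T : SymmAlg k (0 : 𝕜) 1) :
    zeroOneMap k (S * T) = zeroOneMap k S * zeroOneMap k T := by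
  obtain ⟨a, b, c, d, s₂, s₃, hS⟩ := exists_zeroOneForm hk S.2
  obtain ⟨a', b', c', d', s₂', s₃', hT⟩ := exists_zeroOneForm hk T.2
  have h1 := zeroOneMap_apply_eq (hS.coord hk)
  have h2 := zeroOneMap_apply_eq (hT.coord hk)
  have h3 := zeroOneMap_apply_eq (T := S * T) ((hS.mul hT).coord hk)
  exact h3.trans ((algBProdMk_mul _ _ _ _ _ _ _ _ _ _ _ _).trans (congrArg₂ _ h1.symm h2.symm))

theorem zeroOneMap_injective (hk : 5 ≤ k) : Function.Injective (zeroOneMap (𝕜 := 𝕜) k) :=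
  symmAlg_injective_of_forall_eq_zero fun T hT =>
    Subtype.ext (eq_zero_of_zeroOneCoord hk T.2 (algBProdMk_eq_zero hT))

theorem zeroOneMap_surjective (hk : 3 ≤ k) : Function.Surjective (zeroOneMap (𝕜 := 𝕜) k) :=
  fun x => by
    obtain ⟨v, rfl⟩ := algBProdMk_surjective x
    obtain ⟨T, hT, hTi⟩ := exists_mem_zeroOneCoord_eq hk v
    exact ⟨⟨T, hT⟩, zeroOneMap_apply_eq hTi⟩

theorem nonempty_symmAlg_zero_one_equiv (hk : 5 ≤ k) :
    Nonempty (SymmAlg k (0 : 𝕜) 1 ≃ₐ[𝕜] (AlgB 𝕜 × (Fin 2 → 𝕜))) :=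
  ⟨AlgEquiv.ofBijective (AlgHom.ofLinearMap (zeroOneMap k) (zeroOneMap_one (by omega))
    (zeroOneMap_mul (by omega))) ⟨zeroOneMap_injective hk, zeroOneMap_surjective (by omega)⟩⟩

end ZeroOne

end

/-! ### Assembly of the cases -/

noncomputable section

variable {𝕜 : Type*} [RCLike 𝕜]

theorem nonempty_symmAlg_equiv_pi_two {k : ℕ} (hk : 5 ≤ k) {lam mu : 𝕜}
    (h : (lam + mu = 1 ∧ lam ≠ 0) ∨ (lam = 0 ∧ mu ≠ 1 ∧ mu ≠ 0) ∨
      (mu = 1 ∧ lam ≠ 1 ∧ lam ≠ 0)) : Nonempty (SymmAlg k lam mu ≃ₐ[𝕜] (Fin 2 → 𝕜)) := by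
  obtain ⟨h1, h2⟩ | ⟨rfl, h1, h2⟩ | ⟨rfl, h1, h2⟩ := h
  · exact nonempty_symmAlg_equiv_of_add_eq_one hk h1 h2
  · exact nonempty_symmAlg_zero_equiv hk h2 h1
  · exact nonempty_symmAlg_equiv_one hk h2 h1

/-- The algebra of symmetries does not depend on the order. -/
theorem nonempty_symmAlg_equiv_symmAlg {k l : ℕ} (hk : 5 ≤ k) (hl : 5 ≤ l) (lam mu : 𝕜) :
    Nonempty (SymmAlg k lam mu ≃ₐ[𝕜] SymmAlg l lam mu) := by
  by_cases h2 : (lam + mu = 1 ∧ lam ≠ 0) ∨ (lam = 0 ∧ mu ≠ 1 ∧ mu ≠ 0) ∨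
      (mu = 1 ∧ lam ≠ 1 ∧ lam ≠ 0)
  · obtain ⟨e⟩ := nonempty_symmAlg_equiv_pi_two hk h2
    obtain ⟨e'⟩ := nonempty_symmAlg_equiv_pi_two hl h2
    exact ⟨e.trans e'.symm⟩
  by_cases h0 : lam = 0
  · subst h0
    by_cases hm : mu = 1
    · subst hm
      obtain ⟨e⟩ := nonempty_symmAlg_zero_one_equiv (𝕜 := 𝕜) hk
      obtain ⟨e'⟩ := nonempty_symmAlg_zero_one_equiv (𝕜 := 𝕜) hl
      exact ⟨e.trans e'.symm⟩
    · obtain rfl : mu = 0 := by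
        by_contra h
        exact h2 (.inr (.inl ⟨rfl, hm, h⟩))
      obtain ⟨e⟩ := nonempty_symmAlg_zero_zero_equiv (𝕜 := 𝕜) hk
      obtain ⟨e'⟩ := nonempty_symmAlg_zero_zero_equiv (𝕜 := 𝕜) hl
      exact ⟨e.trans e'.symm⟩
  · have hadd : lam + mu ≠ 1 := fun h => h2 (.inl ⟨h, h0⟩)
    by_cases hm : mu = 1
    · subst hm
      obtain rfl : lam = 1 := by
        by_contra h
        exact h2 (.inr (.inr ⟨rfl, h, h0⟩))
      obtain ⟨e⟩ := nonempty_symmAlg_one_one_equiv (𝕜 := 𝕜) hk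
      obtain ⟨e'⟩ := nonempty_symmAlg_one_one_equiv (𝕜 := 𝕜) hl
      exact ⟨e.trans e'.symm⟩
    · obtain ⟨e⟩ := nonempty_symmAlg_equiv_of_generic hk hadd h0 hm
      obtain ⟨e'⟩ := nonempty_symmAlg_equiv_of_generic hl hadd h0 hm
      exact ⟨e.trans e'.symm⟩

end

theorem theorem3p1 {𝕜 : Type*} [RCLike 𝕜] (k : ℕ) (hk : 5 ≤ k) :
    (∀ lam mu : 𝕜, lam + mu ≠ 1 → lam ≠ 0 → mu ≠ 1 → SymmAlg k lam mu = ⊥) ∧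
    (∀ lam mu : 𝕜,
      ((lam + mu = 1 ∧ lam ≠ 0) ∨ (lam = 0 ∧ mu ≠ 1 ∧ mu ≠ 0) ∨
        (mu = 1 ∧ lam ≠ 1 ∧ lam ≠ 0)) →
      Nonempty (SymmAlg k lam mu ≃ₐ[𝕜] (Fin 2 → 𝕜))) ∧
    Nonempty (SymmAlg k (0 : 𝕜) 0 ≃ₐ[𝕜] (Fin 3 → 𝕜)) ∧
    Nonempty (SymmAlg k (1 : 𝕜) 1 ≃ₐ[𝕜] (Fin 3 → 𝕜)) ∧
    Nonempty (SymmAlg k (0 : 𝕜) 1 ≃ₐ[𝕜] (AlgB 𝕜 × (Fin 2 → 𝕜))) ∧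
    (∀ (l : ℕ), 5 ≤ l → ∀ lam mu : 𝕜, Nonempty (SymmAlg k lam mu ≃ₐ[𝕜] SymmAlg l lam mu)) := by
  exact ⟨fun _ _ => symmAlg_eq_bot hk, fun _ _ => nonempty_symmAlg_equiv_pi_two hk,
    nonempty_symmAlg_zero_zero_equiv hk, nonempty_symmAlg_one_one_equiv hk,
    nonempty_symmAlg_zero_one_equiv hk, fun _ => nonempty_symmAlg_equiv_symmAlg hk⟩
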